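/- **Setting.** Let $N,m\in\mathbb N$, $T>0$. For $k=1,\dots,N$ consider $$\partial_t\rho^k+\partial_xF_k(\rho^k,\omega*\boldsymbol\rho)=S_k(\boldsymbol\rho,\omega*\boldsymbol\rho),\qquad \boldsymbol\rho(0,\cdot)=\boldsymbol\rho_0,\qquad (\omega*\boldsymbol\rho)_\ell(t,x)=\sum_{k=1}^N\int_{\mathbb R}\omega^{\ell,k}(y-x)\rho^k(t,y)\,dy,\quad \ell=1,\dots,m,$$ with $F_k:\mathbb R\times\mathbb R^m\to\mathbb R$ and $S_k:\mathbb R^N\times\mathbb R^m\to\mathbb R$. Assume that there are $0\le\rho_m<\rho_M$ such that for all $k,\ell$: * $F_k(\rho,R)=\rho V_k(R)$; $F_k(\rho_m,R)=0$ for all $R\in\mathbb R^m$; $|F_k(\rho,R)-F_k(\rho',R')|\le L_F\big(|\rho-\rho'|+\sum_\ell|R_\ell-R'_\ell|\big)$ for $\rho,\rho'\in[-\rho_M,\rho_M]$, $R,R'\in[-N\rho_M,N\rho_M]^m$; $V_k$ is Lipschitz on $[-N\rho_M,N\rho_M]^m$; * $S_k((\rho_m,\dots,\rho_m),R)=0$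 for all $R\in\mathbb R^m$; $S_k$ is Lipschitz on $[-\rho_M,\rho_M]^N\times[-N\rho_M,N\rho_M]^m$; for each $R$, the map $\boldsymbol\rho\mapsto S_k(\boldsymbol\rho,R)$ is affine (all $\partial_{\rho^j}S_k$ are independent of $\boldsymbol\rho$); * $\boldsymbol\rho_0\in L^\infty(\mathbb R;\mathbb R^N)$, $\rho_m\le\rho_0^k$ a.e. and $\operatorname{ess\,sup}\rho^k_0<\rho_M$; * $\omega^{\ell,k}:\mathbb R\to[0,\infty)$ is integrable and of bounded variation, $\int\omega^{\ell,k}=1$, $0\in\operatorname{supp}\omega^{\ell,k}$. **Scheme.** Let $\Delta x,\Delta t>0$, $\lambda=\Delta t/\Delta x$, $C>0$, $\delta\in(0,1)$, $x_j=j\Delta x$, $t^n=n\Delta t$. Let $\operatorname{minmod}$ of several numbers be the one of smallest modulus if all have the same strict sign, and $0$ otherwise. For a grid function $v$ put $$D_j(v)=\operatorname{minmod}\big(v_{j+1}-v_j,\ v_j-v_{j-1},\ \operatorname{sign}(v_j-v_{j-1})\,C\Delta x^\delta\big).$$ Start from $\rho_j^{k,0}=\frac1{\Delta x}\int_{x_{j-1/2}}^{x_{j+1/2}}\rho_0^k\,dx$.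 Given $\boldsymbol\rho^n$, let $\Delta x\,s_j^{k,n}=D_j(\rho^{k,n})$, $\tilde\rho_j^{k,n}(x)=\rho_j^{k,n}+s_j^{k,n}(x-x_j)$, and let $R_j^{\ell,n}=\sum_kR_j^{\ell,k,n}$ be given by the following quadrature. Write $w=\omega^{\ell,k}$, let $[\eta_1,\eta_2]$ be the smallest closed interval containing $\operatorname{supp}w$, $N_1=\lceil|\eta_1|/\Delta x\rceil$, $N_2=\lceil\eta_2/\Delta x\rceil$, and let $h_1=(\tfrac12-N_1)\Delta x-\eta_1$, $\mu_1=\frac12\big(\eta_1+(\tfrac12-N_1)\Delta x\big)$ and $h_2=\eta_2-(N_2-\tfrac12)\Delta x$, $\mu_2=\frac12\big((N_2-\tfrac12)\Delta x+\eta_2\big)$ be the (signed) lengths and the midpoints of the two end pieces $[\eta_1,(\frac12-N_1)\Delta x]$ and $[(N_2-\frac12)\Delta x,\eta_2]$. Then $$R_j^{\ell,k,n}=h_1w(\mu_1)\,\tilde\rho^{k,n}_{j-N_1}(x_j+\mu_1)+\Delta x\sum_{-N_1<i<N_2}\rho^{k,n}_{j+i}\,w(i\Delta x)+h_2w(\mu_2)\,\tilde\rho^{k,n}_{j+N_2}(x_j+\mu_2).$$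 If $\eta_1=-\infty$ or $\eta_2=+\infty$, the corresponding end term and the corresponding bound on $i$ are dropped. (If $\eta_1/\Delta x$ and $\eta_2/\Delta x$ are integers, then $h_1=h_2=\Delta x/2$, $\mu_1=\frac{\Delta x}4-N_1\Delta x$, $\mu_2=N_2\Delta x-\frac{\Delta x}4$.) Next put $$\Delta x\,\sigma_j^{k,n}=D_j\big(F_k(\rho^{k,n}_\cdot,\boldsymbol R^n_\cdot)\big),\qquad q_j^{k,n}=S_k(\boldsymbol\rho_j^n,\boldsymbol R_j^n)-\sigma_j^{k,n},\qquad \rho_j^{k,n+1/2}=\rho_j^{k,n}+\tfrac{\Delta t}2q_j^{k,n},\qquad R_j^{\ell,n+1/2}=R_j^{\ell,n}+\tfrac{\Delta t}2\sum_kR_{t,j}^{\ell,k,n},$$ where $R_{t,j}^{\ell,k,n}$ is obtained from the quadrature formula by replacing $\tilde\rho^{k,n}_{j-N_1}(x_j+\mu_1)$, $\rho^{k,n}_{j+i}$, $\tilde\rho^{k,n}_{j+N_2}(x_j+\mu_2)$ by $q^{k,n}_{j-N_1}$, $q^{k,n}_{j+i}$, $q^{k,n}_{j+N_2}$. With $F_j^k=F_k(\rho_j^{k,n+1/2},\boldsymbol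 R_j^{n+1/2})$ and $S_j^k=S_k(\boldsymbol\rho_j^{n+1/2},\boldsymbol R_j^{n+1/2})$ let $$\rho_{j+1/2}^{k,n+1}=\tfrac12(\rho_j^{k,n}+\rho_{j+1}^{k,n})+\tfrac{\Delta x}8(s_j^{k,n}-s_{j+1}^{k,n})-\lambda(F_{j+1}^k-F_j^k)+\tfrac{\Delta t}2(S_{j+1}^k+S_j^k),$$ $\Delta x\,s_{j+1/2}^{k,n+1}=D_{j+1/2}(\rho^{k,n+1}_{\cdot+1/2})$ (the same formula on the staggered grid), and $$\rho_j^{k,n+1}=\tfrac14(\rho_{j-1}^{k,n}+2\rho_j^{k,n}+\rho_{j+1}^{k,n})-\tfrac{\Delta x}{16}(s_{j+1}^{k,n}-s_{j-1}^{k,n})-\tfrac{\Delta x}8(s_{j+1/2}^{k,n+1}-s_{j-1/2}^{k,n+1})-\tfrac\lambda2(F_{j+1}^k-F_{j-1}^k)+\tfrac{\Delta t}4(S_{j+1}^k+2S_j^k+S_{j-1}^k).$$ The approximate solution is $\rho_\Delta^k(t,x)=\rho_j^{k,n}+s_j^{k,n}(x-x_j)$ for $t\in[t^n,t^{n+1})$,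 $x\in[x_{j-1/2},x_{j+1/2})$. **Weak solution.** $\boldsymbol\rho\in L^\infty((0,T^*)\times\mathbb R;\mathbb R^N)$ is a weak solution on $(0,T^*)$ if for all $k$ and all $\phi\in C^1_c((-42,T^*)\times\mathbb R)$ the following integrals exist and $$\int_{\mathbb R}\rho_0^k\,\phi(0,x)\,dx+\int_0^{T^*}\!\!\int_{\mathbb R}\Big(\rho^k\phi_t+F_k(\rho^k,\omega*\boldsymbol\rho)\phi_x+S_k(\boldsymbol\rho,\omega*\boldsymbol\rho)\phi\Big)\,dx\,dt=0.$$ **Theorem.** There is $T^*\in(0,T]$ such that the following holds for all $C>0$, $\delta\in(0,1)$ and all sequences of step sizes $\Delta x_i\to0$, $\Delta t_i\to0$ that satisfy the CFL condition $\frac{\Delta t_i}{\Delta x_i}L_F\le\frac{\sqrt2-1}2$ and whose ratios $\Delta t_i/\Delta x_i$ are bounded away from $0$ (for example, constant). There are a subsequence of the approximate solutions $\boldsymbol\rho_{\Delta_i}$ and a function $\boldsymbol\rho\in L^\infty((0,T^*)\times\mathbb R;\mathbb R^N)$ such that, along the subsequence, $\boldsymbol\rho_{\Delta_i}\in L^\infty((0,T^*)\times\mathbb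 R;\mathbb R^N)$ and $\boldsymbol\rho_{\Delta_i}\to\boldsymbol\rho$ weakly-$*$ in $L^\infty((0,T^*)\times\mathbb R;\mathbb R^N)$, and $\boldsymbol\rho$ is a weak solution on $(0,T^*)$. -/

import Mathlib

open Set Filter Topology MeasureTheory
open scoped ENNReal

noncomputable section

namespace NonlocalNT

/-- The data of a system of `N` nonlocal balance laws
`∂ₜ ρᵏ + ∂ₓ Fₖ(ρᵏ, ω ∗ ρ) = Sₖ(ρ, ω ∗ ρ)`, `ρ(0, ·) = ρ₀`, with `m` nonlocal quantities. -/
structure BalanceSystem (N m : ℕ) where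
  kernel : Fin m → Fin N → ℝ → ℝ
  flux : Fin N → ℝ → (Fin m → ℝ) → ℝ
  source : Fin N → (Fin N → ℝ) → (Fin m → ℝ) → ℝ
  initial : ℝ → Fin N → ℝ

variable {N m : ℕ}

/-- The box `[-b, b]^ι`. -/
def box {ι : Type} (b : ℝ) : Set (ι → ℝ) := {v | ∀ i, v i ∈ Icc (-b) b}

/-- Flux and source vanish at `ρm` and are Lipschitz for densities in `[-ρM, ρM]` and nonlocal
quantities in `[-N ρM, N ρM]^m` (the sums of `N` averages of such densities), the flux with
constant `LF`; the initial densities lie in `[ρm, ρM)`, with essential supremum below `ρM`; the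
kernels are nonnegative, integrable and of bounded variation, have unit integral, and `0` lies in
their support. -/
structure BaseAssumption (P : BalanceSystem N m) (ρm ρM LF : ℝ) : Prop where
  rhom_nonneg : 0 ≤ ρm
  rhom_lt_rhoM : ρm < ρM
  LF_nonneg : 0 ≤ LF
  flux_rhom : ∀ k R, P.flux k ρm R = 0
  flux_lip : ∀ k, ∀ r ∈ Icc (-ρM) ρM, ∀ r' ∈ Icc (-ρM) ρM,
    ∀ R ∈ box (N * ρM), ∀ R' ∈ box (N * ρM),
      |P.flux k r R - P.flux k r' R'| ≤ LF * (|r - r'| + ∑ l, |R l - R' l|)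
  source_rhom : ∀ k R, P.source k (fun _ => ρm) R = 0
  source_lip : ∃ LS : ℝ, ∀ k, ∀ r ∈ box ρM, ∀ r' ∈ box ρM,
    ∀ R ∈ box (N * ρM), ∀ R' ∈ box (N * ρM),
      |P.source k r R - P.source k r' R'| ≤ LS * (∑ i, |r i - r' i| + ∑ l, |R l - R' l|)
  initial_mem : MemLp P.initial ∞ volume
  initial_range : ∃ b < ρM, ∀ᵐ x, ∀ k, P.initial x k ∈ Icc ρm b
  kernel_nonneg : ∀ l k x, 0 ≤ P.kernel l k x
  kernel_integrable : ∀ l k, Integrable (P.kernel l k)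
  kernel_bv : ∀ l k, BoundedVariationOn (P.kernel l k) univ
  kernel_support : ∀ l k, (0 : ℝ) ∈ tsupport (P.kernel l k)
  kernel_integral : ∀ l k, ∫ x, P.kernel l k x = 1

/-- In addition, `Fₖ(ρ, R) = ρ Vₖ(R)` with `Vₖ` Lipschitz, and the partial derivatives of
`Sₖ(ρ, R)` with respect to the densities do not depend on `ρ`. -/
structure LinearAssumption (P : BalanceSystem N m) (ρm ρM LF : ℝ) : Prop
    extends BaseAssumption P ρm ρM LF where
  flux_linear : ∃ V : Fin N → (Fin m → ℝ) → ℝ, (∀ k r R, P.flux k r R = r * V k R) ∧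
    ∀ k, ∃ K, LipschitzOnWith K (V k) (box (N * ρM))
  source_linear : ∀ k R, ∃ (a : Fin N → ℝ) (b : ℝ), ∀ r, P.source k r R = ∑ i, a i * r i + b

/-! ### Weak solutions -/

/-- `(0, T) × ℝ` -/
def strip (T : ℝ) : Set (ℝ × ℝ) := Ioo 0 T ×ˢ univ

/-- `u ∈ L^∞((0, T) × ℝ; ℝ^N)` -/
def MemLinf (T : ℝ) (u : ℝ → ℝ → Fin N → ℝ) : Prop :=
  MemLp (fun p : ℝ × ℝ => u p.1 p.2) ∞ (volume.restrict (strip T))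

/-- `(ω ∗ ρ)_l (t, x) = ∑ₖ ∫ ω^{l,k}(y - x) ρᵏ(t, y) dy` -/
def nonlocal (ω : Fin m → Fin N → ℝ → ℝ) (u : ℝ → ℝ → Fin N → ℝ) (t x : ℝ) : Fin m → ℝ :=
  fun l => ∑ k, ∫ y, ω l k (y - x) * u t y k

/-- `φ ∈ C¹_c((-42, T) × ℝ)`, extended by zero. -/
structure IsTestFunction (T : ℝ) (φ : ℝ → ℝ → ℝ) : Prop where
  contDiff : ContDiff ℝ 1 (Function.uncurry φ)
  compact : HasCompactSupport (Function.uncurry φ)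
  support : tsupport (Function.uncurry φ) ⊆ Ioo (-42) T ×ˢ univ

/-- Weak solutions on `(0, T) × ℝ`; that the integrals exist is part of the definition. -/
structure IsWeakSolution (P : BalanceSystem N m) (T : ℝ) (u : ℝ → ℝ → Fin N → ℝ) : Prop where
  memLinf : MemLinf T u
  flux_integrable : ∀ k φ, IsTestFunction T φ → IntegrableOn (fun p : ℝ × ℝ =>
    P.flux k (u p.1 p.2 k) (nonlocal P.kernel u p.1 p.2) * deriv (fun x => φ p.1 x) p.2) (strip T)
  source_integrable : ∀ k φ, IsTestFunction T φ → IntegrableOn (fun p : ℝ × ℝ =>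
    φ p.1 p.2 * P.source k (u p.1 p.2) (nonlocal P.kernel u p.1 p.2)) (strip T)
  weak_form : ∀ k φ, IsTestFunction T φ →
    (∫ x, P.initial x k * φ 0 x)
      + (∫ p in strip T, u p.1 p.2 k * deriv (fun t => φ t p.2) p.1)
      + (∫ p in strip T,
          P.flux k (u p.1 p.2 k) (nonlocal P.kernel u p.1 p.2) * deriv (fun x => φ p.1 x) p.2)
      + (∫ p in strip T,
          φ p.1 p.2 * P.source k (u p.1 p.2) (nonlocal P.kernel u p.1 p.2)) = 0

/-- Weak-∗ convergence in `L^∞((0, T) × ℝ; ℝ^N)`. -/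
structure WeakStarTendsto (T : ℝ) (u : ℕ → ℝ → ℝ → Fin N → ℝ) (v : ℝ → ℝ → Fin N → ℝ) :
    Prop where
  seq_mem : ∀ i, MemLinf T (u i)
  lim_mem : MemLinf T v
  tendsto : ∀ (k : Fin N) (g : ℝ × ℝ → ℝ), IntegrableOn g (strip T) →
    Tendsto (fun i => ∫ p in strip T, u i p.1 p.2 k * g p) atTop
      (𝓝 (∫ p in strip T, v p.1 p.2 k * g p))

/-! ### The Nessyahu–Tadmor scheme -/

def minmod (a b : ℝ) : ℝ := if a * b ≤ 0 then 0 else if |a| ≤ |b| then a else b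

def minmod₃ (a b c : ℝ) : ℝ := minmod (minmod a b) c

/-- The step sizes `Δx`, `Δt` and the parameters `C`, `δ` of the truncation of the slopes. -/
structure Grid where
  dx : ℝ
  dt : ℝ
  C : ℝ
  δ : ℝ

/-- `λ = Δt / Δx` -/
def Grid.ratio (G : Grid) : ℝ := G.dt / G.dx

/-- The truncated slope in a cell, times `Δx`; `a, v, b` are the values in the cell on the
left, in the cell and in the cell on the right. -/
def Grid.limited (G : Grid) (a v b : ℝ) : ℝ :=
  minmod₃ (b - v) (v - a) (Real.sign (v - a) * (G.C * G.dx ^ G.δ))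

section Quadrature

/-! Quadrature for `∫ f(y) w(y - x_j) dy`, with `[η₁, η₂]` the smallest closed interval that
contains the support of `w`. It is split into the cells centred at `x_{j+i}`, `-N₁ < i < N₂`, and
the end pieces `[x_j + η₁, x_{j-N₁+1/2}]` and `[x_{j+N₂-1/2}, x_j + η₂]`; the midpoint rule is used
on each piece. If `η₁ = -∞` or `η₂ = ∞`, there is no end piece on that side. If `η₁ / h` and
`η₂ / h` are integers, the end pieces are half cells, with weights `(h/2) w(h/4 - N₁ h)` and
`(h/2) w(N₂ h - h/4)` and midpoints at distance `h/4` from `x_{j-N₁}` and `x_{j+N₂}`. -/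

variable (w : ℝ → ℝ) (h : ℝ)

def eta₁ : ℝ := sInf (tsupport w)

def eta₂ : ℝ := sSup (tsupport w)

def cells₁ : ℤ := ⌈|eta₁ w| / h⌉

def cells₂ : ℤ := ⌈eta₂ w / h⌉

/-- The midpoint of the left end piece, relative to `x_j`. -/
def mid₁ : ℝ := (eta₁ w + (1 / 2 - cells₁ w h) * h) / 2

/-- The midpoint of the right end piece, relative to `x_j`. -/
def mid₂ : ℝ := ((cells₂ w h - 1 / 2) * h + eta₂ w) / 2

/-- Length of the left end piece, times the kernel at its midpoint. -/
def weight₁ : ℝ := ((1 / 2 - cells₁ w h) * h - eta₁ w) * w (mid₁ w h)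

/-- Length of the right end piece, times the kernel at its midpoint. -/
def weight₂ : ℝ := (eta₂ w - (cells₂ w h - 1 / 2) * h) * w (mid₂ w h)

open Classical in
/-- The quadrature at `x_j`, where `f i` is the value of the integrand factor used in the cell `i`,
and `f₁ i`, `f₂ i` are its values if the cell `i` carries the left or the right end piece. -/
def quadrature (f₁ f f₂ : ℤ → ℝ) (j : ℤ) : ℝ :=
  (if BddBelow (tsupport w) then weight₁ w h * f₁ (j - cells₁ w h) else 0)
    + h * (∑' i : ℤ,
        if (BddBelow (tsupport w) → -cells₁ w h < i) ∧ (BddAbove (tsupport w) → i < cells₂ w h)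
        then f (j + i) * w (i * h) else 0)
    + (if BddAbove (tsupport w) then weight₂ w h * f₂ (j + cells₂ w h) else 0)

end Quadrature

section Scheme

variable (P : BalanceSystem N m) (G : Grid) (r : ℤ → Fin N → ℝ)

/-- `s_jᵏ` -/
def slope (j : ℤ) (k : Fin N) : ℝ := G.limited (r (j - 1) k) (r j k) (r (j + 1) k) / G.dx

/-- `R_j^{l,n}` -/
def discR (j : ℤ) (l : Fin m) : ℝ :=
  ∑ k, quadrature (P.kernel l k) G.dx
    (fun i => r i k + slope G r i k * (mid₁ (P.kernel l k) G.dx + cells₁ (P.kernel l k) G.dx * G.dx))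
    (fun i => r i k)
    (fun i => r i k + slope G r i k * (mid₂ (P.kernel l k) G.dx - cells₂ (P.kernel l k) G.dx * G.dx))
    j

/-- `Fₖ(ρ_j^{k,n}, R_jⁿ)` -/
def discFlux (j : ℤ) (k : Fin N) : ℝ := P.flux k (r j k) (discR P G r j)

/-- `σᵏ(ρ_jⁿ, R_jⁿ)` -/
def fluxSlope (j : ℤ) (k : Fin N) : ℝ :=
  G.limited (discFlux P G r (j - 1) k) (discFlux P G r j k) (discFlux P G r (j + 1) k) / G.dx

/-- `Sₖ(ρ_jⁿ, R_jⁿ) - σᵏ(ρ_jⁿ, R_jⁿ)`, the approximation of `∂ₜρᵏ`. -/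
def discRate (j : ℤ) (k : Fin N) : ℝ := P.source k (r j) (discR P G r j) - fluxSlope P G r j k

/-- `ρ_j^{k,n+1/2}` -/
def halfRho (j : ℤ) (k : Fin N) : ℝ := r j k + G.dt / 2 * discRate P G r j k

/-- `R_j^{l,n+1/2}` -/
def halfR (j : ℤ) (l : Fin m) : ℝ :=
  discR P G r j l + G.dt / 2 * ∑ k, quadrature (P.kernel l k) G.dx
    (fun i => discRate P G r i k) (fun i => discRate P G r i k) (fun i => discRate P G r i k) j

def halfFlux (j : ℤ) (k : Fin N) : ℝ := P.flux k (halfRho P G r j k) (halfR P G r j)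

def halfSource (j : ℤ) (k : Fin N) : ℝ := P.source k (halfRho P G r j) (halfR P G r j)

/-- The staggered value `ρ_{j+1/2}^{k,n+1}`. -/
def staggered (j : ℤ) (k : Fin N) : ℝ :=
  (r j k + r (j + 1) k) / 2 + G.dx / 8 * (slope G r j k - slope G r (j + 1) k)
    - G.ratio * (halfFlux P G r (j + 1) k - halfFlux P G r j k)
    + G.dt / 2 * (halfSource P G r (j + 1) k + halfSource P G r j k)

/-- One step `ρⁿ ↦ ρⁿ⁺¹` of the non-staggered scheme; `slope G (staggered P G r) j k` is
`s_{j+1/2}^{k,n+1}`. -/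
def step (j : ℤ) (k : Fin N) : ℝ :=
  (r (j - 1) k + 2 * r j k + r (j + 1) k) / 4
    - G.dx / 16 * (slope G r (j + 1) k - slope G r (j - 1) k)
    - G.dx / 8 * (slope G (staggered P G r) j k - slope G (staggered P G r) (j - 1) k)
    - G.ratio / 2 * (halfFlux P G r (j + 1) k - halfFlux P G r (j - 1) k)
    + G.dt / 4 * (halfSource P G r (j + 1) k + 2 * halfSource P G r j k
        + halfSource P G r (j - 1) k)

end Scheme

/-- The values `ρ_j^{k,n}`, starting from the cell averages of the initial data. -/
def values (P : BalanceSystem N m) (G : Grid) : ℕ → ℤ → Fin N → ℝ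
  | 0 => fun j k => (1 / G.dx) *
      ∫ x in Ico (((j : ℝ) - 1 / 2) * G.dx) (((j : ℝ) + 1 / 2) * G.dx), P.initial x k
  | n + 1 => step P G (values P G n)

/-- The piecewise linear approximate solution: for `t ∈ [tⁿ, tⁿ⁺¹)` and
`x ∈ [x_{j-1/2}, x_{j+1/2})` it is `ρ_j^{k,n} + s_j^{k,n} (x - x_j)`. -/
def approx (P : BalanceSystem N m) (G : Grid) (t x : ℝ) (k : Fin N) : ℝ :=
  let n : ℕ := ⌊t / G.dt⌋₊
  let j : ℤ := ⌊x / G.dx + 1 / 2⌋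
  values P G n j k + slope G (values P G n) j k * (x - j * G.dx)

end NonlocalNT

end

noncomputable section

namespace NonlocalNT

variable {N m : ℕ}

/-! Flux and source are affine in the densities, so strong compactness of the densities is not
needed: weak-∗ convergence of the densities, combined with convergence almost everywhere of the
nonlocal quantities, is enough to pass to the limit in `F_k` and `S_k`. No bound on the total
variation of the approximations is used.

The maximum norm is controlled on a short time interval. In one step it grows by at most `growthRate
* Δt` (`abs_step_le`): every term of order one is estimated by the increment `D` between
neighbouring cells, and the CFL condition is exactly what makes these contributions add up to at
most the `D / 2` that averaging gains. The growth rate depends on the system only, not on the step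
sizes or on `C` and `δ`. Hence a time `T*` can be fixed in advance up to which all values stay below
some `β < ρM`, and flux and source are evaluated only where the assumptions hold
(`inRange_of_abs_le`, `abs_values_le`).

The nonlocal quantities converge because convolution regularises. A kernel of bounded variation
moves by `O(h)` in `L¹` under a shift by `h` (`HasOscBound`). In conservative form, the change of
the values in one step is a difference of numerical fluxes over one cell plus `Δt` times a source;
moving the difference onto the kernel shows that convolutions change by `O(Δx + Δt)`, which is
`O(Δt)` since `Δt / Δx` is bounded below (`abs_integral_step_sub_le`). So at each fixed `x` the
convolutions are Lipschitz in time up to a vanishing error. Weak-∗ convergence gives convergence of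
their time averages, and Lebesgue differentiation turns this into convergence almost everywhere
(`ae_tendsto_of_tendsto_setAverage`, `ae_tendsto_integral_kernel`). The quadrature error and the
predictor step tend to zero uniformly.

Finally the scheme is multiplied by a test function and all differences are moved onto it
(`RunBound.discrete_weak_form`). The numerical diffusion vanishes since the forward and backward
difference quotients have the same limit; the slope terms vanish since slopes times `Δx` are
truncated at `C Δx^δ`. What remains converges to the weak form (`ConvergentFamily.isWeakSolution`).
-/

/-! ### Weak-∗ compactness in `L^∞` -/

theorem integral_abs_mul_le_of_bound {α : Type*} [MeasurableSpace α] {μ : Measure α} {f h : α → ℝ}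
    {M : ℝ} (hf : AEStronglyMeasurable f μ) (hM : ∀ᵐ x ∂μ, |f x| ≤ M) (hh : Integrable h μ) :
    |∫ x, f x * h x ∂μ| ≤ M * ∫ x, |h x| ∂μ := by
  have hi : Integrable (fun x => f x * h x) μ := hh.bdd_mul hf hM
  calc |∫ x, f x * h x ∂μ| ≤ ∫ x, |f x * h x| ∂μ := abs_integral_le_integral_abs
    _ ≤ ∫ x, M * |h x| ∂μ := by
        refine integral_mono_ae hi.abs (hh.abs.const_mul M) ?_
        filter_upwards [hM] with x hx
        rw [abs_mul]
        exact mul_le_mul_of_nonneg_right hx (abs_nonneg _)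
    _ = M * ∫ x, |h x| ∂μ := integral_const_mul _ _

/-- Weak-∗ convergence against a class of functions that is dense in `L¹`. -/
theorem tendsto_integral_mul_of_tendsto_setIntegral {α : Type*} [MeasurableSpace α] {μ : Measure α}
    {M : ℝ} {f : ℕ → α → ℝ} {g : α → ℝ}
    (hf : ∀ i, AEStronglyMeasurable (f i) μ) (hM : ∀ i, ∀ᵐ x ∂μ, |f i x| ≤ M)
    (hg : AEStronglyMeasurable g μ) (hgM : ∀ᵐ x ∂μ, |g x| ≤ M)
    (hset : ∀ s, MeasurableSet s → μ s < ∞ →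
      Tendsto (fun i => ∫ x in s, f i x ∂μ) atTop (𝓝 (∫ x in s, g x ∂μ)))
    {h : α → ℝ} (hh : Integrable h μ) :
    Tendsto (fun i => ∫ x, f i x * h x ∂μ) atTop (𝓝 (∫ x, g x * h x ∂μ)) := by
  refine Integrable.induction (P := fun h : α → ℝ =>
    Tendsto (fun i => ∫ x, f i x * h x ∂μ) atTop (𝓝 (∫ x, g x * h x ∂μ))) ?_ ?_ ?_ ?_ hh
  · intro c s hs hμs
    have key : ∀ u : α → ℝ, ∫ x, u x * s.indicator (fun _ => c) x ∂μ = (∫ x in s, u x ∂μ) * c := by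
      intro u
      rw [← integral_mul_const, ← integral_indicator hs]
      congr 1
      ext x
      by_cases hx : x ∈ s <;> simp [hx]
    simp only [key]
    exact (hset s hs hμs).mul_const c
  · intro u v _ hu hv hPu hPv
    have key : ∀ {w : α → ℝ}, AEStronglyMeasurable w μ → (∀ᵐ x ∂μ, |w x| ≤ M) →
        ∫ x, w x * (u + v) x ∂μ = ∫ x, w x * u x ∂μ + ∫ x, w x * v x ∂μ := by
      intro w hw hwM
      rw [← integral_add (hu.bdd_mul hw hwM) (hv.bdd_mul hw hwM)]
      simp [mul_add]
    rw [key hg hgM]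
    simp only [key (hf _) (hM _)]
    exact hPu.add hPv
  · rw [← isSeqClosed_iff_isClosed]
    intro H h0 hH hlim
    simp only [mem_ofPred_eq] at hH ⊢
    rw [Metric.tendsto_atTop]
    intro ε hε
    -- A three-epsilon argument shows that the admissible `h` form a closed set in `L¹`. Since `M`
    -- may be zero, `|M| + 1` serves as a positive bound.
    have hM1 : (0 : ℝ) < |M| + 1 := by positivity
    obtain ⟨n, hn⟩ := (Metric.tendsto_atTop.1 hlim (ε / (3 * (|M| + 1))) (by positivity))
    have hn := hn n le_rfl
    have hdist : ∫ x, |H n x - h0 x| ∂μ < ε / (3 * (|M| + 1)) := by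
      rw [L1.dist_eq_integral_dist] at hn
      simpa [Real.dist_eq] using hn
    have hsub : Integrable (fun x => H n x - h0 x) μ :=
      (L1.integrable_coeFn _).sub (L1.integrable_coeFn _)
    have key : ∀ {w : α → ℝ}, AEStronglyMeasurable w μ → (∀ᵐ x ∂μ, |w x| ≤ M) →
        |∫ x, w x * H n x ∂μ - ∫ x, w x * h0 x ∂μ| < ε / 3 := by
      intro w hw hwM
      rw [← integral_sub ((L1.integrable_coeFn _).bdd_mul hw hwM)
        ((L1.integrable_coeFn _).bdd_mul hw hwM)]
      simp only [← mul_sub]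
      calc _ ≤ M * ∫ x, |H n x - h0 x| ∂μ := integral_abs_mul_le_of_bound hw hwM hsub
        _ ≤ (|M| + 1) * ∫ x, |H n x - h0 x| ∂μ := by
            apply mul_le_mul_of_nonneg_right _ (integral_nonneg fun _ => abs_nonneg _)
            linarith [le_abs_self M]
        _ < (|M| + 1) * (ε / (3 * (|M| + 1))) := by gcongr
        _ = ε / 3 := by field_simp
    obtain ⟨i0, hi0⟩ := Metric.tendsto_atTop.1 (hH n) (ε / 3) (by positivity)
    refine ⟨i0, fun i hi => ?_⟩
    have h1 := hi0 i hi
    have h2 := key (hf i) (hM i)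
    have h3 := key hg hgM
    rw [Real.dist_eq, abs_lt] at h1 ⊢
    rw [abs_lt] at h2 h3
    constructor <;> linarith
  · intro u v huv _ hu
    have key : ∀ w : α → ℝ, ∫ x, w x * u x ∂μ = ∫ x, w x * v x ∂μ := fun w =>
      integral_congr_ae (by filter_upwards [huv] with x hx; rw [hx])
    simpa only [key] using hu

/-- On a finite measure space bounded functions lie in the Hilbert space `L²`, where Banach–Alaoglu
yields a weakly convergent subsequence. Testing with indicator functions shows that the limit
inherits the bound `M`, and density of simple functions extends the convergence from `L²` to `L¹`
test functions. -/
theorem exists_weakStar_subseq_of_finite {α : Type*} [MeasurableSpace α]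
    [MeasurableSpace.CountablyGenerated α] {μ : Measure α} [IsFiniteMeasure μ] {M : ℝ} (hM0 : 0 ≤ M)
    {f : ℕ → α → ℝ} (hf : ∀ i, AEStronglyMeasurable (f i) μ) (hM : ∀ i, ∀ᵐ x ∂μ, |f i x| ≤ M) :
    ∃ θ : ℕ → ℕ, StrictMono θ ∧ ∃ g : α → ℝ, Measurable g ∧ (∀ x, |g x| ≤ M) ∧
      ∀ h, Integrable h μ →
        Tendsto (fun i => ∫ x, f (θ i) x * h x ∂μ) atTop (𝓝 (∫ x, g x * h x ∂μ)) := by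
  -- Needed for the separability of `Lp ℝ 2 μ`, on which sequential compactness of balls in the weak
  -- dual rests.
  have : Fact ((2 : ℝ≥0∞) ≠ ∞) := ⟨by simp⟩
  let F : ℕ → Lp ℝ 2 μ := fun i => (MemLp.of_bound (hf i) M (hM i)).toLp (f i)
  have hF : ∀ i, F i =ᵐ[μ] f i := fun i => MemLp.coeFn_toLp _
  obtain ⟨Λ, -, θ, hθ, hlim⟩ := (WeakDual.isSeqCompact_closedBall ℝ (Lp ℝ 2 μ) 0
    ((measureUnivNNReal μ : ℝ) ^ (2 : ℝ≥0∞).toReal⁻¹ * M)) (x := fun i =>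
      StrongDual.toWeakDual (InnerProductSpace.toDual ℝ _ (F i))) (by
        intro i
        simp only [mem_preimage, Metric.mem_closedBall, dist_zero_right]
        refine (LinearIsometryEquiv.norm_map (InnerProductSpace.toDual ℝ (Lp ℝ 2 μ)) (F i)).le.trans
          (Lp.norm_le_of_ae_bound hM0 ?_)
        filter_upwards [hF i, hM i] with x h1 h2
        rwa [h1])
  let g : Lp ℝ 2 μ := (InnerProductSpace.toDual ℝ _).symm (WeakDual.toStrongDual Λ)
  have hconv : ∀ q : Lp ℝ 2 μ, Tendsto (fun i => inner ℝ (F (θ i)) q) atTop (𝓝 (inner ℝ g q)) := by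
    intro q
    have h1 := ((WeakDual.eval_continuous (𝕜 := ℝ) q).tendsto Λ).comp hlim
    rw [InnerProductSpace.toDual_symm_apply]
    exact h1
  have hset : ∀ s, MeasurableSet s →
      Tendsto (fun i => ∫ x in s, f (θ i) x ∂μ) atTop (𝓝 (∫ x in s, g x ∂μ)) := by
    intro s hs
    have h1 := hconv (indicatorConstLp 2 hs (measure_ne_top μ s) (1 : ℝ))
    simp only [real_inner_comm, L2.inner_indicatorConstLp_one] at h1
    have h2 : ∀ i, ∫ x in s, F (θ i) x ∂μ = ∫ x in s, f (θ i) x ∂μ := fun i =>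
      integral_congr_ae (ae_restrict_of_ae (hF (θ i)))
    simpa only [h2] using h1
  have hgi : Integrable g μ := (Lp.memLp g).integrable (by norm_num)
  have hfi : ∀ i, Integrable (f i) μ := fun i =>
    (MemLp.of_bound (p := 1) (hf i) M (hM i)).integrable le_rfl
  have hub : g ≤ᵐ[μ] fun _ => M := by
    refine ae_le_of_forall_setIntegral_le hgi (integrable_const M) fun s hs _ => ?_
    refine le_of_tendsto' (hset s hs) fun i => ?_
    refine setIntegral_mono_ae (hfi _).integrableOn (integrable_const M).integrableOn ?_
    filter_upwards [hM (θ i)] with x hx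
    exact (abs_le.1 hx).2
  have hlb : (fun _ => -M) ≤ᵐ[μ] g := by
    refine ae_le_of_forall_setIntegral_le (integrable_const (-M)) hgi fun s hs _ => ?_
    refine ge_of_tendsto' (hset s hs) fun i => ?_
    refine setIntegral_mono_ae (integrable_const (-M)).integrableOn (hfi _).integrableOn ?_
    filter_upwards [hM (θ i)] with x hx
    exact (abs_le.1 hx).1
  have hgm : Measurable (g : α → ℝ) := (Lp.stronglyMeasurable g).measurable
  -- The limit obeys the bound only almost everywhere; truncation makes it hold everywhere, so that
  -- convolutions of the limit can later be estimated at every single time.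
  refine ⟨θ, hθ, fun x => max (-M) (min M (g x)), measurable_const.max (measurable_const.min hgm),
    fun x => abs_le.2 ⟨le_max_left _ _, max_le (by linarith) (min_le_left _ _)⟩, fun h hh => ?_⟩
  have heq : ∀ᵐ x ∂μ, max (-M) (min M (g x)) = g x := by
    filter_upwards [hub, hlb] with x h1 h2
    rw [min_eq_right h1, max_eq_right h2]
  rw [integral_congr_ae (g := fun x => g x * h x) (by filter_upwards [heq] with x hx; rw [hx])]
  refine tendsto_integral_mul_of_tendsto_setIntegral (M := M) (fun i => hf _) (fun i => hM _)
    hgi.aestronglyMeasurable ?_ (fun s hs _ => hset s hs) hh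
  filter_upwards [hub, hlb] with x h1 h2 using abs_le.2 ⟨h2, h1⟩

/-- A bounded sequence in `L^∞` of a σ-finite measure has a weakly-∗ convergent subsequence. -/
theorem exists_weakStar_subseq {α : Type*} [MeasurableSpace α]
    [MeasurableSpace.CountablyGenerated α] {μ : Measure α} [SigmaFinite μ] {M : ℝ} (hM0 : 0 ≤ M)
    {f : ℕ → α → ℝ} (hf : ∀ i, AEStronglyMeasurable (f i) μ) (hM : ∀ i, ∀ᵐ x ∂μ, |f i x| ≤ M) :
    ∃ θ : ℕ → ℕ, StrictMono θ ∧ ∃ g : α → ℝ, Measurable g ∧ (∀ x, |g x| ≤ M) ∧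
      ∀ h, Integrable h μ →
        Tendsto (fun i => ∫ x, f (θ i) x * h x ∂μ) atTop (𝓝 (∫ x, g x * h x ∂μ)) := by
  have hac := absolutelyContinuous_toFinite μ
  have hca := toFinite_absolutelyContinuous μ
  obtain ⟨θ, hθ, g, hgm, hgM, hg⟩ := exists_weakStar_subseq_of_finite (μ := μ.toFinite) hM0
    (fun i => (hf i).mono_ac hca) (fun i => hca.ae_le (hM i))
  refine ⟨θ, hθ, g, hgm, hgM, fun h hh => ?_⟩
  -- `μ.toFinite` is a finite measure with the same null sets; the density of `μ` is absorbed into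
  -- the test function.
  have h1 := hg _ ((integrable_rnDeriv_smul_iff hac).2 hh)
  have key : ∀ u : α → ℝ, ∫ x, u x * ((μ.rnDeriv μ.toFinite x).toReal • h x) ∂μ.toFinite
      = ∫ x, u x * h x ∂μ := by
    intro u
    rw [← integral_rnDeriv_smul hac]
    congr 1
    ext x
    simp only [smul_eq_mul]
    ring
  simpa only [key] using h1

theorem exists_weakStar_subseq_family {ι α : Type*} [Finite ι] [MeasurableSpace α]
    [MeasurableSpace.CountablyGenerated α] {μ : Measure α} [SigmaFinite μ] {M : ℝ} (hM0 : 0 ≤ M)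
    {f : ℕ → α → ι → ℝ} (hf : ∀ i k, AEStronglyMeasurable (fun x => f i x k) μ)
    (hM : ∀ i k, ∀ᵐ x ∂μ, |f i x k| ≤ M) :
    ∃ θ : ℕ → ℕ, StrictMono θ ∧ ∃ g : α → ι → ℝ, (∀ k, Measurable fun x => g x k) ∧
      (∀ x k, |g x k| ≤ M) ∧ ∀ k h, Integrable h μ →
        Tendsto (fun i => ∫ x, f (θ i) x k * h x ∂μ) atTop (𝓝 (∫ x, g x k * h x ∂μ)) := by
  classical
  have := Fintype.ofFinite ι
  suffices H : ∀ s : Finset ι, ∃ θ : ℕ → ℕ, StrictMono θ ∧ ∃ g : α → ι → ℝ,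
      (∀ k, Measurable fun x => g x k) ∧ (∀ x k, |g x k| ≤ M) ∧ ∀ k ∈ s, ∀ h, Integrable h μ →
        Tendsto (fun i => ∫ x, f (θ i) x k * h x ∂μ) atTop (𝓝 (∫ x, g x k * h x ∂μ)) by
    obtain ⟨θ, hθ, g, h1, h2, h3⟩ := H Finset.univ
    exact ⟨θ, hθ, g, h1, h2, fun k => h3 k (Finset.mem_univ k)⟩
  intro s
  induction s using Finset.induction_on with
  | empty => exact ⟨id, strictMono_id, fun _ _ => 0, by fun_prop, by simp [hM0], by simp⟩
  | insert a s ha ih =>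
    obtain ⟨θ, hθ, g, h1, h2, h3⟩ := ih
    obtain ⟨θ', hθ', g', h1', h2', h3'⟩ := exists_weakStar_subseq (μ := μ) hM0
      (f := fun i x => f (θ i) x a) (fun i => hf _ _) (fun i => hM _ _)
    refine ⟨θ ∘ θ', hθ.comp hθ', fun x k => if k = a then g' x else g x k, fun k => ?_,
      fun x k => ?_, fun k hk h hh => ?_⟩
    · by_cases hka : k = a
      · simpa [hka] using h1'
      · simpa [hka] using h1 k
    · by_cases hka : k = a
      · simpa [hka] using h2' x
      · simpa [hka] using h2 x k
    · by_cases hka : k = a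
      · subst hka
        simpa using h3' h hh
      · simp only [hka, if_false]
        exact (h3 k ((Finset.mem_insert.1 hk).resolve_left hka) h hh).comp hθ'.tendsto_atTop

/-! ### Cells -/

/-- The index of the cell that contains `x`. -/
def cellIdx (h x : ℝ) : ℤ := ⌊x / h + 1 / 2⌋

theorem measurable_cellIdx (h : ℝ) : Measurable (cellIdx h) :=
  Int.measurable_floor.comp (by fun_prop)

theorem cellIdx_eq_iff {h : ℝ} (hh : 0 < h) {x : ℝ} {i : ℤ} :
    cellIdx h x = i ↔ ((i : ℝ) - 1 / 2) * h ≤ x ∧ x < ((i : ℝ) + 1 / 2) * h := by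
  rw [cellIdx, Int.floor_eq_iff, ← sub_le_iff_le_add, le_div_iff₀ hh, ← lt_sub_iff_add_lt,
    div_lt_iff₀ hh]
  constructor <;> rintro ⟨h1, h2⟩ <;> refine ⟨h1, ?_⟩ <;> linarith

theorem abs_sub_cellIdx_le {h : ℝ} (hh : 0 < h) (x : ℝ) : |x - cellIdx h x * h| ≤ h / 2 := by
  obtain ⟨h1, h2⟩ := (cellIdx_eq_iff hh).1 (rfl : cellIdx h x = cellIdx h x)
  rw [abs_le]
  constructor <;> linarith

theorem cellIdx_add_mul {h : ℝ} (hh : 0 < h) (x : ℝ) (i : ℤ) :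
    cellIdx h (x + i * h) = cellIdx h x + i := by
  rw [cellIdx, cellIdx, ← Int.floor_add_intCast]
  congr 1
  field_simp
  ring

theorem cellIdx_sub {h : ℝ} (hh : 0 < h) (x : ℝ) : cellIdx h (x - h) = cellIdx h x - 1 := by
  simpa [← sub_eq_add_neg] using cellIdx_add_mul hh x (-1)

theorem cellIdx_mul {h : ℝ} (hh : 0 < h) (i : ℤ) : cellIdx h (i * h) = i := by
  rw [cellIdx_eq_iff hh]
  constructor <;> nlinarith

theorem cellIdx_preimage {h : ℝ} (hh : 0 < h) (i : ℤ) :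
    cellIdx h ⁻¹' {i} = Ico (((i : ℝ) - 1 / 2) * h) (((i : ℝ) + 1 / 2) * h) := by
  ext x
  simp [cellIdx_eq_iff hh]

theorem measureReal_cellIdx_preimage {h : ℝ} (hh : 0 < h) (i : ℤ) :
    volume.real (cellIdx h ⁻¹' {i}) = h := by
  rw [cellIdx_preimage hh, Real.volume_real_Ico_of_le (by nlinarith)]
  ring

theorem hasSum_integral_cells (h : ℝ) {F : ℝ → ℝ} (hF : Integrable F) :
    HasSum (fun i : ℤ => ∫ x in cellIdx h ⁻¹' {i}, F x) (∫ x, F x) := by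
  have hU : (⋃ i : ℤ, cellIdx h ⁻¹' {i}) = univ := by
    ext x
    simp
  have := hasSum_integral_iUnion (μ := volume) (f := F) (s := fun i : ℤ => cellIdx h ⁻¹' {i})
    (fun i => measurable_cellIdx h (measurableSet_singleton i))
    (fun i j hij => Disjoint.preimage _ (disjoint_singleton.2 hij)) (hF.integrableOn)
  rwa [hU, setIntegral_univ] at this

/-! ### Kernels of bounded variation -/

/-- The integral of the oscillation of `w` at scale `h` is at most `V h`. -/
def HasOscBound (w : ℝ → ℝ) (V : ℝ) : Prop :=
  ∀ h, 0 < h → ∃ G : ℝ → ℝ, Integrable G ∧ ∫ y, G y ≤ V * h ∧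
    ∀ y a b, |a - y| ≤ h → |b - y| ≤ h → |w a - w b| ≤ G y

/-- Telescoping: the integral over `[a, b]` equals the integral of `v` over `[b - h, b + h]` minus
that over `[a - h, a + h]`, and each of these is at most `2 M h` in modulus. As the integrand is
nonnegative, this bound, uniform in `a` and `b`, also gives integrability on the line. -/
theorem Monotone.integral_shift_sub {v : ℝ → ℝ} (hv : Monotone v) {M : ℝ} (hM : ∀ x, |v x| ≤ M)
    {h : ℝ} (hh : 0 < h) :
    Integrable (fun y => v (y + h) - v (y - h)) ∧ ∫ y, (v (y + h) - v (y - h)) ≤ 4 * M * h := by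
  have hloc : ∀ a b : ℝ, IntervalIntegrable v volume a b := fun a b => hv.intervalIntegrable
  have hi1 : ∀ a b : ℝ, IntervalIntegrable (fun y => v (y + h)) volume a b := fun a b =>
    Monotone.intervalIntegrable fun x y hxy => hv (by linarith)
  have hi2 : ∀ a b : ℝ, IntervalIntegrable (fun y => v (y - h)) volume a b := fun a b =>
    Monotone.intervalIntegrable fun x y hxy => hv (by linarith)
  have hsmall : ∀ c : ℝ, |∫ y in (c - h)..(c + h), v y| ≤ 2 * M * h := by
    intro c
    have := intervalIntegral.norm_integral_le_of_norm_le_const (a := c - h) (b := c + h) (f := v)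
      (C := M) fun x _ => hM x
    rw [Real.norm_eq_abs] at this
    refine this.trans (le_of_eq ?_)
    rw [abs_of_nonneg (by linarith)]
    ring
  have hbd : ∀ a b : ℝ, ∫ y in a..b, (v (y + h) - v (y - h)) ≤ 4 * M * h := by
    intro a b
    rw [intervalIntegral.integral_sub (hi1 a b) (hi2 a b), intervalIntegral.integral_comp_add_right,
      intervalIntegral.integral_comp_sub_right, intervalIntegral.integral_interval_sub_interval_comm
      (hloc _ _) (hloc _ _) (hloc _ _), intervalIntegral.integral_symm]
    have h1 := abs_le.1 (hsmall a)
    have h2 := abs_le.1 (hsmall b)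
    rw [intervalIntegral.integral_symm (b - h) (b + h)]
    linarith [h1.1, h2.2]
  have hnn : ∀ y, 0 ≤ v (y + h) - v (y - h) := fun y => sub_nonneg.2 (hv (by linarith))
  have ha : Tendsto (fun i : ℕ => -(i : ℝ)) atTop atBot :=
    tendsto_neg_atTop_atBot.comp tendsto_natCast_atTop_atTop
  have hb : Tendsto (fun i : ℕ => (i : ℝ)) atTop atTop := tendsto_natCast_atTop_atTop
  have hint : Integrable (fun y => v (y + h) - v (y - h)) := by
    refine integrable_of_intervalIntegral_norm_bounded (4 * M * h) (fun i => ?_) ha hb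
      (Eventually.of_forall fun i => ?_)
    · exact ((intervalIntegrable_iff_integrableOn_Ioc_of_le (by
        have : (0 : ℝ) ≤ i := Nat.cast_nonneg i
        linarith)).1 ((hi1 _ _).sub (hi2 _ _)))
    · simp only [Real.norm_eq_abs, abs_of_nonneg (hnn _)]
      exact hbd _ _
  exact ⟨hint, le_of_tendsto' (intervalIntegral_tendsto_integral hint ha hb) fun i => hbd _ _⟩

theorem BoundedVariationOn.abs_sub_le_variation {w : ℝ → ℝ} (hw : BoundedVariationOn w univ)
    {x y : ℝ} (hxy : x ≤ y) :
    |w x - w y| ≤ variationOnFromTo w univ 0 y - variationOnFromTo w univ 0 x := by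
  have hl := hw.locallyBoundedVariationOn
  have h1 := variationOnFromTo.add hl (mem_univ (0 : ℝ)) (mem_univ x) (mem_univ y)
  have h2 := variationOnFromTo.eq_of_le w univ hxy
  have h3 : variationOnFromTo w univ 0 y - variationOnFromTo w univ 0 x =
      (eVariationOn w (univ ∩ Icc x y)).toReal := by linarith
  rw [h3]
  have hb : BoundedVariationOn w (univ ∩ Icc x y) := hw.mono inter_subset_left
  have := hb.dist_le (x := x) (y := y) ⟨mem_univ _, le_rfl, hxy⟩ ⟨mem_univ _, hxy, le_rfl⟩
  rwa [Real.dist_eq] at this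

/-- The increments of `w` are dominated by those of its variation function, which is monotone and
bounded by the total variation. The oscillation of `w` on `[y - h, y + h]` is therefore at most `v
(y + h) - v (y - h)`. -/
theorem BoundedVariationOn.exists_hasOscBound {w : ℝ → ℝ} (hw : BoundedVariationOn w univ) :
    ∃ V, 0 ≤ V ∧ HasOscBound w V := by
  set v := variationOnFromTo w univ 0 with hv
  have hmono : Monotone v := monotoneOn_univ.1
    (variationOnFromTo.monotoneOn hw.locallyBoundedVariationOn (mem_univ 0))
  have hM : ∀ x, |v x| ≤ (eVariationOn w univ).toReal := fun x =>
    variationOnFromTo.abs_le_eVariationOn hw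
  refine ⟨4 * (eVariationOn w univ).toReal, by positivity, fun h hh =>
    ⟨fun y => v (y + h) - v (y - h), (Monotone.integral_shift_sub hmono hM hh).1,
      (Monotone.integral_shift_sub hmono hM hh).2, fun y a b ha hb => ?_⟩⟩
  rw [abs_le] at ha hb
  have key : ∀ c, |c - y| ≤ h → v (y - h) ≤ v c ∧ v c ≤ v (y + h) := fun c hc =>
    ⟨hmono (by linarith [(abs_le.1 hc).1]), hmono (by linarith [(abs_le.1 hc).2])⟩
  have ka := key a (abs_le.2 ha)
  have kb := key b (abs_le.2 hb)
  rcases le_total a b with hab | hab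
  · have := BoundedVariationOn.abs_sub_le_variation hw hab
    linarith [ka.1, kb.2]
  · have := BoundedVariationOn.abs_sub_le_variation hw hab
    rw [abs_sub_comm]
    linarith [kb.1, ka.2]

theorem BoundedVariationOn.exists_abs_le {w : ℝ → ℝ} (hw : BoundedVariationOn w univ) :
    ∃ W, 0 ≤ W ∧ ∀ x, |w x| ≤ W := by
  refine ⟨|w 0| + (eVariationOn w univ).toReal, by positivity, fun x => ?_⟩
  have := hw.dist_le (mem_univ x) (mem_univ 0)
  rw [Real.dist_eq] at this
  linarith [abs_sub_abs_le_abs_sub (w x) (w 0)]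

theorem BoundedVariationOn.measurable {w : ℝ → ℝ} (hw : BoundedVariationOn w univ) :
    Measurable w := by
  obtain ⟨p, q, hp, hq, rfl⟩ :=
    hw.locallyBoundedVariationOn.exists_monotoneOn_sub_monotoneOn
  exact (monotoneOn_univ.1 hp).measurable.sub (monotoneOn_univ.1 hq).measurable

/-- Both `y - x` and `y - x'` lie within `h` of `y - x`, so the two kernels differ by at most the
oscillation majorant at `y - x`, whose integral is `O(h)`. -/
theorem HasOscBound.abs_integral_shift_sub_le {w : ℝ → ℝ} {V : ℝ} (hV : HasOscBound w V)
    (hw : Integrable w) {B : ℝ} {g : ℝ → ℝ} (hg : Measurable g) (hgB : ∀ y, |g y| ≤ B) {h : ℝ}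
    (hh : 0 < h) {x x' : ℝ} (hx : |x - x'| ≤ h) :
    |(∫ y, w (y - x) * g y) - ∫ y, w (y - x') * g y| ≤ V * h * B := by
  obtain ⟨G, hG, hGV, hGw⟩ := hV h hh
  have hB : 0 ≤ B := (abs_nonneg _).trans (hgB 0)
  have hi : ∀ z : ℝ, Integrable fun y => w (y - z) * g y := fun z =>
    (hw.comp_sub_right z).mul_bdd (c := B) hg.aestronglyMeasurable
      (Eventually.of_forall fun y => hgB y)
  rw [← integral_sub (hi x) (hi x')]
  calc |∫ y, (w (y - x) * g y - w (y - x') * g y)|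
      ≤ ∫ y, |w (y - x) * g y - w (y - x') * g y| := abs_integral_le_integral_abs
    _ ≤ ∫ y, G (y - x) * B := by
        refine integral_mono ((hi x).sub (hi x')).abs ((hG.comp_sub_right x).mul_const B)
          fun y => ?_
        simp only [← sub_mul, abs_mul]
        refine mul_le_mul (hGw _ _ _ (by simpa using hh.le) ?_) (hgB y) (abs_nonneg _)
          ((abs_nonneg _).trans (hGw (y - x) (y - x) (y - x) (by simpa using hh.le)
            (by simpa using hh.le)))
        have : y - x' - (y - x) = x - x' := by ring
        rwa [this]
    _ = (∫ y, G y) * B := by rw [integral_mul_const, integral_sub_right_eq_self]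
    _ ≤ V * h * B := mul_le_mul_of_nonneg_right hGV hB

/-! ### The quadrature rule -/

section QuadratureError

variable {w : ℝ → ℝ} {h : ℝ}

theorem eta₁_nonpos (h0 : (0 : ℝ) ∈ tsupport w) (hb : BddBelow (tsupport w)) : eta₁ w ≤ 0 :=
  csInf_le hb h0

theorem cells₁_bounds (hh : 0 < h) (h0 : (0 : ℝ) ∈ tsupport w) (hb : BddBelow (tsupport w)) :
    -eta₁ w ≤ cells₁ w h * h ∧ cells₁ w h * h < -eta₁ w + h := by
  have h1 := Int.le_ceil (|eta₁ w| / h)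
  have h2 := Int.ceil_lt_add_one (|eta₁ w| / h)
  rw [abs_of_nonpos (eta₁_nonpos h0 hb)] at h1 h2
  rw [cells₁, abs_of_nonpos (eta₁_nonpos h0 hb)]
  refine ⟨(div_le_iff₀ hh).1 h1, ?_⟩
  have := mul_lt_mul_of_pos_right h2 hh
  rwa [add_mul, div_mul_cancel₀ _ hh.ne', one_mul] at this

/-- Unlike on the left, no absolute value occurs in `cells₂`, so the bounds need neither the sign of
`eta₂` nor a bounded support; they hold even for the default value of the supremum. -/
theorem cells₂_bounds (hh : 0 < h) :
    eta₂ w ≤ cells₂ w h * h ∧ cells₂ w h * h < eta₂ w + h := by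
  have h1 := Int.le_ceil (eta₂ w / h)
  have h2 := Int.ceil_lt_add_one (eta₂ w / h)
  rw [cells₂]
  refine ⟨(div_le_iff₀ hh).1 h1, ?_⟩
  have := mul_lt_mul_of_pos_right h2 hh
  rwa [add_mul, div_mul_cancel₀ _ hh.ne', one_mul] at this

theorem abs_weight₁_le (hh : 0 < h) (h0 : (0 : ℝ) ∈ tsupport w) (hb : BddBelow (tsupport w))
    {W : ℝ} (hW : ∀ x, |w x| ≤ W) : |weight₁ w h| ≤ h * W := by
  obtain ⟨h1, h2⟩ := cells₁_bounds hh h0 hb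
  rw [weight₁, abs_mul]
  refine mul_le_mul (abs_le.2 ⟨?_, ?_⟩) (hW _) (abs_nonneg _) hh.le <;> linarith

theorem abs_weight₂_le (hh : 0 < h) {W : ℝ} (hW : ∀ x, |w x| ≤ W) : |weight₂ w h| ≤ h * W := by
  obtain ⟨h1, h2⟩ := cells₂_bounds (w := w) hh
  rw [weight₂, abs_mul]
  refine mul_le_mul (abs_le.2 ⟨?_, ?_⟩) (hW _) (abs_nonneg _) hh.le <;> linarith

theorem abs_mid₁_add_le (hh : 0 < h) (h0 : (0 : ℝ) ∈ tsupport w) (hb : BddBelow (tsupport w)) :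
    |mid₁ w h + cells₁ w h * h| ≤ h := by
  obtain ⟨h1, h2⟩ := cells₁_bounds hh h0 hb
  rw [mid₁, abs_le]
  constructor <;> linarith

theorem abs_mid₂_sub_le (hh : 0 < h) : |mid₂ w h - cells₂ w h * h| ≤ h := by
  obtain ⟨h1, h2⟩ := cells₂_bounds (w := w) hh
  rw [mid₂, abs_le]
  constructor <;> linarith

/-- Outside the range of summation, the kernel vanishes at the nodes except the two extreme ones. -/
theorem kernel_eq_zero_of_not_mem_range (hh : 0 < h) (h0 : (0 : ℝ) ∈ tsupport w) {i : ℤ}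
    (hi : ¬((BddBelow (tsupport w) → -cells₁ w h < i) ∧ (BddAbove (tsupport w) → i < cells₂ w h)))
    (h1 : i ≠ -cells₁ w h) (h2 : i ≠ cells₂ w h) : w (i * h) = 0 := by
  apply image_eq_zero_of_notMem_tsupport
  intro hmem
  apply hi
  constructor
  · intro hb
    by_contra hlt
    have hlt : i < -cells₁ w h := lt_of_le_of_ne (not_lt.1 hlt) h1
    have h3 : (i : ℝ) < -cells₁ w h := by exact_mod_cast hlt
    have h4 : eta₁ w ≤ i * h := csInf_le hb hmem
    have h5 := (cells₁_bounds hh h0 hb).1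
    nlinarith
  · intro hb
    by_contra hlt
    have hlt : cells₂ w h < i := lt_of_le_of_ne (not_lt.1 hlt) h2.symm
    have h3 : (cells₂ w h : ℝ) < i := by exact_mod_cast hlt
    have h4 : i * h ≤ eta₂ w := le_csSup hb hmem
    have h5 := (cells₂_bounds (w := w) hh).1
    nlinarith

open Classical in
-- In each cell the node value `w (i h)` is compared with the kernel values under the integral; the
-- difference is at most the oscillation of `w` at scale `h`, whose sum over all cells is at most `V
-- h`. The two extreme nodes, which the sum may leave out although the kernel need not vanish there,
-- account for the remaining `2 W h`.
theorem abs_quadrature_sum_sub_integral_le (hw : Integrable w) (h0 : (0 : ℝ) ∈ tsupport w)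
    {V W : ℝ} (hV : HasOscBound w V) (hW : ∀ x, |w x| ≤ W) (hh : 0 < h) {B : ℝ} {f : ℤ → ℝ}
    (hf : ∀ i, |f i| ≤ B) (x : ℝ) :
    |h * (∑' i : ℤ,
        if (BddBelow (tsupport w) → -cells₁ w h < i) ∧ (BddAbove (tsupport w) → i < cells₂ w h)
        then f (cellIdx h x + i) * w (i * h) else 0)
      - ∫ y, w (y - x) * f (cellIdx h y)| ≤ (V + 2 * W) * h * B := by
  obtain ⟨G, hG, hGV, hGw⟩ := hV h hh
  have hB : 0 ≤ B := (abs_nonneg _).trans (hf 0)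
  set j := cellIdx h x with hj
  -- The quadrature sees only the cell of `x`, while the integral sees `x` itself; the offset `ξ` is
  -- at most `h / 2` and is absorbed by the oscillation bound.
  set ξ := x - j * h with hξ
  have hξ' : |ξ| ≤ h / 2 := abs_sub_cellIdx_le hh x
  set F : ℝ → ℝ := fun z => w (z - ξ) * f (j + cellIdx h z) with hF
  have hFi : Integrable F := by
    refine (hw.comp_sub_right ξ).mul_bdd (c := B) ?_ (Eventually.of_forall fun y => hf _)
    exact ((measurable_of_countable fun i => f (j + i)).comp
      (measurable_cellIdx h)).aestronglyMeasurable
  have hFint : ∫ y, w (y - x) * f (cellIdx h y) = ∫ z, F z := by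
    rw [← integral_add_right_eq_self (fun y => w (y - x) * f (cellIdx h y)) (j * h)]
    congr 1
    ext z
    rw [cellIdx_add_mul hh, add_comm _ j]
    congr 2
    ring
  set T : ℤ → ℝ := fun i =>
    if (BddBelow (tsupport w) → -cells₁ w h < i) ∧ (BddAbove (tsupport w) → i < cells₂ w h)
        then f (j + i) * w (i * h) else 0 with hT
  set S : ℤ → Set ℝ := fun i => cellIdx h ⁻¹' {i} with hS
  have hSm : ∀ i, MeasurableSet (S i) := fun i => measurable_cellIdx h (measurableSet_singleton i)
  have hSvol : ∀ i, volume.real (S i) = h := measureReal_cellIdx_preimage hh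
  have hSfin : ∀ i, volume (S i) ≠ ∞ := fun i => by
    simp only [hS, cellIdx_preimage hh]
    exact measure_Ico_lt_top.ne
  set e : ℤ → ℝ := fun i => (if i = -cells₁ w h then W else 0) + (if i = cells₂ w h then W else 0)
    with he
  have hW0 : 0 ≤ W := (abs_nonneg _).trans (hW 0)
  have hpt : ∀ i, ∀ z ∈ S i, |T i - F z| ≤ (G z + e i) * B := by
    intro i z hz
    have hz' : cellIdx h z = i := hz
    have hzi : |i * h - z| ≤ h := by
      rw [abs_sub_comm, ← hz']
      linarith [abs_sub_cellIdx_le hh z]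
    have hosc : |w (i * h) - w (z - ξ)| ≤ G z := hGw z _ _ hzi (by
      have : z - ξ - z = -ξ := by ring
      rw [this, abs_neg]
      linarith)
    have he0 : 0 ≤ e i := by simp only [he]; positivity
    simp only [hT, hF, hz']
    split_ifs with hc
    · rw [mul_comm (w _), ← mul_sub, abs_mul, mul_comm]
      exact mul_le_mul (by linarith) (hf _) (abs_nonneg _) (by
        have := (abs_nonneg _).trans hosc
        positivity)
    · have hwe : |w (i * h)| ≤ e i := by
        by_cases h1 : i = -cells₁ w h
        · simp only [he, h1, if_true]
          have : 0 ≤ (if -cells₁ w h = cells₂ w h then W else 0) := by positivity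
          linarith [hW ((-cells₁ w h : ℤ) * h)]
        · by_cases h2 : i = cells₂ w h
          · simp only [he, h2, if_true]
            have : 0 ≤ (if cells₂ w h = -cells₁ w h then W else 0) := by positivity
            linarith [hW ((cells₂ w h : ℤ) * h)]
          · rw [kernel_eq_zero_of_not_mem_range hh h0 hc h1 h2, abs_zero]
            exact he0
      rw [zero_sub, abs_neg, abs_mul]
      refine mul_le_mul ?_ (hf _) (abs_nonneg _) (by
        have := (abs_nonneg _).trans hosc
        positivity)
      have := abs_sub_abs_le_abs_sub (w (z - ξ)) (w (i * h))
      rw [abs_sub_comm] at this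
      linarith
  have hcell : ∀ i, |h * T i - ∫ z in S i, F z| ≤ ((∫ z in S i, G z) + e i * h) * B := by
    intro i
    have h1 : h * T i = ∫ z in S i, T i := by
      rw [setIntegral_const, hSvol, smul_eq_mul]
    have hTi : IntegrableOn (fun _ => T i) (S i) := integrableOn_const (hSfin i)
    rw [h1, ← integral_sub hTi hFi.integrableOn]
    refine abs_integral_le_integral_abs.trans ?_
    have hei : IntegrableOn (fun _ => e i) (S i) := integrableOn_const (hSfin i)
    calc ∫ z in S i, |T i - F z| ≤ ∫ z in S i, (G z + e i) * B :=
          setIntegral_mono_on (hTi.sub hFi.integrableOn).abs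
            ((hG.integrableOn.add hei).mul_const B) (hSm i) (hpt i)
      _ = _ := by
          rw [integral_mul_const, integral_add hG.integrableOn hei, setIntegral_const, hSvol,
            smul_eq_mul, mul_comm h]
  have hesum : HasSum e (W + W) := (hasSum_ite_eq _ W).add (hasSum_ite_eq _ W)
  have hbound : HasSum (fun i => ((∫ z in S i, G z) + e i * h) * B)
      (((∫ z, G z) + (W + W) * h) * B) :=
    ((hasSum_integral_cells h hG).add (hesum.mul_right h)).mul_right B
  have hFs := hasSum_integral_cells h hFi
  have hdsum : Summable fun i => h * T i - ∫ z in S i, F z :=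
    Summable.of_norm_bounded hbound.summable hcell
  have hd := tsum_of_norm_bounded (f := fun i => h * T i - ∫ z in S i, F z) hbound hcell
  have hTsum : ∑' i, h * T i = (∑' i, (h * T i - ∫ z in S i, F z)) + ∫ z, F z := by
    rw [← hFs.tsum_eq, ← hdsum.tsum_add hFs.summable]
    simp [hS]
  rw [hFint, ← tsum_mul_left, hTsum, add_sub_cancel_right]
  refine hd.trans ?_
  refine mul_le_mul_of_nonneg_right ?_ hB
  linarith

/-- The quadrature is a first order approximation of the convolution with the kernel. -/
theorem abs_quadrature_sub_integral_le (hw : Integrable w) (h0 : (0 : ℝ) ∈ tsupport w)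
    {V W : ℝ} (hV : HasOscBound w V) (hW : ∀ x, |w x| ≤ W) (hh : 0 < h) {B : ℝ} {f₁ f f₂ : ℤ → ℝ}
    (hf₁ : BddBelow (tsupport w) → ∀ i, |f₁ i| ≤ B) (hf : ∀ i, |f i| ≤ B) (hf₂ : ∀ i, |f₂ i| ≤ B)
    (x : ℝ) :
    |quadrature w h f₁ f f₂ (cellIdx h x) - ∫ y, w (y - x) * f (cellIdx h y)|
      ≤ (V + 4 * W) * h * B := by
  classical
  have hW0 : 0 ≤ W := (abs_nonneg _).trans (hW 0)
  have hB : 0 ≤ B := (abs_nonneg _).trans (hf 0)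
  have hmain := abs_quadrature_sum_sub_integral_le hw h0 hV hW hh hf x
  have h1 : |if BddBelow (tsupport w) then weight₁ w h * f₁ (cellIdx h x - cells₁ w h) else 0|
      ≤ h * W * B := by
    split_ifs with hb
    · rw [abs_mul]
      exact mul_le_mul (abs_weight₁_le hh h0 hb hW) (hf₁ hb _) (abs_nonneg _) (by positivity)
    · rw [abs_zero]
      positivity
  have h2 : |if BddAbove (tsupport w) then weight₂ w h * f₂ (cellIdx h x + cells₂ w h) else 0|
      ≤ h * W * B := by
    split_ifs with hb
    · rw [abs_mul]
      exact mul_le_mul (abs_weight₂_le hh hW) (hf₂ _) (abs_nonneg _) (by positivity)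
    · rw [abs_zero]
      positivity
  rw [quadrature]
  rw [abs_le] at *
  constructor <;> linarith [h1.1, h1.2, h2.1, h2.2, hmain.1, hmain.2]

end QuadratureError

/-! ### Uniform constants for the kernels -/

/-- Constants for which the quadrature with the kernel `w` is a first order approximation of the
convolution with `w`, which is Lipschitz in space. -/
structure KernelBound (w : ℝ → ℝ) (K : ℝ) : Prop where
  measurable : Measurable w
  nonneg : ∀ x, 0 ≤ w x
  integrable : Integrable w
  integral_eq : ∫ x, w x = 1
  const_nonneg : 0 ≤ K
  zero_mem : (0 : ℝ) ∈ tsupport w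
  shift : ∀ {B : ℝ} {g : ℝ → ℝ}, Measurable g → (∀ y, |g y| ≤ B) → ∀ {h : ℝ}, 0 < h →
    ∀ {x x' : ℝ}, |x - x'| ≤ h →
      |(∫ y, w (y - x) * g y) - ∫ y, w (y - x') * g y| ≤ K * h * B
  quadrature_error : ∀ {h : ℝ}, 0 < h → ∀ {B : ℝ} {f₁ f f₂ : ℤ → ℝ},
    (BddBelow (tsupport w) → ∀ i, |f₁ i| ≤ B) → (∀ i, |f i| ≤ B) → (∀ i, |f₂ i| ≤ B) → ∀ x : ℝ,
      |quadrature w h f₁ f f₂ (cellIdx h x) - ∫ y, w (y - x) * f (cellIdx h y)| ≤ K * h * B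

theorem exists_kernelBound {N m : ℕ} {P : BalanceSystem N m} {ρm ρM LF : ℝ}
    (hP : BaseAssumption P ρm ρM LF) : ∃ K, 0 ≤ K ∧ ∀ l k, KernelBound (P.kernel l k) K := by
  have hex : ∀ l k, ∃ K, KernelBound (P.kernel l k) K := by
    intro l k
    obtain ⟨V, hV0, hV⟩ := BoundedVariationOn.exists_hasOscBound (hP.kernel_bv l k)
    obtain ⟨W, hW0, hW⟩ := BoundedVariationOn.exists_abs_le (hP.kernel_bv l k)
    refine ⟨V + 4 * W, BoundedVariationOn.measurable (hP.kernel_bv l k), hP.kernel_nonneg l k,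
      hP.kernel_integrable l k, hP.kernel_integral l k, by positivity, hP.kernel_support l k,
      fun hg hgB h hh x x' hx => ?_, fun hh _ _ _ _ hf₁ hf hf₂ x => abs_quadrature_sub_integral_le
        (hP.kernel_integrable l k) (hP.kernel_support l k) hV hW hh hf₁ hf hf₂ x⟩
    refine (hV.abs_integral_shift_sub_le (hP.kernel_integrable l k) hg hgB hh hx).trans ?_
    have := (abs_nonneg _).trans (hgB 0)
    gcongr
    linarith
  choose K hK using hex
  -- The sum dominates each of the finitely many nonnegative constants, so one constant serves all
  -- kernels.
  refine ⟨∑ l, ∑ k, K l k, Finset.sum_nonneg fun l _ => Finset.sum_nonneg fun k _ =>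
    (hK l k).const_nonneg, fun l k => ?_⟩
  have hle : K l k ≤ ∑ l, ∑ k, K l k :=
    (Finset.single_le_sum (f := fun k => K l k) (fun k _ => (hK l k).const_nonneg)
      (Finset.mem_univ k)).trans (Finset.single_le_sum (f := fun l => ∑ k, K l k)
      (fun l _ => Finset.sum_nonneg fun k _ => (hK l k).const_nonneg) (Finset.mem_univ l))
  have h0 := (hK l k).const_nonneg
  refine { hK l k with
    const_nonneg := h0.trans hle
    shift := fun hg hgB h hh x x' hx => ((hK l k).shift hg hgB hh hx).trans ?_
    quadrature_error := fun hh B _ f _ hf₁ hf hf₂ x =>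
      ((hK l k).quadrature_error hh hf₁ hf hf₂ x).trans ?_ }
  · have := (abs_nonneg _).trans (hgB 0)
    gcongr
  · have := (abs_nonneg _).trans (hf 0)
    gcongr

theorem KernelBound.abs_integral_le {w : ℝ → ℝ} {K : ℝ} (hw : KernelBound w K) {B : ℝ}
    {g : ℝ → ℝ} (hgB : ∀ y, |g y| ≤ B) (x : ℝ) : |∫ y, w (y - x) * g y| ≤ B := by
  have hB : 0 ≤ B := (abs_nonneg _).trans (hgB 0)
  calc |∫ y, w (y - x) * g y| ≤ ∫ y, w (y - x) * B := by
        rw [← Real.norm_eq_abs]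
        refine norm_integral_le_of_norm_le ((hw.integrable.comp_sub_right x).mul_const B)
          (Eventually.of_forall fun y => ?_)
        rw [Real.norm_eq_abs, abs_mul, abs_of_nonneg (hw.nonneg _)]
        exact mul_le_mul_of_nonneg_left (hgB y) (hw.nonneg _)
    _ = B := by rw [integral_mul_const, integral_sub_right_eq_self, hw.integral_eq, one_mul]

theorem KernelBound.abs_quadrature_le {w : ℝ → ℝ} {K : ℝ} (hw : KernelBound w K) {h : ℝ}
    (hh : 0 < h) {B B' : ℝ} {f₁ f f₂ : ℤ → ℝ} (hf₁ : BddBelow (tsupport w) → ∀ i, |f₁ i| ≤ B')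
    (hf : ∀ i, |f i| ≤ B) (hf₂ : ∀ i, |f₂ i| ≤ B') (hBB : B ≤ B') (j : ℤ) :
    |quadrature w h f₁ f f₂ j| ≤ B + K * h * B' := by
  have h1 := hw.quadrature_error hh hf₁ (fun i => (hf i).trans hBB) hf₂ (j * h)
  rw [cellIdx_mul hh] at h1
  have h2 := hw.abs_integral_le (fun y => hf (cellIdx h y)) (j * h)
  rw [abs_le] at *
  constructor <;> linarith [h1.1, h1.2, h2.1, h2.2]

theorem measurable_comp_cellIdx (h : ℝ) (f : ℤ → ℝ) : Measurable fun y => f (cellIdx h y) :=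
  (measurable_of_countable f).comp (measurable_cellIdx h)

theorem KernelBound.abs_quadrature_succ_sub_le {w : ℝ → ℝ} {K : ℝ} (hw : KernelBound w K) {h : ℝ}
    (hh : 0 < h) {B : ℝ} {f₁ f f₂ : ℤ → ℝ} (hf₁ : BddBelow (tsupport w) → ∀ i, |f₁ i| ≤ B)
    (hf : ∀ i, |f i| ≤ B) (hf₂ : ∀ i, |f₂ i| ≤ B) (j : ℤ) :
    |quadrature w h f₁ f f₂ (j + 1) - quadrature w h f₁ f f₂ j|
      ≤ 3 * K * h * B := by
  have h1 := hw.quadrature_error hh hf₁ hf hf₂ (j * h)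
  have h2 := hw.quadrature_error hh hf₁ hf hf₂ (((j + 1 : ℤ) : ℝ) * h)
  have h3 := hw.shift (measurable_comp_cellIdx h f) (fun y => hf (cellIdx h y)) hh
    (x := ((j + 1 : ℤ) : ℝ) * h) (x' := j * h) (by
      push_cast
      rw [← sub_mul, add_sub_cancel_left, one_mul, abs_of_pos hh])
  rw [cellIdx_mul hh] at h1 h2
  rw [abs_le] at *
  constructor <;> linarith [h1.1, h1.2, h2.1, h2.2, h3.1, h3.2]

/-- The convolution of an increment over one cell is small. -/
theorem KernelBound.abs_integral_increment_le {w : ℝ → ℝ} {K : ℝ} (hw : KernelBound w K) {h : ℝ}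
    (hh : 0 < h) {B : ℝ} {f : ℤ → ℝ} (hf : ∀ i, |f i| ≤ B) (x : ℝ) :
    |∫ y, w (y - x) * (f (cellIdx h y) - f (cellIdx h y - 1))| ≤ K * h * B := by
  have hi : ∀ z : ℝ, Integrable fun y => w (y - z) * f (cellIdx h y) := fun z =>
    (hw.integrable.comp_sub_right z).mul_bdd (c := B)
      (measurable_comp_cellIdx h f).aestronglyMeasurable (Eventually.of_forall fun y => hf _)
  have hi' : Integrable fun y => w (y - x) * f (cellIdx h y - 1) :=
    (hw.integrable.comp_sub_right x).mul_bdd (c := B)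
      (measurable_comp_cellIdx h fun i => f (i - 1)).aestronglyMeasurable
      (Eventually.of_forall fun y => hf _)
  -- Summation by parts in integral form: the shift by one cell passes from `f` to the kernel, which
  -- has the required modulus of continuity in `L¹`.
  have hs : ∫ y, w (y - x) * f (cellIdx h y - 1) = ∫ y, w (y - (x - h)) * f (cellIdx h y) := by
    rw [← integral_sub_right_eq_self (fun y => w (y - (x - h)) * f (cellIdx h y)) h]
    simp only [cellIdx_sub hh]
    congr 1
    ext y
    congr 2
    ring
  simp only [mul_sub]
  rw [integral_sub (hi x) hi', hs]
  exact hw.shift (measurable_comp_cellIdx h f) (fun y => hf _) hh (by simp [abs_of_pos hh])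

/-! ### Stability of the scheme -/

theorem abs_sum_le_mul {n : ℕ} {f : Fin n → ℝ} {c : ℝ} (h : ∀ i, |f i| ≤ c) :
    |∑ i, f i| ≤ n * c := by
  refine (Finset.abs_sum_le_sum_abs _ _).trans ((Finset.sum_le_card_nsmul _ _ c fun i _ => h i).trans
    (le_of_eq ?_))
  simp

theorem sum_abs_le_mul {n : ℕ} {f : Fin n → ℝ} {c : ℝ} (h : ∀ i, |f i| ≤ c) :
    ∑ i, |f i| ≤ n * c := by
  refine (Finset.sum_le_card_nsmul _ _ c fun i _ => h i).trans (le_of_eq ?_)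
  simp

theorem mem_box_iff {ι : Type} {b : ℝ} {v : ι → ℝ} : v ∈ box b ↔ ∀ i, |v i| ≤ b := by
  simp [box, abs_le]

theorem abs_minmod_le_left (a b : ℝ) : |minmod a b| ≤ |a| := by
  unfold minmod
  split_ifs with h1 h2
  · simp
  · exact le_rfl
  · exact (not_le.1 h2).le

theorem abs_minmod_le_right (a b : ℝ) : |minmod a b| ≤ |b| := by
  unfold minmod
  split_ifs with h1 h2
  · simp
  · exact h2
  · exact le_rfl

theorem Grid.abs_limited_le_right (G : Grid) (a v b : ℝ) : |G.limited a v b| ≤ |b - v| :=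
  (abs_minmod_le_left _ _).trans (abs_minmod_le_left _ _)

theorem Grid.abs_limited_le_left (G : Grid) (a v b : ℝ) : |G.limited a v b| ≤ |v - a| :=
  (abs_minmod_le_left _ _).trans (abs_minmod_le_right _ _)

/-- The bound `C Δx^δ` of the truncation. -/
def Grid.trunc (G : Grid) : ℝ := |G.C * G.dx ^ G.δ|

theorem Grid.abs_limited_le_trunc (G : Grid) (a v b : ℝ) : |G.limited a v b| ≤ G.trunc := by
  refine (abs_minmod_le_right _ _).trans ?_
  rw [abs_mul, Grid.trunc]
  refine mul_le_of_le_one_left (abs_nonneg _) ?_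
  rcases Real.sign_apply_eq (v - a) with h | h | h <;> simp [h]

section Slope

variable {G : Grid} (hdx : 0 < G.dx) (r : ℤ → Fin N → ℝ) (j : ℤ) (k : Fin N)
include hdx

theorem dx_mul_slope :
    G.dx * slope G r j k = G.limited (r (j - 1) k) (r j k) (r (j + 1) k) := by
  rw [slope, mul_div_cancel₀ _ hdx.ne']

theorem abs_dx_mul_slope_le_right : |G.dx * slope G r j k| ≤ |r (j + 1) k - r j k| := by
  rw [dx_mul_slope hdx]
  exact G.abs_limited_le_right _ _ _

theorem abs_dx_mul_slope_le_left : |G.dx * slope G r j k| ≤ |r j k - r (j - 1) k| := by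
  rw [dx_mul_slope hdx]
  exact G.abs_limited_le_left _ _ _

theorem abs_dx_mul_slope_succ_le : |G.dx * slope G r (j + 1) k| ≤ |r (j + 1) k - r j k| := by
  simpa using abs_dx_mul_slope_le_left hdx r (j + 1) k

theorem abs_dx_mul_slope_le_trunc : |G.dx * slope G r j k| ≤ G.trunc := by
  rw [dx_mul_slope hdx]
  exact G.abs_limited_le_trunc _ _ _

theorem abs_slope_mul_le {B : ℝ} (hr : ∀ j k, |r j k| ≤ B) {y : ℝ} (hy : |y| ≤ G.dx) :
    |r j k + slope G r j k * y| ≤ 3 * B := by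
  have h1 := abs_dx_mul_slope_le_right hdx r j k
  have h2 : |slope G r j k * y| ≤ |G.dx * slope G r j k| := by
    rw [abs_mul, abs_mul, mul_comm, abs_of_pos hdx]
    exact mul_le_mul_of_nonneg_right hy (abs_nonneg _)
  have h3 := abs_sub (r (j + 1) k) (r j k)
  have h4 := abs_add_le (r j k) (slope G r j k * y)
  linarith [hr j k, hr (j + 1) k]

end Slope

/-! ### The discrete nonlocal quantities -/

section DiscreteConvolution

variable {P : BalanceSystem N m} {G : Grid} {K : ℝ}
  (hK : ∀ l k, KernelBound (P.kernel l k) K) (hdx : 0 < G.dx)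
  {r : ℤ → Fin N → ℝ} {B : ℝ} (hr : ∀ j k, |r j k| ≤ B)
include hK hdx hr

/-- Convolution with a probability density does not increase the maximum norm, so only the
quadrature error exceeds `N * B`. The factor `3 * B` bounds the linear reconstruction at distance at
most `Δx` from the cell centre. -/
theorem abs_discR_le (j : ℤ) (l : Fin m) : |discR P G r j l| ≤ N * (B + K * G.dx * (3 * B)) := by
  refine abs_sum_le_mul fun k => ?_
  have hB : 0 ≤ B := (abs_nonneg _).trans (hr 0 k)
  exact (hK l k).abs_quadrature_le hdx
    (fun hb i => abs_slope_mul_le hdx r i k hr (abs_mid₁_add_le hdx (hK l k).zero_mem hb))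
    (fun i => hr i k) (fun i => abs_slope_mul_le hdx r i k hr (abs_mid₂_sub_le hdx)) (by linarith) j

theorem abs_discR_succ_sub_le (j : ℤ) (l : Fin m) :
    |discR P G r (j + 1) l - discR P G r j l| ≤ N * (3 * K * G.dx * (3 * B)) := by
  rw [discR, discR, ← Finset.sum_sub_distrib]
  refine abs_sum_le_mul fun k => ?_
  have hB : 0 ≤ B := (abs_nonneg _).trans (hr 0 k)
  exact (hK l k).abs_quadrature_succ_sub_le hdx
    (fun hb i => abs_slope_mul_le hdx r i k hr (abs_mid₁_add_le hdx (hK l k).zero_mem hb))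
    (fun i => (hr i k).trans (by linarith))
    (fun i => abs_slope_mul_le hdx r i k hr (abs_mid₂_sub_le hdx)) j

/-- The discrete nonlocal quantity approximates the exact one of the piecewise constant function. -/
theorem abs_discR_sub_integral_le (x : ℝ) (l : Fin m) :
    |discR P G r (cellIdx G.dx x) l
      - ∑ k, ∫ y, P.kernel l k (y - x) * r (cellIdx G.dx y) k| ≤ N * (K * G.dx * (3 * B)) := by
  rw [discR, ← Finset.sum_sub_distrib]
  refine abs_sum_le_mul fun k => ?_
  have hB : 0 ≤ B := (abs_nonneg _).trans (hr 0 k)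
  exact (hK l k).quadrature_error hdx
    (fun hb i => abs_slope_mul_le hdx r i k hr (abs_mid₁_add_le hdx (hK l k).zero_mem hb))
    (fun i => (hr i k).trans (by linarith))
    (fun i => abs_slope_mul_le hdx r i k hr (abs_mid₂_sub_le hdx)) x

end DiscreteConvolution

theorem Grid.dt_mul_div (G : Grid) (x : ℝ) : G.dt * (x / G.dx) = G.ratio * x := by
  rw [Grid.ratio]
  ring

theorem abs_halfR_sub_discR_le {P : BalanceSystem N m} {G : Grid} {K : ℝ}
    (hK : ∀ l k, KernelBound (P.kernel l k) K) (hdx : 0 < G.dx) (hdt : 0 < G.dt)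
    {r : ℤ → Fin N → ℝ} {e : ℝ} (he : ∀ j k, |G.dt * discRate P G r j k| ≤ e) (j : ℤ) (l : Fin m) :
    |halfR P G r j l - discR P G r j l| ≤ N * (e + K * G.dx * e) := by
  have hq : ∀ j k, |discRate P G r j k| ≤ e / G.dt := fun j k => by
    have := he j k
    rwa [abs_mul, abs_of_pos hdt, mul_comm, ← le_div_iff₀ hdt] at this
  rw [halfR, add_sub_cancel_left]
  have h1 : |∑ k, quadrature (P.kernel l k) G.dx (fun i => discRate P G r i k)
      (fun i => discRate P G r i k) (fun i => discRate P G r i k) j|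
      ≤ N * (e / G.dt + K * G.dx * (e / G.dt)) :=
    abs_sum_le_mul fun k => (hK l k).abs_quadrature_le hdx (fun _ i => hq i k) (fun i => hq i k)
      (fun i => hq i k) le_rfl j
  rw [abs_mul, abs_of_pos (by positivity)]
  calc _ ≤ G.dt / 2 * (N * (e / G.dt + K * G.dx * (e / G.dt))) := by gcongr
    _ = N * (e + K * G.dx * e) / 2 := by field_simp
    _ ≤ N * (e + K * G.dx * e) := by
      -- For `N = 0` nothing is known about the sign of `e`; nonnegativity of the whole product is
      -- read off from `h1` instead.
      have h0 : 0 ≤ N * (e + K * G.dx * e) := by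
        have h2 := (abs_nonneg _).trans h1
        have h3 : N * (e + K * G.dx * e) = N * (e / G.dt + K * G.dx * (e / G.dt)) * G.dt := by
          field_simp
        rw [h3]
        positivity
      linarith

theorem abs_halfR_succ_sub_le {P : BalanceSystem N m} {G : Grid} {K : ℝ}
    (hK : ∀ l k, KernelBound (P.kernel l k) K) (hdx : 0 < G.dx) (hdt : 0 < G.dt)
    {r : ℤ → Fin N → ℝ} {B e : ℝ} (hr : ∀ j k, |r j k| ≤ B)
    (he : ∀ j k, |G.dt * discRate P G r j k| ≤ e) (j : ℤ) (l : Fin m) :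
    |halfR P G r (j + 1) l - halfR P G r j l| ≤ N * (3 * K * G.dx * (3 * B + e)) := by
  have hq : ∀ j k, |discRate P G r j k| ≤ e / G.dt := fun j k => by
    have := he j k
    rwa [abs_mul, abs_of_pos hdt, mul_comm, ← le_div_iff₀ hdt] at this
  have h0 := abs_discR_succ_sub_le hK hdx hr j l
  have h1 : |∑ k, (quadrature (P.kernel l k) G.dx (fun i => discRate P G r i k)
      (fun i => discRate P G r i k) (fun i => discRate P G r i k) (j + 1)
      - quadrature (P.kernel l k) G.dx (fun i => discRate P G r i k)
      (fun i => discRate P G r i k) (fun i => discRate P G r i k) j)|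
      ≤ N * (3 * K * G.dx * (e / G.dt)) :=
    abs_sum_le_mul fun k => (hK l k).abs_quadrature_succ_sub_le hdx (fun _ i => hq i k)
      (fun i => hq i k) (fun i => hq i k) j
  rw [Finset.sum_sub_distrib] at h1
  rw [halfR, halfR]
  set Q₁ := ∑ k, quadrature (P.kernel l k) G.dx (fun i => discRate P G r i k)
      (fun i => discRate P G r i k) (fun i => discRate P G r i k) (j + 1)
  set Q₀ := ∑ k, quadrature (P.kernel l k) G.dx (fun i => discRate P G r i k)
      (fun i => discRate P G r i k) (fun i => discRate P G r i k) j
  have h2 : |G.dt / 2 * (Q₁ - Q₀)| ≤ N * (3 * K * G.dx * e) := by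
    rw [abs_mul, abs_of_pos (by positivity)]
    calc _ ≤ G.dt / 2 * (N * (3 * K * G.dx * (e / G.dt))) := by gcongr
      _ = N * (3 * K * G.dx * e) / 2 := by field_simp
      _ ≤ _ := by
        have h3 : N * (3 * K * G.dx * e) = N * (3 * K * G.dx * (e / G.dt)) * G.dt := by
          field_simp
        have h4 := (abs_nonneg _).trans h1
        have : 0 ≤ N * (3 * K * G.dx * e) := by
          rw [h3]
          positivity
        linarith
  have h3 : discR P G r (j + 1) l + G.dt / 2 * Q₁ - (discR P G r j l + G.dt / 2 * Q₀)
      = (discR P G r (j + 1) l - discR P G r j l) + G.dt / 2 * (Q₁ - Q₀) := by ring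
  rw [h3]
  refine (abs_add_le _ _).trans ((add_le_add h0 h2).trans (le_of_eq (by ring)))

/-- All arguments at which flux and source are evaluated in one step are in the range of the
assumptions. -/
structure InRange (P : BalanceSystem N m) (G : Grid) (ρM : ℝ) (r : ℤ → Fin N → ℝ) : Prop where
  rho : ∀ j k, |r j k| ≤ ρM
  discR : ∀ j, discR P G r j ∈ box (N * ρM)
  halfRho : ∀ j, halfRho P G r j ∈ box ρM
  halfR : ∀ j, halfR P G r j ∈ box (N * ρM)

section Base

variable {P : BalanceSystem N m} {ρm ρM LF : ℝ} (hP : BaseAssumption P ρm ρM LF)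
include hP

theorem BaseAssumption.rhoM_pos : 0 < ρM := hP.rhom_nonneg.trans_lt hP.rhom_lt_rhoM

theorem BaseAssumption.exists_source_bound : ∃ Sb, 0 ≤ Sb ∧
    ∀ k, ∀ r ∈ box ρM, ∀ R ∈ box (N * ρM), |P.source k r R| ≤ Sb := by
  obtain ⟨LS, hLS⟩ := hP.source_lip
  have h0 := hP.rhoM_pos
  have h1 := hP.rhom_nonneg
  have h2 := hP.rhom_lt_rhoM
  refine ⟨|LS| * (N * (2 * ρM)), by positivity, fun k r hr R hR => ?_⟩
  have hm : (fun _ : Fin N => ρm) ∈ box ρM := mem_box_iff.2 fun i => by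
    rw [abs_of_nonneg h1]
    exact h2.le
  have := hLS k r hr _ hm R hR R hR
  rw [hP.source_rhom, sub_zero] at this
  have h3 : ∑ i, |r i - ρm| ≤ N * (2 * ρM) := sum_abs_le_mul fun i => by
    have h4 := abs_sub (r i) ρm
    rw [abs_of_nonneg h1] at h4
    linarith [mem_box_iff.1 hr i]
  simp only [sub_self, abs_zero, Finset.sum_const_zero, add_zero] at this
  have h4 : 0 ≤ ∑ i, |r i - ρm| := Finset.sum_nonneg fun i _ => abs_nonneg _
  calc _ ≤ _ := this
    _ ≤ |LS| * ∑ i, |r i - ρm| := mul_le_mul_of_nonneg_right (le_abs_self _) h4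
    _ ≤ _ := by gcongr

theorem BaseAssumption.abs_flux_le {k : Fin N} {r : ℝ} (hr : |r| ≤ ρM) {R : Fin m → ℝ}
    (hR : R ∈ box (N * ρM)) : |P.flux k r R| ≤ LF * (2 * ρM) := by
  have h1 := hP.rhom_nonneg
  have h2 := hP.rhom_lt_rhoM
  have := hP.flux_lip k r (abs_le.1 hr) ρm ⟨by linarith, h2.le⟩ R hR R hR
  rw [hP.flux_rhom, sub_zero] at this
  simp only [sub_self, abs_zero, Finset.sum_const_zero, add_zero] at this
  refine this.trans (mul_le_mul_of_nonneg_left ?_ hP.LF_nonneg)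
  have h4 := abs_sub r ρm
  rw [abs_of_nonneg h1] at h4
  linarith

/-- Bound for the increments of the flux. -/
theorem BaseAssumption.abs_flux_sub_le {k : Fin N} {r r' : ℝ} (hr : |r| ≤ ρM) (hr' : |r'| ≤ ρM)
    {R R' : Fin m → ℝ} (hR : R ∈ box (N * ρM)) (hR' : R' ∈ box (N * ρM)) {d c : ℝ}
    (hd : |r - r'| ≤ d) (hc : ∀ l, |R l - R' l| ≤ c) :
    |P.flux k r R - P.flux k r' R'| ≤ LF * (d + m * c) :=
  (hP.flux_lip k r (abs_le.1 hr) r' (abs_le.1 hr') R hR R' hR').trans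
    (mul_le_mul_of_nonneg_left (add_le_add hd (sum_abs_le_mul hc)) hP.LF_nonneg)

variable {G : Grid} {K : ℝ} (hK : ∀ l k, KernelBound (P.kernel l k) K) (hdx : 0 < G.dx)
  {r : ℤ → Fin N → ℝ} (hr : ∀ j k, |r j k| ≤ ρM) (hR : ∀ j, discR P G r j ∈ box (N * ρM))
include hK hdx hr hR

theorem abs_discFlux_succ_sub_le (j : ℤ) (k : Fin N) :
    |discFlux P G r (j + 1) k - discFlux P G r j k|
      ≤ LF * (|r (j + 1) k - r j k| + m * (N * (3 * K * G.dx * (3 * ρM)))) :=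
  hP.abs_flux_sub_le (hr _ _) (hr _ _) (hR _) (hR _) le_rfl
    (abs_discR_succ_sub_le hK hdx hr j)

/-- Together with its companion for the cell `j + 1`, this bounds the flux slopes on both sides of
an interface by the same increment of the data: minmod is dominated by either of its one-sided
differences. The stability estimate relies on this. -/
theorem abs_dt_mul_fluxSlope_le (hdt : 0 < G.dt) (j : ℤ) (k : Fin N) :
    |G.dt * fluxSlope P G r j k| ≤ G.ratio * LF *
      (|r (j + 1) k - r j k| + m * (N * (3 * K * G.dx * (3 * ρM)))) := by
  have hlam : 0 ≤ G.ratio := by rw [Grid.ratio]; positivity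
  rw [fluxSlope, Grid.dt_mul_div, abs_mul, abs_of_nonneg hlam, mul_assoc]
  exact mul_le_mul_of_nonneg_left ((G.abs_limited_le_right _ _ _).trans
    (abs_discFlux_succ_sub_le hP hK hdx hr hR j k)) hlam

theorem abs_dt_mul_fluxSlope_succ_le (hdt : 0 < G.dt) (j : ℤ) (k : Fin N) :
    |G.dt * fluxSlope P G r (j + 1) k| ≤ G.ratio * LF *
      (|r (j + 1) k - r j k| + m * (N * (3 * K * G.dx * (3 * ρM)))) := by
  have hlam : 0 ≤ G.ratio := by rw [Grid.ratio]; positivity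
  rw [fluxSlope, Grid.dt_mul_div, abs_mul, abs_of_nonneg hlam, mul_assoc, add_sub_cancel_right]
  exact mul_le_mul_of_nonneg_left ((G.abs_limited_le_left _ _ _).trans
    (abs_discFlux_succ_sub_le hP hK hdx hr hR j k)) hlam

omit hP hK hr hR in
theorem abs_dt_mul_fluxSlope_le_trunc (hdt : 0 < G.dt) (j : ℤ) (k : Fin N) :
    |G.dt * fluxSlope P G r j k| ≤ G.ratio * G.trunc := by
  have hlam : 0 ≤ G.ratio := by rw [Grid.ratio]; positivity
  rw [fluxSlope, Grid.dt_mul_div, abs_mul, abs_of_nonneg hlam]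
  exact mul_le_mul_of_nonneg_left (G.abs_limited_le_trunc _ _ _) hlam

end Base

/-! ### Growth of the maximum norm in one step -/

/-- The left side is the maximum of `|a|` and `|b|`. Hence a mean of two values leaves room for an
error of half their distance. -/
theorem half_abs_add_add_half_abs_sub_le {a b c : ℝ} (ha : |a| ≤ c) (hb : |b| ≤ c) :
    |a + b| / 2 + |b - a| / 2 ≤ c := by
  rw [abs_le] at ha hb
  rcases abs_cases (a + b) with h | h <;> rcases abs_cases (b - a) with h' | h' <;> linarith

section Stability

variable {P : BalanceSystem N m} {ρm ρM LF : ℝ} (hP : BaseAssumption P ρm ρM LF)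
  {K Sb : ℝ} (hK : ∀ l k, KernelBound (P.kernel l k) K) (hSb0 : 0 ≤ Sb)
  (hSb : ∀ k, ∀ r ∈ box ρM, ∀ R ∈ box (N * ρM), |P.source k r R| ≤ Sb)
  {G : Grid} (hdx : 0 < G.dx) (hdt : 0 < G.dt)

theorem Grid.ratio_nonneg (hdx : 0 < G.dx) (hdt : 0 < G.dt) : 0 ≤ G.ratio := by
  rw [Grid.ratio]
  positivity

theorem Grid.ratio_mul_dx (hdx : 0 < G.dx) : G.ratio * G.dx = G.dt := by
  rw [Grid.ratio, div_mul_cancel₀ _ hdx.ne']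

/-- Bound for `Δt` times the discrete time derivative. -/
def rateBound (N m : ℕ) (ρM LF K Sb : ℝ) (G : Grid) : ℝ :=
  G.dt * Sb + min (G.ratio * G.trunc)
    (G.ratio * LF * (2 * ρM + m * (N * (3 * K * G.dx * (3 * ρM)))))

include hP hK hSb hdx hdt in
-- Both arguments of the minimum in `rateBound` are needed. The one with `trunc` makes the predictor
-- step tend to zero. The other does not involve `C` and `δ`, so the growth rate derived from it is
-- independent of them; it also vanishes for `LF = 0`, where the CFL condition does not bound the
-- ratio.
theorem abs_dt_mul_discRate_le {r : ℤ → Fin N → ℝ} (hr : ∀ j k, |r j k| ≤ ρM)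
    (hR : ∀ j, discR P G r j ∈ box (N * ρM)) (j : ℤ) (k : Fin N) :
    |G.dt * discRate P G r j k| ≤ rateBound N m ρM LF K Sb G := by
  have h1 := hSb k (r j) (mem_box_iff.2 fun i => hr j i) _ (hR j)
  have h2 := abs_dt_mul_fluxSlope_le hP hK hdx hr hR hdt j k
  have h3 := abs_dt_mul_fluxSlope_le_trunc (P := P) (r := r) hdx hdt j k
  have hlam := G.ratio_nonneg hdx hdt
  have h4 : |G.dt * fluxSlope P G r j k| ≤
      G.ratio * LF * (2 * ρM + m * (N * (3 * K * G.dx * (3 * ρM)))) := by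
    refine h2.trans (mul_le_mul_of_nonneg_left ?_ (mul_nonneg hlam hP.LF_nonneg))
    have h5 := abs_sub (r (j + 1) k) (r j k)
    linarith [hr j k, hr (j + 1) k]
  rw [discRate, mul_sub, rateBound]
  refine (abs_sub _ _).trans (add_le_add ?_ (le_min h3 h4))
  rw [abs_mul, abs_of_pos hdt]
  exact mul_le_mul_of_nonneg_left h1 hdt.le

include hP hSb0 hdx hdt in
theorem rateBound_nonneg (hK0 : 0 ≤ K) : 0 ≤ rateBound N m ρM LF K Sb G := by
  have hlam := G.ratio_nonneg hdx hdt
  have h1 := hP.rhoM_pos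
  have h2 := hP.LF_nonneg
  have h3 : 0 ≤ G.trunc := abs_nonneg _
  rw [rateBound]
  positivity

include hP hK hSb0 hSb hdx hdt in
/-- Densities with a bound below `ρM` stay in the range of the assumptions if the step sizes are
small. -/
theorem inRange_of_abs_le (hK0 : 0 ≤ K) {β : ℝ}
    (hsmall : β + K * G.dx * (3 * ρM) + (1 + K * G.dx) * rateBound N m ρM LF K Sb G ≤ ρM)
    {r : ℤ → Fin N → ℝ} (hr : ∀ j k, |r j k| ≤ β) : InRange P G ρM r := by
  have he := rateBound_nonneg (N := N) (m := m) hP hSb0 hdx hdt hK0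
  set e := rateBound N m ρM LF K Sb G with hedef
  have hρ := hP.rhoM_pos
  have hKd : 0 ≤ K * G.dx := by positivity
  have hβM : β ≤ ρM := by nlinarith [mul_nonneg hKd hρ.le, mul_nonneg hKd he]
  have hrM : ∀ j k, |r j k| ≤ ρM := fun j k => (hr j k).trans hβM
  have h3 : K * G.dx * (3 * β) ≤ K * G.dx * (3 * ρM) := by gcongr
  have hRle : ∀ j l, |discR P G r j l| ≤ N * (β + K * G.dx * (3 * β)) := abs_discR_le hK hdx hr
  have hR : ∀ j, discR P G r j ∈ box (N * ρM) := fun j => mem_box_iff.2 fun l =>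
    (hRle j l).trans (mul_le_mul_of_nonneg_left (by nlinarith [mul_nonneg hKd he])
      (Nat.cast_nonneg N))
  have hq := abs_dt_mul_discRate_le hP hK hSb hdx hdt hrM hR
  refine ⟨hrM, hR, fun j => mem_box_iff.2 fun k => ?_, fun j => mem_box_iff.2 fun l => ?_⟩
  · have h4 : halfRho P G r j k = r j k + G.dt * discRate P G r j k / 2 := by
      rw [halfRho]
      ring
    rw [h4]
    have h5 := abs_add_le (r j k) (G.dt * discRate P G r j k / 2)
    rw [abs_div, abs_two] at h5
    nlinarith [hr j k, hq j k, mul_nonneg hKd he, mul_nonneg hKd hρ.le]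
  · have h4 := abs_halfR_sub_discR_le hK hdx hdt hq j l
    have h5 := abs_sub_abs_le_abs_sub (halfR P G r j l) (discR P G r j l)
    have h6 : (N : ℝ) * (β + K * G.dx * (3 * β)) + N * (e + K * G.dx * e) ≤ N * ρM := by
      rw [← mul_add]
      exact mul_le_mul_of_nonneg_left (by linarith) (Nat.cast_nonneg N)
    linarith [hRle j l]

variable {r : ℤ → Fin N → ℝ} (hr : InRange P G ρM r)

/-- Bound for the total increment of `R^{n+1/2}` over one cell, divided by `Δx`. -/
def halfRConst (N m : ℕ) (ρM K Sb : ℝ) : ℝ :=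
  m * (N * (3 * K * (3 * ρM + (Sb + (2 * ρM + m * (N * (3 * K * (3 * ρM))))))))

include hP hK hSb hdx hdt hr in
theorem sum_halfR_increment_le (hK0 : 0 ≤ K) (hSb0 : 0 ≤ Sb) (hdx1 : G.dx ≤ 1) (hdt1 : G.dt ≤ 1)
    (hcfl : G.ratio * LF ≤ 1) (j : ℤ) :
    ∀ l, |halfR P G r (j + 1) l - halfR P G r j l|
      ≤ N * (3 * K * (3 * ρM + (Sb + (2 * ρM + m * (N * (3 * K * (3 * ρM))))))) * G.dx := by
  intro l
  have hρ := hP.rhoM_pos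
  have hq := abs_dt_mul_discRate_le hP hK hSb hdx hdt hr.rho hr.discR
  refine (abs_halfR_succ_sub_le hK hdx hdt hr.rho hq j l).trans ?_
  have hlam := mul_nonneg (G.ratio_nonneg hdx hdt) hP.LF_nonneg
  -- The second argument of the minimum is taken here, which keeps `C` and `δ` out of the constant.
  have h1 : rateBound N m ρM LF K Sb G ≤ Sb + (2 * ρM + m * (N * (3 * K * (3 * ρM)))) := by
    rw [rateBound]
    refine add_le_add (mul_le_of_le_one_left hSb0 hdt1) ((min_le_right _ _).trans ?_)
    refine (mul_le_of_le_one_left (by positivity) hcfl).trans ?_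
    have : 3 * K * G.dx * (3 * ρM) ≤ 3 * K * (3 * ρM) := by
      refine mul_le_mul_of_nonneg_right (mul_le_of_le_one_right (by positivity) hdx1) (by positivity)
    gcongr
  have h2 : (N : ℝ) * (3 * K * G.dx * (3 * ρM + rateBound N m ρM LF K Sb G)) ≤
      N * (3 * K * G.dx * (3 * ρM + (Sb + (2 * ρM + m * (N * (3 * K * (3 * ρM))))))) := by
    gcongr
  refine h2.trans (le_of_eq (by ring))

/-- The growth rate of the maximum norm. -/
def growthRate (N m : ℕ) (ρM LF K Sb : ℝ) : ℝ :=
  2 * Sb + LF * (m * (N * (3 * K * (3 * ρM))) + halfRConst N m ρM K Sb)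

theorem growthRate_nonneg (hK0 : 0 ≤ K) (hSb0 : 0 ≤ Sb) (hLF : 0 ≤ LF) (hρ : 0 ≤ ρM) :
    0 ≤ growthRate N m ρM LF K Sb := by
  rw [growthRate, halfRConst]
  positivity

include hP hK hSb hdx hdt hr in
-- Let `D` be the increment of the data over the interface. The mean is at most `b - D / 2`. The two
-- slopes, each at most `D` with weight `1 / 8`, cost `D / 4`. The flux difference costs `μ (1 + μ)
-- D ≤ D / 4`, with one factor `μ` from the flux and the other from the flux slopes in the
-- predictor. The rest is `O(Δt)`: sources carry a factor `Δt`, increments of the nonlocal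
-- quantities are `O(Δx)`, and `μ Δx = LF Δt`.
theorem abs_staggered_le (hK0 : 0 ≤ K) (hSb0 : 0 ≤ Sb) (hdx1 : G.dx ≤ 1) (hdt1 : G.dt ≤ 1)
    (hcfl : G.ratio * LF ≤ (Real.sqrt 2 - 1) / 2) {b : ℝ} (hb : ∀ j k, |r j k| ≤ b)
    (j : ℤ) (k : Fin N) :
    |staggered P G r j k| ≤ b + growthRate N m ρM LF K Sb * G.dt := by
  have hρ := hP.rhoM_pos
  have hLF := hP.LF_nonneg
  have hlam := G.ratio_nonneg hdx hdt
  set μ := G.ratio * LF with hμ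
  have hμ0 : 0 ≤ μ := mul_nonneg hlam hLF
  have hsq : Real.sqrt 2 * Real.sqrt 2 = 2 := Real.mul_self_sqrt (by norm_num)
  have hs0 : 0 ≤ Real.sqrt 2 := Real.sqrt_nonneg 2
  have hs2 : Real.sqrt 2 ≤ 2 := by nlinarith
  have hμ1 : μ ≤ 1 := by linarith
  -- The CFL number `(√2 - 1) / 2` is the positive root of `μ (1 + μ) = 1 / 4`.
  have hμμ : μ * (1 + μ) ≤ 1 / 4 := by nlinarith
  have hμdx : μ * G.dx = LF * G.dt := by
    rw [hμ, mul_right_comm, G.ratio_mul_dx hdx, mul_comm]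
  set D := |r (j + 1) k - r j k| with hD
  have hD0 : 0 ≤ D := abs_nonneg _
  set c₁ : ℝ := m * (N * (3 * K * (3 * ρM))) with hc₁
  have hc₁0 : 0 ≤ c₁ := by positivity
  set c₂ : ℝ := halfRConst N m ρM K Sb with hc₂
  have hc₂0 : 0 ≤ c₂ := by rw [hc₂, halfRConst]; positivity
  -- the slopes
  have hs1 := abs_dx_mul_slope_le_right hdx r j k
  have hs1' := abs_dx_mul_slope_succ_le hdx r j k
  -- the fluxes
  have hσ : |G.dt * fluxSlope P G r j k| ≤ μ * (D + c₁ * G.dx) :=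
    (abs_dt_mul_fluxSlope_le hP hK hdx hr.rho hr.discR hdt j k).trans (le_of_eq (by rw [hc₁]; ring))
  have hσ' : |G.dt * fluxSlope P G r (j + 1) k| ≤ μ * (D + c₁ * G.dx) :=
    (abs_dt_mul_fluxSlope_succ_le hP hK hdx hr.rho hr.discR hdt j k).trans
      (le_of_eq (by rw [hc₁]; ring))
  have hSj : ∀ i, |P.source k (r i) (discR P G r i)| ≤ Sb := fun i =>
    hSb k _ (mem_box_iff.2 fun a => hr.rho i a) _ (hr.discR i)
  have hhalf : |halfRho P G r (j + 1) k - halfRho P G r j k| ≤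
      D + G.dt * Sb + μ * (D + c₁ * G.dx) := by
    have h1 : halfRho P G r (j + 1) k - halfRho P G r j k = (r (j + 1) k - r j k)
        + (G.dt / 2 * (P.source k (r (j + 1)) (discR P G r (j + 1))
          - P.source k (r j) (discR P G r j))
        - (G.dt * fluxSlope P G r (j + 1) k - G.dt * fluxSlope P G r j k) / 2) := by
      rw [halfRho, halfRho, discRate, discRate]
      ring
    have h2 : |G.dt / 2 * (P.source k (r (j + 1)) (discR P G r (j + 1))
          - P.source k (r j) (discR P G r j))| ≤ G.dt * Sb := by
      rw [abs_mul, abs_of_pos (by positivity)]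
      have h3 := (abs_sub (P.source k (r (j + 1)) (discR P G r (j + 1)))
        (P.source k (r j) (discR P G r j))).trans (add_le_add (hSj _) (hSj _))
      calc _ ≤ G.dt / 2 * (Sb + Sb) := by gcongr
        _ = _ := by ring
    have h3 : |(G.dt * fluxSlope P G r (j + 1) k - G.dt * fluxSlope P G r j k) / 2| ≤
        μ * (D + c₁ * G.dx) := by
      rw [abs_div, abs_two]
      have := abs_sub (G.dt * fluxSlope P G r (j + 1) k) (G.dt * fluxSlope P G r j k)
      linarith
    rw [h1]
    refine (abs_add_le _ _).trans ?_
    have := (abs_sub _ _).trans (add_le_add h2 h3)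
    linarith
  have hflux : G.ratio * |halfFlux P G r (j + 1) k - halfFlux P G r j k| ≤
      D / 4 + (Sb + LF * (c₁ + c₂)) * G.dt := by
    have h1 : |halfFlux P G r (j + 1) k - halfFlux P G r j k| ≤
        LF * ((D + G.dt * Sb + μ * (D + c₁ * G.dx)) + m * (N * (3 * K * (3 * ρM + (Sb + (2 * ρM +
          m * (N * (3 * K * (3 * ρM))))))) * G.dx)) :=
      hP.abs_flux_sub_le (mem_box_iff.1 (hr.halfRho _) k) (mem_box_iff.1 (hr.halfRho _) k)
        (hr.halfR _) (hr.halfR _) hhalf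
        (sum_halfR_increment_le hP hK hSb hdx hdt hr hK0 hSb0 hdx1 hdt1 hμ1 j)
    have h2 : (D + G.dt * Sb + μ * (D + c₁ * G.dx)) + m * (N * (3 * K * (3 * ρM + (Sb + (2 * ρM +
          m * (N * (3 * K * (3 * ρM))))))) * G.dx)
        = D + G.dt * Sb + μ * (D + c₁ * G.dx) + c₂ * G.dx := by
      rw [hc₂, halfRConst]
      ring
    rw [h2] at h1
    calc _ ≤ G.ratio * (LF * (D + G.dt * Sb + μ * (D + c₁ * G.dx) + c₂ * G.dx)) := by gcongr
      _ = μ * (1 + μ) * D + μ * (G.dt * Sb) + μ * ((μ * G.dx) * c₁) + (μ * G.dx) * c₂ := by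
          rw [hμ]; ring
      _ ≤ 1 / 4 * D + 1 * (G.dt * Sb) + 1 * ((LF * G.dt) * c₁) + (LF * G.dt) * c₂ := by
          rw [hμdx]
          gcongr
      _ = _ := by ring
  have hsrc : ∀ i, |halfSource P G r i k| ≤ Sb := fun i =>
    hSb k _ (hr.halfRho i) _ (hr.halfR i)
  have hmax := half_abs_add_add_half_abs_sub_le (hb j k) (hb (j + 1) k)
  rw [staggered]
  set F₁ := halfFlux P G r (j + 1) k
  set F₀ := halfFlux P G r j k
  set S₁ := halfSource P G r (j + 1) k
  set S₀ := halfSource P G r j k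
  have e1 : |G.ratio * (F₁ - F₀)| ≤ D / 4 + (Sb + LF * (c₁ + c₂)) * G.dt := by
    rwa [abs_mul, abs_of_nonneg hlam]
  have e2 : |G.dt / 2 * (S₁ + S₀)| ≤ G.dt * Sb := by
    rw [abs_mul, abs_of_pos (by positivity)]
    have h3 := (abs_add_le S₁ S₀).trans (add_le_add (hsrc _) (hsrc _))
    calc _ ≤ G.dt / 2 * (Sb + Sb) := by gcongr
      _ = _ := by ring
  have e3 : |G.dx / 8 * (slope G r j k - slope G r (j + 1) k)| ≤ D / 4 := by
    have h1 : G.dx / 8 * (slope G r j k - slope G r (j + 1) k)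
        = (G.dx * slope G r j k - G.dx * slope G r (j + 1) k) / 8 := by ring
    rw [h1, abs_div, abs_of_pos (by norm_num : (0 : ℝ) < 8)]
    have := abs_sub (G.dx * slope G r j k) (G.dx * slope G r (j + 1) k)
    linarith
  have e4 : |(r j k + r (j + 1) k) / 2| ≤ b - D / 2 := by
    rw [abs_div, abs_two]
    linarith
  have e5 : growthRate N m ρM LF K Sb * G.dt = (Sb + LF * (c₁ + c₂)) * G.dt + G.dt * Sb := by
    rw [growthRate]
    ring
  rw [e5]
  rw [abs_le] at e1 e2 e3 e4 ⊢
  constructor <;> linarith [e1.1, e1.2, e2.1, e2.2, e3.1, e3.2, e4.1, e4.2]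

omit hP hK hSb hdx hdt hr in
-- The second half of the step only averages the linear reconstruction of the staggered values over
-- the original cells. It involves no flux, so it cannot increase the maximum norm: the slopes cost
-- at most half of what the mean gains.
theorem step_eq_average (j : ℤ) (k : Fin N) :
    step P G r j k = (staggered P G r (j - 1) k + staggered P G r j k) / 2
      - (G.dx * slope G (staggered P G r) j k - G.dx * slope G (staggered P G r) (j - 1) k) / 8 := by
  rw [step, staggered, staggered, sub_add_cancel]
  ring

include hP hK hSb hdx hdt hr in
theorem abs_step_le (hK0 : 0 ≤ K) (hSb0 : 0 ≤ Sb) (hdx1 : G.dx ≤ 1) (hdt1 : G.dt ≤ 1)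
    (hcfl : G.ratio * LF ≤ (Real.sqrt 2 - 1) / 2) {b : ℝ} (hb : ∀ j k, |r j k| ≤ b)
    (j : ℤ) (k : Fin N) :
    |step P G r j k| ≤ b + growthRate N m ρM LF K Sb * G.dt := by
  have hs := abs_staggered_le hP hK hSb hdx hdt hr hK0 hSb0 hdx1 hdt1 hcfl hb
  have h1 := abs_dx_mul_slope_le_left hdx (staggered P G r) j k
  have h2 := abs_dx_mul_slope_le_right hdx (staggered P G r) (j - 1) k
  rw [sub_add_cancel] at h2
  have hmax := half_abs_add_add_half_abs_sub_le (hs (j - 1) k) (hs j k)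
  rw [step_eq_average]
  set a := staggered P G r (j - 1) k
  set a' := staggered P G r j k
  have e1 : |(a + a') / 2| = |a + a'| / 2 := by rw [abs_div, abs_two]
  have e2 := abs_sub ((a + a') / 2)
    ((G.dx * slope G (staggered P G r) j k - G.dx * slope G (staggered P G r) (j - 1) k) / 8)
  have e3 : |(G.dx * slope G (staggered P G r) j k
      - G.dx * slope G (staggered P G r) (j - 1) k) / 8| ≤ |a' - a| / 2 := by
    rw [abs_div, abs_of_pos (by norm_num : (0 : ℝ) < 8)]
    have := abs_sub (G.dx * slope G (staggered P G r) j k)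
      (G.dx * slope G (staggered P G r) (j - 1) k)
    linarith [abs_nonneg (a' - a)]
  linarith

/-! ### Conservative form and change of the convolutions in one step -/

/-- The numerical flux of the conservative form of the scheme (with the sign of a gain). -/
def numFlux (P : BalanceSystem N m) (G : Grid) (r : ℤ → Fin N → ℝ) (j : ℤ) (k : Fin N) : ℝ :=
  (r (j + 1) k - r j k) / 4 - (G.dx * slope G r (j + 1) k + G.dx * slope G r j k) / 16
    - G.dx * slope G (staggered P G r) j k / 8
    - G.ratio / 2 * (halfFlux P G r (j + 1) k + halfFlux P G r j k)

/-- The averaged source. -/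
def numSource (P : BalanceSystem N m) (G : Grid) (r : ℤ → Fin N → ℝ) (j : ℤ) (k : Fin N) : ℝ :=
  (halfSource P G r (j + 1) k + 2 * halfSource P G r j k + halfSource P G r (j - 1) k) / 4

omit hP hK hSb hdx hdt hr in
-- Apart from the source, the change in time is a difference over one cell of quantities that are
-- merely bounded. After convolution this difference falls on the kernel and becomes small.
theorem step_sub_eq (j : ℤ) (k : Fin N) :
    step P G r j k - r j k = numFlux P G r j k - numFlux P G r (j - 1) k
      + G.dt * numSource P G r j k := by
  rw [step, numFlux, numFlux, numSource, sub_add_cancel]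
  ring

include hP hK hSb hdx hdt hr in
theorem abs_numFlux_le (hK0 : 0 ≤ K) (hSb0 : 0 ≤ Sb) (hdx1 : G.dx ≤ 1) (hdt1 : G.dt ≤ 1)
    (hcfl : G.ratio * LF ≤ (Real.sqrt 2 - 1) / 2) (j : ℤ) (k : Fin N) :
    |numFlux P G r j k| ≤ 5 * ρM + growthRate N m ρM LF K Sb := by
  have hρ := hP.rhoM_pos
  have hlam := G.ratio_nonneg hdx hdt
  have hg := growthRate_nonneg (N := N) (m := m) hK0 hSb0 hP.LF_nonneg hρ.le
  have hs := abs_staggered_le hP hK hSb hdx hdt hr hK0 hSb0 hdx1 hdt1 hcfl hr.rho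
  have hs' : ∀ j, |staggered P G r j k| ≤ ρM + growthRate N m ρM LF K Sb := fun j =>
    (hs j k).trans (by nlinarith)
  have hsq : Real.sqrt 2 * Real.sqrt 2 = 2 := Real.mul_self_sqrt (by norm_num)
  have hs0 : 0 ≤ Real.sqrt 2 := Real.sqrt_nonneg 2
  have hμ1 : G.ratio * LF ≤ 1 / 2 := by nlinarith
  have hd : ∀ j, |r (j + 1) k - r j k| ≤ 2 * ρM := fun j =>
    (abs_sub _ _).trans (by linarith [hr.rho (j + 1) k, hr.rho j k])
  have h1 := abs_dx_mul_slope_le_right hdx r j k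
  have h2 := abs_dx_mul_slope_succ_le hdx r j k
  have h3 := (abs_dx_mul_slope_le_right hdx (staggered P G r) j k).trans (abs_sub _ _)
  have hF : ∀ i, |G.ratio / 2 * halfFlux P G r i k| ≤ ρM / 2 := fun i => by
    have := hP.abs_flux_le (k := k) (mem_box_iff.1 (hr.halfRho i) k) (hr.halfR i)
    rw [abs_mul, abs_of_nonneg (by positivity)]
    calc _ ≤ G.ratio / 2 * (LF * (2 * ρM)) := by
          rw [halfFlux]
          gcongr
      _ = G.ratio * LF * ρM := by ring
      _ ≤ 1 / 2 * ρM := by gcongr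
      _ = _ := by ring
  have h4 := hF j
  have h5 := hF (j + 1)
  have h6 := hd j
  have h7 := hs' j
  have h8 := hs' (j + 1)
  have h9 : |G.dx * slope G (staggered P G r) j k|
      ≤ 2 * (ρM + growthRate N m ρM LF K Sb) := by linarith
  have h10 := h1.trans h6
  have h11 := h2.trans h6
  rw [numFlux, mul_add]
  rw [abs_le] at *
  constructor <;> linarith [h4.1, h4.2, h5.1, h5.2, h6.1, h6.2, h9.1, h9.2, h10.1, h10.2, h11.1,
    h11.2]

include hSb hr in
theorem abs_numSource_le (j : ℤ) (k : Fin N) : |numSource P G r j k| ≤ Sb := by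
  have hsrc : ∀ i, |halfSource P G r i k| ≤ Sb := fun i =>
    hSb k _ (hr.halfRho i) _ (hr.halfR i)
  have h1 := abs_le.1 (hsrc (j + 1))
  have h2 := abs_le.1 (hsrc j)
  have h3 := abs_le.1 (hsrc (j - 1))
  rw [numSource, abs_le]
  constructor <;> linarith [h1.1, h1.2, h2.1, h2.2, h3.1, h3.2]

include hP hK hSb hdx hdt hr in
/-- The convolution with a kernel changes by `O(Δx + Δt)` in one step. -/
theorem abs_integral_step_sub_le (hK0 : 0 ≤ K) (hSb0 : 0 ≤ Sb) (hdx1 : G.dx ≤ 1) (hdt1 : G.dt ≤ 1)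
    (hcfl : G.ratio * LF ≤ (Real.sqrt 2 - 1) / 2) {w : ℝ → ℝ} (hw : KernelBound w K) (k : Fin N)
    (x : ℝ) :
    |(∫ y, w (y - x) * step P G r (cellIdx G.dx y) k) - ∫ y, w (y - x) * r (cellIdx G.dx y) k|
      ≤ K * (5 * ρM + growthRate N m ρM LF K Sb) * G.dx + Sb * G.dt := by
  have hp := abs_numFlux_le hP hK hSb hdx hdt hr hK0 hSb0 hdx1 hdt1 hcfl
  have hq := abs_numSource_le hSb hr
  have hi : ∀ {f : ℤ → ℝ} {C : ℝ}, (∀ j, |f j| ≤ C) →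
      Integrable fun y => w (y - x) * f (cellIdx G.dx y) := fun {f C} hf =>
    (hw.integrable.comp_sub_right x).mul_bdd (c := C)
      (measurable_comp_cellIdx _ f).aestronglyMeasurable (Eventually.of_forall fun y => hf _)
  have hstep := abs_step_le hP hK hSb hdx hdt hr hK0 hSb0 hdx1 hdt1 hcfl hr.rho
  have hpi : Integrable fun y => w (y - x) * (numFlux P G r (cellIdx G.dx y) k
      - numFlux P G r (cellIdx G.dx y - 1) k) := by
    refine hi (f := fun j => numFlux P G r j k - numFlux P G r (j - 1) k)
      (C := 2 * (5 * ρM + growthRate N m ρM LF K Sb)) fun j => ?_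
    have := abs_sub (numFlux P G r j k) (numFlux P G r (j - 1) k)
    linarith [hp j k, hp (j - 1) k]
  rw [← integral_sub (hi (f := fun j => step P G r j k) fun j => hstep j k)
    (hi (f := fun j => r j k) fun j => hr.rho j k)]
  have heq : ∀ y, w (y - x) * step P G r (cellIdx G.dx y) k - w (y - x) * r (cellIdx G.dx y) k
      = w (y - x) * (numFlux P G r (cellIdx G.dx y) k - numFlux P G r (cellIdx G.dx y - 1) k)
        + G.dt * (w (y - x) * numSource P G r (cellIdx G.dx y) k) := fun y => by
    rw [← mul_sub, step_sub_eq]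
    ring
  simp only [heq]
  rw [integral_add hpi ((hi (f := fun j => numSource P G r j k) fun j => hq j k).const_mul _),
    integral_const_mul]
  have h1 := hw.abs_integral_increment_le hdx (f := fun j => numFlux P G r j k)
    (fun j => hp j k) x
  have h2 := hw.abs_integral_le (g := fun y => numSource P G r (cellIdx G.dx y) k)
    (fun y => hq _ k) x
  refine (abs_add_le _ _).trans (add_le_add (h1.trans (le_of_eq (by ring))) ?_)
  rw [abs_mul, abs_of_pos hdt, mul_comm]
  exact mul_le_mul_of_nonneg_right h2 hdt.le

end Stability

/-! ### Pointwise convergence from convergence of averages -/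

theorem setAverage_mem_Icc {s : Set ℝ} (hs0 : volume s ≠ 0) (hs : volume s ≠ ∞)
    (hsm : MeasurableSet s) {f : ℝ → ℝ} (hf : IntegrableOn f s) {c d : ℝ}
    (h : ∀ x ∈ s, |f x - c| ≤ d) : |(⨍ x in s, f x) - c| ≤ d := by
  have := (convex_Icc (c - d) (c + d)).set_average_mem isClosed_Icc hs0 hs
    ((ae_restrict_iff' hsm).2 (Eventually.of_forall fun x hx => by
      have := abs_le.1 (h x hx)
      exact ⟨by linarith, by linarith⟩)) hf
  rw [abs_le]
  constructor <;> linarith [this.1, this.2]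

/-- Asymptotically equi-Lipschitz functions whose averages converge, converge almost everywhere. -/
theorem ae_tendsto_of_tendsto_setAverage {T L : ℝ} (hL : 0 ≤ L) {φ : ℕ → ℝ → ℝ} {ψ : ℝ → ℝ}
    {ε : ℕ → ℝ} (hε : Tendsto ε atTop (𝓝 0)) (hψ : LocallyIntegrable ψ)
    (hφ : ∀ i, LocallyIntegrable (φ i))
    (hlip : ∀ i, ∀ s ∈ Ioo 0 T, ∀ t ∈ Ioo 0 T, |φ i s - φ i t| ≤ L * |s - t| + ε i)
    (hconv : ∀ t τ, 0 < τ → Metric.closedBall t τ ⊆ Ioo 0 T → Tendsto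
      (fun i => ⨍ s in Metric.closedBall t τ, φ i s) atTop (𝓝 (⨍ s in Metric.closedBall t τ, ψ s))) :
    ∀ᵐ t, t ∈ Ioo 0 T → Tendsto (fun i => φ i t) atTop (𝓝 (ψ t)) := by
  filter_upwards [IsUnifLocDoublingMeasure.ae_tendsto_average volume hψ 1] with t ht htT
  have h1 : Tendsto (fun τ => ⨍ s in Metric.closedBall t τ, ψ s) (𝓝[>] 0) (𝓝 (ψ t)) :=
    ht (fun _ => t) id tendsto_id (by
      filter_upwards [self_mem_nhdsWithin] with τ hτ
      simpa using le_of_lt (mem_Ioi.1 hτ))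
  rw [Metric.tendsto_atTop]
  intro η hη
  obtain ⟨τ₀, hτ₀, hball⟩ := Metric.nhds_basis_closedBall.mem_iff.1 (isOpen_Ioo.mem_nhds htT)
  have h2 : ∀ᶠ τ in 𝓝[>] (0 : ℝ), |(⨍ s in Metric.closedBall t τ, ψ s) - ψ t| < η / 4 := by
    have := h1.eventually (Metric.ball_mem_nhds (ψ t) (by positivity : 0 < η / 4))
    simpa [Real.dist_eq] using this
  have h3 : ∀ᶠ τ in 𝓝[>] (0 : ℝ), L * τ < η / 4 := by
    have : Tendsto (fun τ : ℝ => L * τ) (𝓝[>] 0) (𝓝 (L * 0)) :=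
      (continuous_const.mul continuous_id).continuousAt.tendsto.mono_left nhdsWithin_le_nhds
    exact this.eventually (gt_mem_nhds (by linarith))
  have h4 : ∀ᶠ τ in 𝓝[>] (0 : ℝ), τ < τ₀ := nhdsWithin_le_nhds (gt_mem_nhds hτ₀)
  -- At a Lebesgue point `t` of `ψ`, the radius `τ` is fixed first and `i` is sent to infinity
  -- afterwards. The four quarters of `η` are: average of `ψ` against `ψ t`, oscillation `L τ` of `φ
  -- i` on the ball, the defect `ε i`, and the distance of the two averages.
  obtain ⟨τ, ⟨⟨hτ1, hτ2⟩, hτ3⟩, hτ0⟩ :=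
    (((h2.and h3).and h4).and self_mem_nhdsWithin).exists
  have hτ0 : 0 < τ := hτ0
  have hsub : Metric.closedBall t τ ⊆ Ioo 0 T :=
    (Metric.closedBall_subset_closedBall hτ3.le).trans hball
  have h5 := (hconv t τ hτ0 hsub).eventually
    (Metric.ball_mem_nhds _ (by positivity : 0 < η / 4))
  have h6 : ∀ᶠ i in atTop, ε i < η / 4 := hε.eventually (gt_mem_nhds (by positivity))
  obtain ⟨i0, hi0⟩ := eventually_atTop.1 (h5.and h6)
  refine ⟨i0, fun i hi => ?_⟩
  obtain ⟨h7, h8⟩ := hi0 i hi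
  have hvol : volume (Metric.closedBall t τ) ≠ ∞ := measure_closedBall_lt_top.ne
  have hvol0 : volume (Metric.closedBall t τ) ≠ 0 := (Metric.measure_closedBall_pos _ _ hτ0).ne'
  have h9 : |(⨍ s in Metric.closedBall t τ, φ i s) - φ i t| ≤ L * τ + ε i := by
    refine setAverage_mem_Icc hvol0 hvol Metric.isClosed_closedBall.measurableSet
      ((hφ i).integrableOn_isCompact (isCompact_closedBall t τ)) fun s hs => ?_
    refine (hlip i s (hsub hs) t htT).trans ?_
    have : |s - t| ≤ τ := by simpa [Real.dist_eq] using hs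
    gcongr
  rw [Real.dist_eq] at h7 ⊢
  rw [abs_lt] at h7 hτ1 ⊢
  rw [abs_le] at h9
  constructor <;> linarith [h7.1, h7.2, h9.1, h9.2, hτ1.1, hτ1.2]

/-! ### Grid functions on space-time -/

/-- The function on `[0, T) × ℝ` with values `a n j` on the cells of the grid, extended by zero. -/
def gridFn (T : ℝ) (G : Grid) (a : ℕ → ℤ → ℝ) (p : ℝ × ℝ) : ℝ :=
  if 0 ≤ p.1 ∧ p.1 < T then a ⌊p.1 / G.dt⌋₊ (cellIdx G.dx p.2) else 0

theorem measurable_gridFn (T : ℝ) (G : Grid) (a : ℕ → ℤ → ℝ) : Measurable (gridFn T G a) := by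
  refine Measurable.ite ?_ ?_ measurable_const
  · exact (measurableSet_le measurable_const measurable_fst).inter
      (measurableSet_lt measurable_fst measurable_const)
  · exact (measurable_of_countable fun q : ℕ × ℤ => a q.1 q.2).comp
      ((Nat.measurable_floor.comp (measurable_fst.div_const _)).prodMk
        ((measurable_cellIdx _).comp measurable_snd))

theorem floor_mul_lt {T dt t : ℝ} (hdt : 0 < dt) (ht0 : 0 ≤ t) (ht : t < T) :
    (⌊t / dt⌋₊ : ℝ) * dt < T :=
  lt_of_le_of_lt ((le_div_iff₀ hdt).1 (Nat.floor_le (by positivity))) ht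

theorem gridFn_of_mem {T : ℝ} {G : Grid} {a : ℕ → ℤ → ℝ} {p : ℝ × ℝ} (hp : p ∈ strip T) :
    gridFn T G a p = a ⌊p.1 / G.dt⌋₊ (cellIdx G.dx p.2) :=
  if_pos ⟨hp.1.1.le, hp.1.2⟩

theorem abs_gridFn_le {T : ℝ} {G : Grid} (hdt : 0 < G.dt) {a : ℕ → ℤ → ℝ} {A : ℝ} (hA : 0 ≤ A)
    (ha : ∀ n : ℕ, n * G.dt < T → ∀ j, |a n j| ≤ A) (p : ℝ × ℝ) : |gridFn T G a p| ≤ A := by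
  unfold gridFn
  split_ifs with h
  · exact ha _ (floor_mul_lt hdt h.1 h.2) _
  · simpa using hA

theorem measurableSet_strip (T : ℝ) : MeasurableSet (strip T) :=
  measurableSet_Ioo.prod MeasurableSet.univ

/-- Convergence of integrals against functions in `L¹((0, T) × ℝ)`. -/
def WeakConv (T : ℝ) (f : ℕ → ℝ × ℝ → ℝ) (g : ℝ × ℝ → ℝ) : Prop :=
  ∀ h : ℝ × ℝ → ℝ, IntegrableOn h (strip T) →
    Tendsto (fun i => ∫ p in strip T, f i p * h p) atTop (𝓝 (∫ p in strip T, g p * h p))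

/-- Uniformly vanishing perturbations do not affect the weak limit. This lets the piecewise
constant, piecewise linear and predicted densities be exchanged for one another. -/
theorem WeakConv.congr_of_tendsto_zero {T B : ℝ} {f f' : ℕ → ℝ × ℝ → ℝ} {g : ℝ × ℝ → ℝ}
    (h : WeakConv T f g) (hf : ∀ i, Measurable (f i)) (hf' : ∀ i, Measurable (f' i))
    (hfB : ∀ i, ∀ p ∈ strip T, |f i p| ≤ B) {ε : ℕ → ℝ} (hε : Tendsto ε atTop (𝓝 0))
    (hd : ∀ i, ∀ p ∈ strip T, |f' i p - f i p| ≤ ε i) : WeakConv T f' g := by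
  intro q hq
  have h1 := h q hq
  have hfi : ∀ i, IntegrableOn (fun p => f i p * q p) (strip T) := fun i =>
    hq.bdd_mul (c := B) (hf i).aestronglyMeasurable
      ((ae_restrict_iff' (measurableSet_strip T)).2 (Eventually.of_forall (hfB i)))
  have hdi : ∀ i, ∀ᵐ p ∂(volume.restrict (strip T)), |f' i p - f i p| ≤ ε i := fun i =>
    (ae_restrict_iff' (measurableSet_strip T)).2 (Eventually.of_forall (hd i))
  have hdint : ∀ i, IntegrableOn (fun p => (f' i p - f i p) * q p) (strip T) := fun i =>
    hq.bdd_mul (c := ε i) ((hf' i).sub (hf i)).aestronglyMeasurable (hdi i)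
  have h2 : Tendsto (fun i => ∫ p in strip T, (f' i p - f i p) * q p) atTop (𝓝 0) := by
    refine squeeze_zero_norm (a := fun i => ε i * ∫ p in strip T, |q p|) (fun i => ?_) ?_
    · exact integral_abs_mul_le_of_bound ((hf' i).sub (hf i)).aestronglyMeasurable (hdi i) hq
    · simpa using hε.mul_const (∫ p in strip T, |q p|)
  have h3 := h1.add h2
  rw [add_zero] at h3
  refine h3.congr fun i => ?_
  rw [← integral_add (hfi i) (hdint i)]
  congr 1
  ext p
  ring

/-- Weak times strong: by dominated convergence `ψ i` tends to `χ` in `L¹`, so replacing `ψ i` by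
`χ` costs at most `B` times the `L¹` distance, and `χ` is an admissible test function for `f`. -/
theorem WeakConv.tendsto_mul {T B : ℝ} {f : ℕ → ℝ × ℝ → ℝ} {g : ℝ × ℝ → ℝ}
    (h : WeakConv T f g) (hf : ∀ i, Measurable (f i)) (hfB : ∀ i, ∀ p ∈ strip T, |f i p| ≤ B)
    {ψ : ℕ → ℝ × ℝ → ℝ} {χ Ψ : ℝ × ℝ → ℝ} (hψ : ∀ i, Measurable (ψ i))
    (hΨ : IntegrableOn Ψ (strip T))
    (hψΨ : ∀ i, ∀ p ∈ strip T, |ψ i p| ≤ Ψ p)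
    (hlim : ∀ᵐ p, p ∈ strip T → Tendsto (fun i => ψ i p) atTop (𝓝 (χ p))) :
    Tendsto (fun i => ∫ p in strip T, f i p * ψ i p) atTop (𝓝 (∫ p in strip T, g p * χ p)) := by
  set μ := (volume : Measure (ℝ × ℝ)).restrict (strip T) with hμ
  have hlim' : ∀ᵐ p ∂μ, Tendsto (fun i => ψ i p) atTop (𝓝 (χ p)) :=
    (ae_restrict_iff' (measurableSet_strip T)).2 hlim
  have hψΨ' : ∀ i, ∀ᵐ p ∂μ, |ψ i p| ≤ Ψ p := fun i =>
    (ae_restrict_iff' (measurableSet_strip T)).2 (Eventually.of_forall (hψΨ i))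
  have hfB' : ∀ i, ∀ᵐ p ∂μ, |f i p| ≤ B := fun i =>
    (ae_restrict_iff' (measurableSet_strip T)).2 (Eventually.of_forall (hfB i))
  have hχm : AEStronglyMeasurable χ μ :=
    aestronglyMeasurable_of_tendsto_ae atTop (fun i => (hψ i).aestronglyMeasurable) hlim'
  have hχΨ : ∀ᵐ p ∂μ, |χ p| ≤ Ψ p := by
    filter_upwards [hlim', ae_all_iff.2 hψΨ'] with p h1 h2
    exact le_of_tendsto' h1.abs h2
  have hχ : Integrable χ μ := Integrable.mono' hΨ hχm hχΨ
  have hψi : ∀ i, Integrable (ψ i) μ := fun i =>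
    Integrable.mono' hΨ (hψ i).aestronglyMeasurable (hψΨ' i)
  have h1 := h χ hχ
  have h2 : Tendsto (fun i => ∫ p, f i p * (ψ i p - χ p) ∂μ) atTop (𝓝 0) := by
    have h3 : Tendsto (fun i => ∫ p, |ψ i p - χ p| ∂μ) atTop (𝓝 (∫ _, (0 : ℝ) ∂μ)) := by
      refine tendsto_integral_of_dominated_convergence (fun p => 2 * Ψ p)
        (fun i => ((hψ i).aestronglyMeasurable.sub hχm).norm) (hΨ.const_mul 2) (fun i => ?_) ?_
      · filter_upwards [hψΨ' i, hχΨ] with p h1 h2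
        rw [Real.norm_eq_abs, abs_abs]
        linarith [abs_sub (ψ i p) (χ p)]
      · filter_upwards [hlim'] with p hp
        simpa using (hp.sub_const (χ p)).abs
    rw [integral_zero] at h3
    refine squeeze_zero_norm (a := fun i => B * ∫ p, |ψ i p - χ p| ∂μ) (fun i => ?_) ?_
    · exact integral_abs_mul_le_of_bound (hf i).aestronglyMeasurable (hfB' i) ((hψi i).sub hχ)
    · simpa using h3.const_mul B
  have h4 := h1.add h2
  rw [add_zero] at h4
  refine h4.congr fun i => ?_
  have h5 : Integrable (fun p => f i p * (ψ i p - χ p)) μ :=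
    ((hψi i).sub hχ).bdd_mul (hf i).aestronglyMeasurable (hfB' i)
  rw [← integral_add (hχ.bdd_mul (hf i).aestronglyMeasurable (hfB' i)) h5]
  congr 1
  ext p
  ring

/-! ### Convergence of the nonlocal quantities -/

/-- By Fubini, testing weakly with an indicator in time times the kernel centred at a fixed `x`
produces the time integral of the convolution at `x`. -/
theorem integral_strip_indicator_kernel {T : ℝ} {w : ℝ → ℝ} (hw : Integrable w)
    {U : ℝ × ℝ → ℝ} (hU : Measurable U) {B : ℝ} (hUB : ∀ p, |U p| ≤ B) (x : ℝ) {s : Set ℝ}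
    (hsm : MeasurableSet s) (hs : volume s ≠ ∞) (hsT : s ⊆ Ioo 0 T) :
    ∫ p in strip T, U p * (s.indicator (fun _ => (1 : ℝ)) p.1 * w (p.2 - x))
      = ∫ t in s, ∫ y, w (y - x) * U (t, y) := by
  have hH : Integrable (fun p : ℝ × ℝ => s.indicator (fun _ => (1 : ℝ)) p.1 * w (p.2 - x)) :=
    Integrable.mul_prod (μ := volume) (ν := volume) (f := s.indicator fun _ => (1 : ℝ))
      (g := fun y => w (y - x))
      ((integrable_indicator_iff hsm).2 (integrableOn_const hs)) (hw.comp_sub_right x)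
  have hUH : Integrable (fun p : ℝ × ℝ =>
      U p * (s.indicator (fun _ => (1 : ℝ)) p.1 * w (p.2 - x))) :=
    hH.bdd_mul hU.aestronglyMeasurable (Eventually.of_forall hUB)
  rw [setIntegral_eq_integral_of_forall_compl_eq_zero, Measure.volume_eq_prod, integral_prod]
  · rw [← integral_indicator hsm]
    congr 1
    ext t
    by_cases ht : t ∈ s
    · simp only [ht, indicator_of_mem, one_mul]
      congr 1
      ext y
      ring
    · simp [ht]
  · exact hUH
  · intro p hp
    have : p.1 ∉ s := fun h => hp ⟨hsT h, mem_univ _⟩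
    simp [this]

theorem measurable_integral_kernel {w : ℝ → ℝ} (hwm : Measurable w)
    {U : ℝ × ℝ → ℝ} (hU : Measurable U) :
    Measurable fun p : ℝ × ℝ => ∫ y, w (y - p.2) * U (p.1, y) := by
  refine (StronglyMeasurable.integral_prod_right (f := fun (p : ℝ × ℝ) (y : ℝ) =>
    w (y - p.2) * U (p.1, y)) (ν := volume) ?_).measurable
  refine Measurable.stronglyMeasurable ?_
  exact (hwm.comp (by fun_prop)).mul (hU.comp (by fun_prop))

theorem locallyIntegrable_of_bound {f : ℝ → ℝ} (hf : Measurable f) {B : ℝ} (hB : ∀ x, |f x| ≤ B) :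
    LocallyIntegrable f :=
  (locallyIntegrable_const B).mono hf.aestronglyMeasurable (Eventually.of_forall fun x =>
    (hB x).trans (le_abs_self B))

/-- For fixed `x`, weak convergence yields convergence of the time averages of the convolutions, and
the asymptotic Lipschitz bound in time upgrades it to convergence for almost every `t`. Fubini then
gives almost every `(t, x)`. -/
theorem ae_tendsto_integral_kernel {T B L K : ℝ} (hL : 0 ≤ L) {w : ℝ → ℝ} (hw : KernelBound w K)
    {U : ℕ → ℝ × ℝ → ℝ} {u : ℝ × ℝ → ℝ} (hU : ∀ i, Measurable (U i)) (hu : Measurable u)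
    (hUB : ∀ i p, |U i p| ≤ B) (huB : ∀ p, |u p| ≤ B) (hweak : WeakConv T U u)
    {ε : ℕ → ℝ} (hε : Tendsto ε atTop (𝓝 0))
    (hlip : ∀ i x, ∀ s ∈ Ioo 0 T, ∀ t ∈ Ioo 0 T,
      |(∫ y, w (y - x) * U i (s, y)) - ∫ y, w (y - x) * U i (t, y)| ≤ L * |s - t| + ε i) :
    ∀ᵐ p : ℝ × ℝ, p ∈ strip T → Tendsto (fun i => ∫ y, w (y - p.2) * U i (p.1, y)) atTop
      (𝓝 (∫ y, w (y - p.2) * u (p.1, y))) := by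
  have hm : ∀ i, Measurable fun p : ℝ × ℝ => ∫ y, w (y - p.2) * U i (p.1, y) := fun i =>
    measurable_integral_kernel hw.measurable (hU i)
  have hm' : Measurable fun p : ℝ × ℝ => ∫ y, w (y - p.2) * u (p.1, y) :=
    measurable_integral_kernel hw.measurable hu
  have hone : ∀ x, ∀ᵐ t, t ∈ Ioo 0 T → Tendsto (fun i => ∫ y, w (y - x) * U i (t, y)) atTop
      (𝓝 (∫ y, w (y - x) * u (t, y))) := by
    intro x
    refine ae_tendsto_of_tendsto_setAverage hL hε
      (locallyIntegrable_of_bound (hm'.comp (measurable_id.prodMk measurable_const))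
        fun t => hw.abs_integral_le (fun y => huB (t, y)) x)
      (fun i => locallyIntegrable_of_bound ((hm i).comp (measurable_id.prodMk measurable_const))
        fun t => hw.abs_integral_le (fun y => hUB i (t, y)) x)
      (fun i => hlip i x) fun t τ hτ hsub => ?_
    have hsm : MeasurableSet (Metric.closedBall t τ) := Metric.isClosed_closedBall.measurableSet
    have hs : volume (Metric.closedBall t τ) ≠ ∞ := measure_closedBall_lt_top.ne
    have h1 := hweak (fun p => (Metric.closedBall t τ).indicator (fun _ => (1 : ℝ)) p.1 * w (p.2 - x))
      (Integrable.integrableOn (Integrable.mul_prod (μ := volume) (ν := volume)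
        (f := (Metric.closedBall t τ).indicator fun _ => (1 : ℝ)) (g := fun y => w (y - x))
        ((integrable_indicator_iff hsm).2 (integrableOn_const hs)) (hw.integrable.comp_sub_right x)))
    rw [integral_strip_indicator_kernel hw.integrable hu huB x hsm hs hsub] at h1
    simp only [fun i => integral_strip_indicator_kernel hw.integrable (hU i) (hUB i) x
      hsm hs hsub] at h1
    simp only [setAverage_eq]
    exact h1.const_smul _
  -- The exceptional set of times depends on `x`; measurability of the set of convergence is what
  -- allows these null sets to be combined.
  have hset : MeasurableSet {p : ℝ × ℝ | p ∈ strip T → Tendsto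
      (fun i => ∫ y, w (y - p.2) * U i (p.1, y)) atTop (𝓝 (∫ y, w (y - p.2) * u (p.1, y)))} := by
    have h1 : MeasurableSet {p : ℝ × ℝ | Tendsto (fun i => (∫ y, w (y - p.2) * U i (p.1, y))
        - ∫ y, w (y - p.2) * u (p.1, y)) atTop (𝓝 0)} :=
      measurableSet_tendsto _ fun i => (hm i).sub hm'
    have h2 : {p : ℝ × ℝ | p ∈ strip T → Tendsto
      (fun i => ∫ y, w (y - p.2) * U i (p.1, y)) atTop (𝓝 (∫ y, w (y - p.2) * u (p.1, y)))}
      = (strip T)ᶜ ∪ {p : ℝ × ℝ | Tendsto (fun i => (∫ y, w (y - p.2) * U i (p.1, y))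
        - ∫ y, w (y - p.2) * u (p.1, y)) atTop (𝓝 0)} := by
      ext p
      simp only [mem_ofPred_eq, mem_union, mem_compl_iff, imp_iff_not_or,
        tendsto_sub_nhds_zero_iff]
    rw [h2]
    exact (measurableSet_strip T).compl.union h1
  -- The coordinates are exchanged because the null slices are those with `x` fixed.
  have hswap := (Measure.ae_prod_iff_ae_ae (μ := (volume : Measure ℝ)) (ν := (volume : Measure ℝ))
    (p := fun q : ℝ × ℝ => q.swap ∈ strip T → Tendsto
      (fun i => ∫ y, w (y - q.swap.2) * U i (q.swap.1, y)) atTop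
      (𝓝 (∫ y, w (y - q.swap.2) * u (q.swap.1, y)))) (measurable_swap hset)).2
    (Eventually.of_forall fun x => by
      filter_upwards [hone x] with t ht hmem
      exact ht hmem.1)
  exact (Measure.measurePreserving_swap (μ := (volume : Measure ℝ))
    (ν := (volume : Measure ℝ))).quasiMeasurePreserving.ae (p := fun q : ℝ × ℝ => q.swap ∈ strip T → Tendsto
      (fun i => ∫ y, w (y - q.swap.2) * U i (q.swap.1, y)) atTop
      (𝓝 (∫ y, w (y - q.swap.2) * u (q.swap.1, y)))) hswap

/-! ### Families of approximations -/

/-- Bounds for the scheme on the grid `G` up to time `T`: range, variation in time of the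
convolutions with the kernels, and size of the predictor step. -/
structure RunBound (P : BalanceSystem N m) (G : Grid) (T ρM L e : ℝ) : Prop where
  dx_pos : 0 < G.dx
  dt_pos : 0 < G.dt
  inRange : ∀ n : ℕ, n * G.dt < T → InRange P G ρM (values P G n)
  conv_step : ∀ n : ℕ, n * G.dt < T → ∀ l k x,
    |(∫ y, P.kernel l k (y - x) * values P G (n + 1) (cellIdx G.dx y) k)
      - ∫ y, P.kernel l k (y - x) * values P G n (cellIdx G.dx y) k| ≤ L * G.dt
  rate : ∀ n : ℕ, n * G.dt < T → ∀ j k, |G.dt * discRate P G (values P G n) j k| ≤ e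

/-- The piecewise constant function with values `ρ_j^{k,n}`. -/
def cellRho (P : BalanceSystem N m) (G : Grid) (T : ℝ) (k : Fin N) : ℝ × ℝ → ℝ :=
  gridFn T G fun n j => values P G n j k

section Run

variable {P : BalanceSystem N m} {G : Grid} {T ρM L e : ℝ} (h : RunBound P G T ρM L e)
include h

theorem RunBound.abs_cellRho_le (hρ : 0 ≤ ρM) (k : Fin N) (p : ℝ × ℝ) :
    |cellRho P G T k p| ≤ ρM :=
  abs_gridFn_le h.dt_pos hρ (fun n hn j => (h.inRange n hn).rho j k) p

theorem RunBound.abs_conv_sub_le (l : Fin m) (k : Fin N) (x : ℝ) {n n' : ℕ} (hnn : n ≤ n')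
    (hn' : n' * G.dt < T) :
    |(∫ y, P.kernel l k (y - x) * values P G n' (cellIdx G.dx y) k)
      - ∫ y, P.kernel l k (y - x) * values P G n (cellIdx G.dx y) k| ≤ L * ((n' - n) * G.dt) := by
  have hdt := h.dt_pos
  induction n', hnn using Nat.le_induction with
  | base => simp
  | succ n' hnn ih =>
    have hlt : (n' : ℝ) * G.dt < T := by
      refine lt_trans ?_ hn'
      push_cast
      nlinarith
    have h1 := ih hlt
    have h2 := h.conv_step n' hlt l k x
    have h3 := (abs_sub_le _ _ _).trans (add_le_add h2 h1)
    refine h3.trans (le_of_eq ?_)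
    push_cast
    ring

/-- The bound per time step adds up; rounding the two times down to the time grid costs at most one
additional step, whence `L * Δt`. -/
theorem RunBound.abs_integral_cellRho_sub_le (hL : 0 ≤ L) (l : Fin m) (k : Fin N) (x : ℝ) {s t : ℝ}
    (hs : s ∈ Ioo 0 T) (ht : t ∈ Ioo 0 T) :
    |(∫ y, P.kernel l k (y - x) * cellRho P G T k (s, y))
      - ∫ y, P.kernel l k (y - x) * cellRho P G T k (t, y)| ≤ L * |s - t| + L * G.dt := by
  wlog hst : t ≤ s generalizing s t
  · rw [abs_sub_comm, abs_sub_comm s]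
    exact this ht hs (le_of_not_ge hst)
  have hdt := h.dt_pos
  have heq : ∀ {s : ℝ}, s ∈ Ioo 0 T → ∀ y, cellRho P G T k (s, y)
      = values P G ⌊s / G.dt⌋₊ (cellIdx G.dx y) k := fun hs y =>
    gridFn_of_mem (p := (_, y)) ⟨hs, mem_univ _⟩
  simp only [heq hs, heq ht]
  have h1 := h.abs_conv_sub_le l k x (n := ⌊t / G.dt⌋₊) (n' := ⌊s / G.dt⌋₊)
    (Nat.floor_le_floor (by gcongr)) (floor_mul_lt hdt hs.1.le hs.2)
  refine h1.trans ?_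
  rw [← mul_add, abs_of_nonneg (sub_nonneg.2 hst)]
  refine mul_le_mul_of_nonneg_left ?_ hL
  have h2 : (⌊s / G.dt⌋₊ : ℝ) * G.dt ≤ s :=
    (le_div_iff₀ hdt).1 (Nat.floor_le (div_nonneg hs.1.le hdt.le))
  have h3 : t < ((⌊t / G.dt⌋₊ : ℝ) + 1) * G.dt :=
    (div_lt_iff₀ hdt).1 (Nat.lt_floor_add_one _)
  linarith

theorem RunBound.abs_halfR_sub_le {K : ℝ} (hK : ∀ l k, KernelBound (P.kernel l k) K)
    {p : ℝ × ℝ} (hp : p ∈ strip T) (l : Fin m) :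
    |halfR P G (values P G ⌊p.1 / G.dt⌋₊) (cellIdx G.dx p.2) l
      - ∑ k, ∫ y, P.kernel l k (y - p.2) * cellRho P G T k (p.1, y)|
      ≤ N * (e + K * G.dx * e) + N * (K * G.dx * (3 * ρM)) := by
  have hn := floor_mul_lt h.dt_pos hp.1.1.le hp.1.2
  have h1 := abs_halfR_sub_discR_le hK h.dx_pos h.dt_pos (h.rate _ hn) (cellIdx G.dx p.2) l
  have h2 := abs_discR_sub_integral_le hK h.dx_pos (h.inRange _ hn).rho p.2 l
  have heq : ∀ k y, cellRho P G T k (p.1, y)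
      = values P G ⌊p.1 / G.dt⌋₊ (cellIdx G.dx y) k := fun k y =>
    gridFn_of_mem (p := (_, y)) ⟨hp.1, mem_univ _⟩
  simp only [heq]
  exact (abs_sub_le _ _ _).trans (add_le_add h1 h2)

end Run

theorem weakConv_one (T : ℝ) : WeakConv T (fun _ _ => 1) fun _ => 1 :=
  fun _ _ => tendsto_const_nhds

/-- Approximations on finer and finer grids that converge weakly-∗. -/
structure ConvergentFamily (P : BalanceSystem N m) (T ρM L : ℝ) (G : ℕ → Grid) (e : ℕ → ℝ)
    (u : ℝ → ℝ → Fin N → ℝ) : Prop where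
  run : ∀ i, RunBound P (G i) T ρM L (e i)
  rhoM_nonneg : 0 ≤ ρM
  L_nonneg : 0 ≤ L
  dx_tendsto : Tendsto (fun i => (G i).dx) atTop (𝓝 0)
  dt_tendsto : Tendsto (fun i => (G i).dt) atTop (𝓝 0)
  e_tendsto : Tendsto e atTop (𝓝 0)
  measurable : ∀ k, Measurable fun p : ℝ × ℝ => u p.1 p.2 k
  bound : ∀ t x k, |u t x k| ≤ ρM
  weak : ∀ k, WeakConv T (fun i => cellRho P (G i) T k) fun p => u p.1 p.2 k

section Family

variable {P : BalanceSystem N m} {T ρM L : ℝ} {G : ℕ → Grid} {e : ℕ → ℝ} {u : ℝ → ℝ → Fin N → ℝ}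

theorem nonlocal_mem_box {K : ℝ} (hK : ∀ l k, KernelBound (P.kernel l k) K)
    (hu : ∀ t x k, |u t x k| ≤ ρM) (t x : ℝ) :
    nonlocal P.kernel u t x ∈ box (N * ρM) :=
  mem_box_iff.2 fun l => abs_sum_le_mul fun k => (hK l k).abs_integral_le (fun y => hu t y k) x

theorem measurable_nonlocal {K : ℝ} (hK : ∀ l k, KernelBound (P.kernel l k) K)
    (hu : ∀ k, Measurable fun p : ℝ × ℝ => u p.1 p.2 k) :
    Measurable fun p : ℝ × ℝ => nonlocal P.kernel u p.1 p.2 := by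
  refine measurable_pi_lambda _ fun l => Finset.measurable_sum _ fun k _ => ?_
  exact measurable_integral_kernel (hK l k).measurable (hu k)

variable (h : ConvergentFamily P T ρM L G e u) {K : ℝ}
  (hK : ∀ l k, KernelBound (P.kernel l k) K)
include h hK

/-- This is the strong convergence in the argument. `R^{n+1/2}` differs from the exact convolution
of the piecewise constant densities only by the predictor step and the quadrature error, both
uniformly small. -/
theorem ConvergentFamily.ae_tendsto_halfR :
    ∀ᵐ p : ℝ × ℝ, p ∈ strip T → Tendsto (fun i => halfR P (G i) (values P (G i) ⌊p.1 / (G i).dt⌋₊)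
      (cellIdx (G i).dx p.2)) atTop (𝓝 (nonlocal P.kernel u p.1 p.2)) := by
  have h1 : ∀ᵐ p : ℝ × ℝ, ∀ l k, p ∈ strip T →
      Tendsto (fun i => ∫ y, P.kernel l k (y - p.2) * cellRho P (G i) T k (p.1, y)) atTop
        (𝓝 (∫ y, P.kernel l k (y - p.2) * u p.1 y k)) := by
    rw [ae_all_iff]
    intro l
    rw [ae_all_iff]
    intro k
    refine ae_tendsto_integral_kernel h.L_nonneg (hK l k) (fun i => measurable_gridFn _ _ _)
      (h.measurable k) (fun i p => (h.run i).abs_cellRho_le h.rhoM_nonneg k p)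
      (fun p => h.bound _ _ _) (h.weak k) (ε := fun i => L * (G i).dt) ?_
      fun i x s hs t ht => (h.run i).abs_integral_cellRho_sub_le h.L_nonneg l k x hs ht
    simpa using h.dt_tendsto.const_mul L
  filter_upwards [h1] with p hp hmem
  rw [tendsto_pi_nhds]
  intro l
  have h2 : Tendsto (fun i => ∑ k, ∫ y, P.kernel l k (y - p.2) * cellRho P (G i) T k (p.1, y)) atTop
      (𝓝 (nonlocal P.kernel u p.1 p.2 l)) :=
    tendsto_finsetSum _ fun k _ => hp l k hmem
  have h3 : Tendsto (fun i => N * (e i + K * (G i).dx * e i) + N * (K * (G i).dx * (3 * ρM))) atTop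
      (𝓝 0) := by
    have h4 := (((h.e_tendsto.add ((h.dx_tendsto.const_mul K).mul h.e_tendsto)).const_mul
      (N : ℝ)).add (((h.dx_tendsto.const_mul K).mul_const (3 * ρM)).const_mul (N : ℝ)))
    simpa using h4
  have h5 := squeeze_zero_norm (f := fun i => halfR P (G i) (values P (G i) ⌊p.1 / (G i).dt⌋₊)
      (cellIdx (G i).dx p.2) l - ∑ k, ∫ y, P.kernel l k (y - p.2) * cellRho P (G i) T k (p.1, y))
    (fun i =>
    (h.run i).abs_halfR_sub_le hK hmem l) h3
  have h6 := h5.add h2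
  rw [zero_add] at h6
  exact h6.congr fun i => by ring

omit hK in
theorem ConvergentFamily.weakConv_halfRho (k : Fin N) :
    WeakConv T (fun i => gridFn T (G i) fun n j => halfRho P (G i) (values P (G i) n) j k)
      fun p => u p.1 p.2 k := by
  refine (h.weak k).congr_of_tendsto_zero (B := ρM) (ε := e) (fun i => measurable_gridFn _ _ _)
    (fun i => measurable_gridFn _ _ _)
    (fun i p _ => (h.run i).abs_cellRho_le h.rhoM_nonneg k p) h.e_tendsto fun i p hp => ?_
  rw [gridFn_of_mem hp, cellRho, gridFn_of_mem hp, halfRho, add_sub_cancel_left]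
  have h1 := (h.run i).rate _ (floor_mul_lt (h.run i).dt_pos hp.1.1.le hp.1.2)
    (cellIdx (G i).dx p.2) k
  rw [mul_comm_div, mul_comm, div_mul_eq_mul_div, mul_comm, abs_div, abs_two]
  linarith [abs_nonneg ((G i).dt * discRate P (G i) (values P (G i) ⌊p.1 / (G i).dt⌋₊)
    (cellIdx (G i).dx p.2) k), mul_comm ((G i).dt)
    (discRate P (G i) (values P (G i) ⌊p.1 / (G i).dt⌋₊) (cellIdx (G i).dx p.2) k)]

/-- Passage to the limit in a nonlinearity that is affine in the densities and continuous in the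
nonlocal quantities. -/
theorem ConvergentFamily.tendsto_integral_affine {c : Fin N → (Fin m → ℝ) → ℝ}
    {c₀ : (Fin m → ℝ) → ℝ} (hc : ∀ k, Continuous (c k)) (hc₀ : Continuous c₀) {C : ℝ}
    (hcC : ∀ k R, |c k R| ≤ C) (hc₀C : ∀ R, |c₀ R| ≤ C) {a : ℕ → ℕ → ℤ → ℝ}
    (ha : ∀ i (n : ℕ), n * (G i).dt < T → ∀ j, a i n j =
      ∑ k, halfRho P (G i) (values P (G i) n) j k * c k (halfR P (G i) (values P (G i) n) j)
        + c₀ (halfR P (G i) (values P (G i) n) j))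
    {ψ : ℕ → ℝ × ℝ → ℝ} {χ Ψ : ℝ × ℝ → ℝ} (hψ : ∀ i, Measurable (ψ i))
    (hΨ : IntegrableOn Ψ (strip T)) (hψΨ : ∀ i, ∀ p ∈ strip T, |ψ i p| ≤ Ψ p)
    (hlim : ∀ᵐ p, p ∈ strip T → Tendsto (fun i => ψ i p) atTop (𝓝 (χ p))) :
    Tendsto (fun i => ∫ p in strip T, gridFn T (G i) (a i) p * ψ i p) atTop
      (𝓝 (∫ p in strip T, (∑ k, u p.1 p.2 k * c k (nonlocal P.kernel u p.1 p.2)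
        + c₀ (nonlocal P.kernel u p.1 p.2)) * χ p)) := by
  have hC : 0 ≤ C := (abs_nonneg _).trans (hc₀C 0)
  have hR := h.ae_tendsto_halfR hK
  have hterm : ∀ {d : (Fin m → ℝ) → ℝ}, Continuous d → (∀ R, |d R| ≤ C) →
      ∀ {f : ℕ → ℝ × ℝ → ℝ} {g : ℝ × ℝ → ℝ} {B : ℝ}, WeakConv T f g → (∀ i, Measurable (f i)) →
      (∀ i, ∀ p ∈ strip T, |f i p| ≤ B) →
      Tendsto (fun i => ∫ p in strip T, f i p *
        (gridFn T (G i) (fun n j => d (halfR P (G i) (values P (G i) n) j)) p * ψ i p)) atTop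
        (𝓝 (∫ p in strip T, g p * (d (nonlocal P.kernel u p.1 p.2) * χ p))) := by
    intro d hd hdC f g B hfg hf hfB
    refine hfg.tendsto_mul hf hfB (Ψ := fun p => C * Ψ p)
      (fun i => (measurable_gridFn _ _ _).mul (hψ i)) (hΨ.const_mul C) (fun i p hp => ?_) ?_
    · rw [abs_mul]
      exact mul_le_mul (abs_gridFn_le (h.run i).dt_pos hC (fun n _ j => hdC _) p) (hψΨ i p hp)
        (abs_nonneg _) hC
    · filter_upwards [hR, hlim] with p h1 h2 hp
      refine Tendsto.mul ?_ (h2 hp)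
      simp only [gridFn_of_mem hp]
      exact (hd.tendsto _).comp (h1 hp)
  have hint : ∀ {d : (Fin m → ℝ) → ℝ}, (∀ R, |d R| ≤ C) → ∀ {f : ℝ × ℝ → ℝ} {B : ℝ},
      Measurable f → (∀ p ∈ strip T, |f p| ≤ B) → ∀ i, IntegrableOn (fun p => f p *
        (gridFn T (G i) (fun n j => d (halfR P (G i) (values P (G i) n) j)) p * ψ i p))
        (strip T) := by
    intro d hdC f B hf hfB i
    have h1 : IntegrableOn (ψ i) (strip T) := Integrable.mono' hΨ (hψ i).aestronglyMeasurable
      ((ae_restrict_iff' (measurableSet_strip T)).2 (Eventually.of_forall (hψΨ i)))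
    refine Integrable.bdd_mul (c := B) (h1.bdd_mul (c := C)
      (measurable_gridFn _ _ _).aestronglyMeasurable (Eventually.of_forall fun p => ?_))
      hf.aestronglyMeasurable
      ((ae_restrict_iff' (measurableSet_strip T)).2 (Eventually.of_forall hfB))
    exact abs_gridFn_le (h.run i).dt_pos hC (fun n _ j => hdC _) p
  have hHB : ∀ k i, ∀ p ∈ strip T,
      |gridFn T (G i) (fun n j => halfRho P (G i) (values P (G i) n) j k) p| ≤ ρM := fun k i p _ =>
    abs_gridFn_le (h.run i).dt_pos h.rhoM_nonneg
      (fun n hn j => mem_box_iff.1 (((h.run i).inRange n hn).halfRho j) k) p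
  -- Each summand is a weakly convergent density times a strongly convergent factor. In the term
  -- with `c₀` the constant function 1 takes the place of the density.
  have hsum := (tendsto_finsetSum Finset.univ fun k _ => hterm (hc k) (hcC k)
    (h.weakConv_halfRho k) (fun i => measurable_gridFn _ _ _) (hHB k)).add
    (hterm hc₀ hc₀C (weakConv_one T) (fun _ => measurable_const) (B := 1) (fun _ _ _ => by simp))
  have hRm := measurable_nonlocal hK h.measurable
  have hχm : AEStronglyMeasurable χ (volume.restrict (strip T)) :=
    aestronglyMeasurable_of_tendsto_ae atTop (fun i => (hψ i).aestronglyMeasurable)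
      ((ae_restrict_iff' (measurableSet_strip T)).2 hlim)
  have hχ : IntegrableOn χ (strip T) := by
    refine Integrable.mono' hΨ hχm ?_
    have h2 : ∀ᵐ p ∂(volume.restrict (strip T)), ∀ i, |ψ i p| ≤ Ψ p := ae_all_iff.2 fun i =>
      (ae_restrict_iff' (measurableSet_strip T)).2 (Eventually.of_forall (hψΨ i))
    filter_upwards [(ae_restrict_iff' (measurableSet_strip T)).2 hlim, h2] with p h1 h2
    exact le_of_tendsto' h1.abs h2
  have hlimint : ∀ {d : (Fin m → ℝ) → ℝ}, Continuous d → (∀ R, |d R| ≤ C) →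
      ∀ {f : ℝ × ℝ → ℝ} {B : ℝ}, Measurable f → (∀ p, |f p| ≤ B) →
      IntegrableOn (fun p => f p * (d (nonlocal P.kernel u p.1 p.2) * χ p))
        (strip T) := fun hd hdC _ _ hf hfB =>
    (hχ.bdd_mul (c := C) (hd.measurable.comp hRm).aestronglyMeasurable
      (Eventually.of_forall fun p => hdC _)).bdd_mul hf.aestronglyMeasurable
      (Eventually.of_forall hfB)
  have e2 : ∫ p in strip T, (∑ k, u p.1 p.2 k * c k (nonlocal P.kernel u p.1 p.2)
        + c₀ (nonlocal P.kernel u p.1 p.2)) * χ p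
      = (∑ k, ∫ p in strip T, u p.1 p.2 k * (c k (nonlocal P.kernel u p.1 p.2) * χ p))
        + ∫ p in strip T, 1 * (c₀ (nonlocal P.kernel u p.1 p.2) * χ p) := by
    have i1 : ∀ k ∈ (Finset.univ : Finset (Fin N)), IntegrableOn (fun p : ℝ × ℝ =>
        u p.1 p.2 k * (c k (nonlocal P.kernel u p.1 p.2) * χ p)) (strip T) :=
      fun k _ => hlimint (hc k) (hcC k) (h.measurable k) fun p => h.bound _ _ _
    have i2 : IntegrableOn (fun p : ℝ × ℝ =>
        1 * (c₀ (nonlocal P.kernel u p.1 p.2) * χ p)) (strip T) :=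
      hlimint hc₀ hc₀C (f := fun _ => 1) (B := 1) measurable_const fun p => by simp
    rw [← integral_finsetSum _ i1, ← integral_add (integrable_finsetSum _ i1) i2]
    congr 1
    ext p
    rw [add_mul, Finset.sum_mul, one_mul]
    congr 1
    exact Finset.sum_congr rfl fun k _ => by ring
  rw [e2]
  refine hsum.congr fun i => ?_
  have i1 : ∀ k ∈ (Finset.univ : Finset (Fin N)), IntegrableOn (fun p : ℝ × ℝ =>
      gridFn T (G i) (fun n j => halfRho P (G i) (values P (G i) n) j k) p *
      (gridFn T (G i) (fun n j => c k (halfR P (G i) (values P (G i) n) j)) p * ψ i p)) (strip T) :=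
    fun k _ => hint (hcC k) (measurable_gridFn _ _ _) (hHB k i) i
  have i2 : IntegrableOn (fun p : ℝ × ℝ => (1 : ℝ) *
      (gridFn T (G i) (fun n j => c₀ (halfR P (G i) (values P (G i) n) j)) p * ψ i p)) (strip T) :=
    hint hc₀C (f := fun _ => 1) (B := 1) measurable_const (fun p _ => by simp) i
  rw [← integral_finsetSum _ i1, ← integral_add (integrable_finsetSum _ i1) i2]
  refine setIntegral_congr_fun (measurableSet_strip T) fun p hp => ?_
  simp only [gridFn_of_mem hp]
  rw [ha i _ (floor_mul_lt (h.run i).dt_pos hp.1.1.le hp.1.2), add_mul, Finset.sum_mul, one_mul]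
  congr 1
  exact Finset.sum_congr rfl fun k _ => by ring

end Family

/-! ### Flux and source as affine functions of the densities -/

/-- The projection onto the box `[-b, b]^ι`. -/
def clamp {ι : Type} (b : ℝ) (v : ι → ℝ) (i : ι) : ℝ := max (-b) (min b (v i))

theorem clamp_mem_box {ι : Type} {b : ℝ} (hb : 0 ≤ b) (v : ι → ℝ) : clamp b v ∈ box b :=
  fun _ => ⟨le_max_left _ _, max_le (by linarith) (min_le_left _ _)⟩

theorem clamp_of_mem_box {ι : Type} {b : ℝ} {v : ι → ℝ} (hv : v ∈ box b) : clamp b v = v := by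
  ext i
  rw [clamp, min_eq_right (hv i).2, max_eq_right (hv i).1]

theorem continuous_clamp {ι : Type} (b : ℝ) : Continuous (clamp b : (ι → ℝ) → ι → ℝ) := by
  unfold clamp
  fun_prop

/-- On the range of the assumptions, `f (ρ, R)` is affine in `ρ` with coefficients that are
continuous and bounded functions of `R`. -/
def IsAffineOnBox (f : (Fin N → ℝ) → (Fin m → ℝ) → ℝ) (ρM : ℝ) (c : Fin N → (Fin m → ℝ) → ℝ)
    (c₀ : (Fin m → ℝ) → ℝ) (C : ℝ) : Prop :=
  (∀ k, Continuous (c k)) ∧ Continuous c₀ ∧ (∀ k R, |c k R| ≤ C) ∧ (∀ R, |c₀ R| ≤ C) ∧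
    ∀ r, ∀ R ∈ box (N * ρM), f r R = ∑ k, r k * c k R + c₀ R

theorem LinearAssumption.exists_flux_affine {P : BalanceSystem N m} {ρm ρM LF : ℝ}
    (hP : LinearAssumption P ρm ρM LF) (k : Fin N) :
    ∃ c c₀ C, IsAffineOnBox (fun r R => P.flux k (r k) R) ρM c c₀ C := by
  obtain ⟨V, hV, hVlip⟩ := hP.flux_linear
  obtain ⟨κ, hκ⟩ := hVlip k
  have hρ := hP.rhoM_pos
  have hb : 0 ≤ N * ρM := by positivity
  have hcont : Continuous fun R : Fin m → ℝ => V k (clamp (N * ρM) R) :=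
    hκ.continuousOn.comp_continuous (continuous_clamp _) fun R => clamp_mem_box hb R
  -- `V k R` is the flux at density `ρM`, divided by `ρM`.
  have hbound : ∀ R ∈ box (N * ρM), |V k R| ≤ LF * 2 := by
    intro R hR
    have := hP.abs_flux_le (k := k) (r := ρM) (abs_of_pos hρ).le hR
    rw [hV, abs_mul, abs_of_pos hρ] at this
    nlinarith
  have hLF := hP.LF_nonneg
  refine ⟨fun k' R => if k' = k then V k (clamp (N * ρM) R) else 0, fun _ => 0, LF * 2,
    fun k' => ?_, continuous_const, fun k' R => ?_, fun R => ?_, fun r R hR => ?_⟩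
  · by_cases h : k' = k
    · simpa [h] using hcont
    · simpa [h] using continuous_const
  · by_cases h : k' = k
    · simpa [h] using hbound _ (clamp_mem_box hb R)
    · simpa [h] using hLF
  · simpa using hLF
  · simp [hV, clamp_of_mem_box hR]

/-- `source_linear` says nothing about how the coefficients depend on `R`. They are recovered as
differences of values of the source at `0` and at `ρM` times a unit vector. These points lie in the
box, so the Lipschitz bound gives continuity in `R`; projecting `R` onto its box extends the
coefficients to the whole space. -/
theorem LinearAssumption.exists_source_affine {P : BalanceSystem N m} {ρm ρM LF : ℝ}
    (hP : LinearAssumption P ρm ρM LF) (k : Fin N) :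
    ∃ c c₀ C, IsAffineOnBox (P.source k) ρM c c₀ C := by
  obtain ⟨LS, hLS⟩ := hP.source_lip
  obtain ⟨Sb, hSb0, hSb⟩ := hP.exists_source_bound
  have hρ := hP.rhoM_pos
  have hb : 0 ≤ N * ρM := by positivity
  have hcont : ∀ r ∈ box ρM, Continuous fun R : Fin m → ℝ => P.source k r (clamp (N * ρM) R) := by
    intro r hr
    have hlip : LipschitzOnWith (Real.toNNReal (|LS| * m)) (P.source k r) (box (N * ρM)) := by
      refine LipschitzOnWith.of_dist_le_mul fun R hR R' hR' => ?_
      rw [Real.coe_toNNReal _ (by positivity), Real.dist_eq]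
      refine (hLS k r hr r hr R hR R' hR').trans ?_
      simp only [sub_self, abs_zero, Finset.sum_const_zero, zero_add]
      have h1 : ∑ l, |R l - R' l| ≤ m * dist R R' := sum_abs_le_mul fun l => by
        rw [← Real.dist_eq]
        exact dist_le_pi_dist R R' l
      have h2 : 0 ≤ ∑ l, |R l - R' l| := Finset.sum_nonneg fun l _ => abs_nonneg _
      calc _ ≤ |LS| * ∑ l, |R l - R' l| := mul_le_mul_of_nonneg_right (le_abs_self _) h2
        _ ≤ |LS| * (m * dist R R') := by gcongr
        _ = _ := by ring
    exact hlip.continuousOn.comp_continuous (continuous_clamp _) fun R => clamp_mem_box hb R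
  have h0 : (0 : Fin N → ℝ) ∈ box ρM := mem_box_iff.2 fun i => by simpa using hρ.le
  have h1 : ∀ k', (Pi.single k' ρM : Fin N → ℝ) ∈ box ρM := fun k' => mem_box_iff.2 fun i => by
    by_cases h : i = k'
    · subst h
      simp [abs_of_pos hρ]
    · simpa [h] using hρ.le
  have hb0 : ∀ R, |P.source k 0 (clamp (N * ρM) R)| ≤ Sb := fun R =>
    hSb k _ h0 _ (clamp_mem_box hb R)
  refine ⟨fun k' R => (P.source k (Pi.single k' ρM) (clamp (N * ρM) R)
      - P.source k 0 (clamp (N * ρM) R)) / ρM, fun R => P.source k 0 (clamp (N * ρM) R),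
    Sb + 2 * Sb / ρM, fun k' => ((hcont _ (h1 k')).sub (hcont _ h0)).div_const _, hcont _ h0,
    fun k' R => ?_, fun R => (hb0 R).trans (by
      have : 0 ≤ 2 * Sb / ρM := by positivity
      linarith), fun r R hR => ?_⟩
  · rw [abs_div, abs_of_pos hρ]
    have h2 := abs_sub (P.source k (Pi.single k' ρM) (clamp (N * ρM) R))
      (P.source k 0 (clamp (N * ρM) R))
    have h3 : |P.source k (Pi.single k' ρM) (clamp (N * ρM) R)
      - P.source k 0 (clamp (N * ρM) R)| ≤ 2 * Sb := by
      linarith [hb0 R, hSb k _ (h1 k') _ (clamp_mem_box hb R)]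
    calc _ ≤ 2 * Sb / ρM := by gcongr
      _ ≤ _ := by linarith
  · obtain ⟨a, b, hab⟩ := hP.source_linear k R
    simp only [clamp_of_mem_box hR, hab]
    congr 1
    · refine Finset.sum_congr rfl fun i _ => ?_
      simp [Pi.single_apply]
      field_simp
    · simp

/-! ### Test functions -/

/-- Quantitative properties of a test function. -/
structure TestBound (T T' R Lφ M : ℝ) (Φ : ℝ × ℝ → ℝ) : Prop where
  continuous : Continuous Φ
  integrable : Integrable Φ
  lip : ∀ p q, |Φ p - Φ q| ≤ Lφ * ‖p - q‖
  bound : ∀ p, |Φ p| ≤ M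
  zero_of_norm : ∀ p, R < ‖p‖ → Φ p = 0
  zero_of_time : ∀ p : ℝ × ℝ, T' ≤ p.1 → Φ p = 0
  time_lt : T' < T
  lip_nonneg : 0 ≤ Lφ

theorem IsTestFunction.exists_testBound {T : ℝ} {φ : ℝ → ℝ → ℝ} (hφ : IsTestFunction T φ) :
    ∃ T' R Lφ M, TestBound T T' R Lφ M (Function.uncurry φ) := by
  have hc := hφ.contDiff.continuous
  obtain ⟨C, hC⟩ := hφ.contDiff.lipschitzWith_of_hasCompactSupport hφ.compact (by norm_num)
  obtain ⟨M, hM⟩ := hφ.compact.exists_bound_of_continuous hc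
  obtain ⟨R, hR⟩ := hφ.compact.isBounded.subset_closedBall (0 : ℝ × ℝ)
  have htime : ∃ T' < T, ∀ p : ℝ × ℝ, T' ≤ p.1 → Function.uncurry φ p = 0 := by
    rcases (tsupport (Function.uncurry φ)).eq_empty_or_nonempty with he | hne
    · exact ⟨T - 1, by linarith, fun p _ => image_eq_zero_of_notMem_tsupport (by simp [he])⟩
    · obtain ⟨p₀, hp₀, hmax⟩ := hφ.compact.exists_isMaxOn hne continuous_fst.continuousOn
      have h1 : p₀.1 < T := (hφ.support hp₀).1.2
      refine ⟨(p₀.1 + T) / 2, by linarith, fun p hp => image_eq_zero_of_notMem_tsupport fun h => ?_⟩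
      have h2 : p.1 ≤ p₀.1 := hmax h
      linarith
  obtain ⟨T', hT', hzero⟩ := htime
  refine ⟨T', R, C, M, hc, hc.integrable_of_hasCompactSupport hφ.compact, fun p q => ?_,
    fun p => hM p, fun p hp => image_eq_zero_of_notMem_tsupport fun h => ?_, hzero, hT', C.2⟩
  · have := hC.dist_le_mul p q
    rwa [Real.dist_eq, dist_eq_norm] at this
  · have := hR h
    rw [mem_closedBall_zero_iff] at this
    linarith

/-! ### Summation by parts -/

/-- The grid function `a` is bounded up to time `T`. -/
def GridBdd (T : ℝ) (G : Grid) (a : ℕ → ℤ → ℝ) : Prop :=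
  ∃ A, 0 ≤ A ∧ ∀ n : ℕ, n * G.dt < T → ∀ j, |a n j| ≤ A

/-- A linear three-point stencil. -/
def stencil (α β γ : ℝ) (a : ℕ → ℤ → ℝ) (n : ℕ) (j : ℤ) : ℝ :=
  α * a n (j + 1) + β * a n j + γ * a n (j - 1)

section Parts

variable {T : ℝ} {G : Grid} (hdx : 0 < G.dx) (hdt : 0 < G.dt)

theorem GridBdd.add {a b : ℕ → ℤ → ℝ} (ha : GridBdd T G a) (hb : GridBdd T G b) :
    GridBdd T G fun n j => a n j + b n j := by
  obtain ⟨A, hA0, hA⟩ := ha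
  obtain ⟨B, hB0, hB⟩ := hb
  exact ⟨A + B, by positivity, fun n hn j =>
    (abs_add_le _ _).trans (add_le_add (hA n hn j) (hB n hn j))⟩

theorem GridBdd.const_mul_shift {a : ℕ → ℤ → ℝ} (ha : GridBdd T G a) (α : ℝ) (i : ℤ) :
    GridBdd T G fun n j => α * a n (j + i) := by
  obtain ⟨A, hA0, hA⟩ := ha
  refine ⟨|α| * A, by positivity, fun n hn j => ?_⟩
  rw [abs_mul]
  exact mul_le_mul_of_nonneg_left (hA n hn _) (abs_nonneg _)

theorem GridBdd.stencil {a : ℕ → ℤ → ℝ} (ha : GridBdd T G a) (α β γ : ℝ) :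
    GridBdd T G (stencil α β γ a) := by
  have := ((ha.const_mul_shift α 1).add (ha.const_mul_shift β 0)).add (ha.const_mul_shift γ (-1))
  simp only [add_zero, ← sub_eq_add_neg] at this
  exact this

include hdt in
theorem integrable_gridFn_mul {a : ℕ → ℤ → ℝ} (ha : GridBdd T G a) {Φ : ℝ × ℝ → ℝ}
    (hΦ : Integrable Φ) : Integrable fun p => gridFn T G a p * Φ p := by
  obtain ⟨A, hA0, hA⟩ := ha
  exact hΦ.bdd_mul (c := A) (measurable_gridFn _ _ _).aestronglyMeasurable
    (Eventually.of_forall fun p => abs_gridFn_le hdt hA0 hA p)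

include hdt in
theorem integral_gridFn_add_mul {a b : ℕ → ℤ → ℝ} (ha : GridBdd T G a) (hb : GridBdd T G b)
    {Φ : ℝ × ℝ → ℝ} (hΦ : Integrable Φ) :
    ∫ p, gridFn T G (fun n j => a n j + b n j) p * Φ p
      = (∫ p, gridFn T G a p * Φ p) + ∫ p, gridFn T G b p * Φ p := by
  rw [← integral_add (integrable_gridFn_mul hdt ha hΦ) (integrable_gridFn_mul hdt hb hΦ)]
  congr 1
  ext p
  unfold gridFn
  split_ifs
  · ring
  · ring

include hdx in
theorem gridFn_shift (a : ℕ → ℤ → ℝ) (i : ℤ) (p : ℝ × ℝ) :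
    gridFn T G (fun n j => a n (j + i)) p = gridFn T G a (p + (0, i * G.dx)) := by
  simp only [gridFn, Prod.fst_add, Prod.snd_add, add_zero, cellIdx_add_mul hdx]

include hdx in
theorem integral_gridFn_shift_mul (a : ℕ → ℤ → ℝ) (i : ℤ) (Φ : ℝ × ℝ → ℝ) :
    ∫ p, gridFn T G (fun n j => a n (j + i)) p * Φ p
      = ∫ p, gridFn T G a p * Φ (p - (0, i * G.dx)) := by
  rw [← integral_add_right_eq_self (fun p => gridFn T G a p * Φ (p - (0, i * G.dx)))
    ((0 : ℝ), (i : ℝ) * G.dx)]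
  congr 1
  ext p
  rw [gridFn_shift hdx, add_sub_cancel_right]

theorem integral_gridFn_const_mul (a : ℕ → ℤ → ℝ) (α : ℝ) (Φ : ℝ × ℝ → ℝ) :
    ∫ p, gridFn T G (fun n j => α * a n j) p * Φ p = ∫ p, gridFn T G a p * (α * Φ p) := by
  congr 1
  ext p
  unfold gridFn
  split_ifs
  · ring
  · ring

include hdx hdt in
-- The stencil is transposed by translation invariance, so the value in the right-hand cell is
-- paired with `Φ` shifted to the left and conversely.
theorem integral_gridFn_stencil_mul {a : ℕ → ℤ → ℝ} (ha : GridBdd T G a) (α β γ : ℝ)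
    {Φ : ℝ × ℝ → ℝ} (hΦ : Integrable Φ) :
    ∫ p, gridFn T G (stencil α β γ a) p * Φ p = ∫ p, gridFn T G a p *
      (α * Φ (p - (0, G.dx)) + β * Φ p + γ * Φ (p + (0, G.dx))) := by
  have h1 := ha.const_mul_shift α 1
  have h2 := ha.const_mul_shift β 0
  have h3 := ha.const_mul_shift γ (-1)
  have e : stencil α β γ a
      = fun n j => (α * a n (j + 1) + β * a n (j + 0)) + γ * a n (j + -1) := by
    ext n j
    simp [stencil, sub_eq_add_neg]
  rw [e, integral_gridFn_add_mul hdt (h1.add h2) h3 hΦ, integral_gridFn_add_mul hdt h1 h2 hΦ,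
    integral_gridFn_shift_mul hdx (fun n j => α * a n j) 1,
    integral_gridFn_shift_mul hdx (fun n j => β * a n j) 0,
    integral_gridFn_shift_mul hdx (fun n j => γ * a n j) (-1), integral_gridFn_const_mul,
    integral_gridFn_const_mul, integral_gridFn_const_mul]
  have hs : ∀ (δ : ℝ) (q : ℝ × ℝ), Integrable fun p => gridFn T G a p * (δ * Φ (p - q)) :=
    fun δ q => integrable_gridFn_mul hdt ha ((hΦ.comp_sub_right q).const_mul δ)
  have hs2 : Integrable fun p => gridFn T G a p * (α * Φ (p - (0, ((1 : ℤ) : ℝ) * G.dx)))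
      + gridFn T G a p * (β * Φ (p - (0, ((0 : ℤ) : ℝ) * G.dx))) := (hs _ _).add (hs _ _)
  rw [← integral_add (hs _ _) (hs _ _), ← integral_add hs2 (hs _ _)]
  congr 1
  ext p
  have e1 : p - ((0 : ℝ), ((1 : ℤ) : ℝ) * G.dx) = p - (0, G.dx) := by simp
  have e2 : p - ((0 : ℝ), ((0 : ℤ) : ℝ) * G.dx) = p := by
    ext <;> simp
  have e3 : p - ((0 : ℝ), ((-1 : ℤ) : ℝ) * G.dx) = p + (0, G.dx) := by
    ext <;> simp
  rw [e1, e2, e3]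
  ring

/-- The contribution of the initial values. -/
def initFn (G : Grid) (a : ℤ → ℝ) (p : ℝ × ℝ) : ℝ :=
  if -G.dt ≤ p.1 ∧ p.1 < 0 then a (cellIdx G.dx p.2) else 0

theorem measurable_initFn (G : Grid) (a : ℤ → ℝ) : Measurable (initFn G a) := by
  refine Measurable.ite ?_ ((measurable_comp_cellIdx G.dx a).comp measurable_snd) measurable_const
  exact (measurableSet_le measurable_const measurable_fst).inter
    (measurableSet_lt measurable_fst measurable_const)

include hdt in
-- Summation by parts in time. The grid function vanishes for negative times, so its shift by `Δt`
-- creates the layer `[-Δt, 0)` that carries the initial values. At the final time nothing is left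
-- over, since `Φ` vanishes from `T'` on.
theorem integral_time_difference (hT : 0 < T) {a : ℕ → ℤ → ℝ} (ha : GridBdd T G a)
    (ha' : GridBdd T G fun n j => a (n + 1) j - a n j) {T' R Lφ M : ℝ} {Φ : ℝ × ℝ → ℝ}
    (hΦ : TestBound T T' R Lφ M Φ) (hT' : T' + G.dt ≤ T) :
    ∫ p, gridFn T G a p * (Φ (p - (G.dt, 0)) - Φ p)
      = (∫ p, initFn G (a 0) p * Φ p)
        + ∫ p, gridFn T G (fun n j => a (n + 1) j - a n j) p * Φ p := by
  have hi := hΦ.integrable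
  have hpt : ∀ p, (gridFn T G a (p + (G.dt, 0)) - gridFn T G a p) * Φ p
      = initFn G (a 0) p * Φ p + gridFn T G (fun n j => a (n + 1) j - a n j) p * Φ p := by
    intro p
    by_cases hp : T' ≤ p.1
    · simp [hΦ.zero_of_time p hp]
    have hp : p.1 < T' := not_le.1 hp
    have hTT := hΦ.time_lt
    rw [← add_mul]
    congr 1
    simp only [gridFn, initFn, Prod.fst_add, Prod.snd_add, add_zero]
    have h2 : p.1 + G.dt < T := by linarith
    have h3 : p.1 < T := by linarith
    rcases lt_or_ge p.1 (-G.dt) with h1 | h1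
    · have c1 : ¬(0 ≤ p.1 + G.dt) := by linarith
      have c2 : ¬(0 ≤ p.1) := by linarith
      have c3 : ¬(-G.dt ≤ p.1) := by linarith
      simp [c1, c2, c3]
    rcases lt_or_ge p.1 0 with h4 | h4
    · have c1 : 0 ≤ p.1 + G.dt := by linarith
      have c2 : ¬(0 ≤ p.1) := by linarith
      have c3 : ⌊(p.1 + G.dt) / G.dt⌋₊ = 0 := by
        rw [Nat.floor_eq_zero, div_lt_one hdt]
        linarith
      simp [c1, c2, h1, h2, h4, c3]
    · have c1 : 0 ≤ p.1 + G.dt := by linarith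
      have c2 : ¬(p.1 < 0) := by linarith
      have c3 : ⌊(p.1 + G.dt) / G.dt⌋₊ = ⌊p.1 / G.dt⌋₊ + 1 := by
        rw [add_div, div_self hdt.ne', Nat.floor_add_one (by positivity)]
      simp [c1, c2, h2, h3, h4, c3]
  have hinit : Integrable fun p => initFn G (a 0) p * Φ p := by
    obtain ⟨A, hA0, hA⟩ := ha
    refine hi.bdd_mul (c := A) (measurable_initFn _ _).aestronglyMeasurable
      (Eventually.of_forall fun p => ?_)
    unfold initFn
    split_ifs
    · exact hA 0 (by simpa using hT) _
    · simpa using hA0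
  have hgi := integrable_gridFn_mul hdt ha hi
  have hgs := integrable_gridFn_mul hdt ha (hi.comp_sub_right (G.dt, (0 : ℝ)))
  have hshift : Integrable fun p => gridFn T G a (p + (G.dt, 0)) * Φ p := by
    have := hgs.comp_add_right (G.dt, (0 : ℝ))
    simpa only [add_sub_cancel_right] using this
  have hswap : ∫ p, gridFn T G a p * Φ (p - (G.dt, 0))
      = ∫ p, gridFn T G a (p + (G.dt, 0)) * Φ p := by
    rw [← integral_add_right_eq_self (fun p => gridFn T G a p * Φ (p - (G.dt, 0))) (G.dt, (0 : ℝ))]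
    simp only [add_sub_cancel_right]
  simp only [mul_sub]
  rw [integral_sub hgs hgi, hswap, ← integral_sub hshift hgi,
    ← integral_add hinit (integrable_gridFn_mul hdt ha' hi)]
  simp only [← sub_mul, hpt]

theorem ae_fst_ne_zero : ∀ᵐ p : ℝ × ℝ, p.1 ≠ 0 :=
  (Measure.quasiMeasurePreserving_fst (μ := (volume : Measure ℝ)) (ν := (volume : Measure ℝ))).ae
    (p := fun t => t ≠ 0) (by simp [ae_iff])

/-- `gridFn` includes the initial time and the strip does not; the line `t = 0` is a null set. -/
theorem integral_gridFn_mul_eq_strip (a : ℕ → ℤ → ℝ) (Φ : ℝ × ℝ → ℝ) :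
    ∫ p, gridFn T G a p * Φ p = ∫ p in strip T, gridFn T G a p * Φ p := by
  refine (setIntegral_eq_integral_of_ae_compl_eq_zero ?_).symm
  filter_upwards [ae_fst_ne_zero] with p hp hmem
  have : ¬(0 ≤ p.1 ∧ p.1 < T) := fun h =>
    hmem ⟨⟨lt_of_le_of_ne h.1 (Ne.symm hp), h.2⟩, mem_univ _⟩
  simp [gridFn, this]

end Parts

/-! ### The discrete weak form -/

/-- The scheme is a sum of three-point stencils; integrating it against `Φ`, transposing each
stencil and dividing by `Δt` gives an exact identity. The test function itself is never discretised,
so no consistency error appears. -/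
theorem RunBound.discrete_weak_form {P : BalanceSystem N m} {G : Grid} {T ρm ρM LF L e : ℝ}
    (hP : BaseAssumption P ρm ρM LF) (h : RunBound P G T ρM L e) (hT : 0 < T)
    {T' R Lφ M : ℝ} {Φ : ℝ × ℝ → ℝ} (hΦ : TestBound T T' R Lφ M Φ) (hT' : T' + G.dt ≤ T)
    (k : Fin N) :
    ∫ p in strip T, cellRho P G T k p * ((Φ (p - (G.dt, 0)) - Φ p) / G.dt)
      = (∫ p, initFn G (fun j => values P G 0 j k) p * Φ p) / G.dt
        + (∫ p in strip T, cellRho P G T k p *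
            ((1 / 4 * Φ (p - (0, G.dx)) + -1 / 2 * Φ p + 1 / 4 * Φ (p + (0, G.dx))) / G.dt))
        + (∫ p in strip T, gridFn T G (fun n j => G.dx * slope G (values P G n) j k) p *
            ((-1 / 16 * Φ (p - (0, G.dx)) + 0 * Φ p + 1 / 16 * Φ (p + (0, G.dx))) / G.dt))
        + (∫ p in strip T,
            gridFn T G (fun n j => G.dx * slope G (staggered P G (values P G n)) j k) p *
            ((0 * Φ (p - (0, G.dx)) + -1 / 8 * Φ p + 1 / 8 * Φ (p + (0, G.dx))) / G.dt))
        + (∫ p in strip T, gridFn T G (fun n j => halfFlux P G (values P G n) j k) p *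
            ((Φ (p + (0, G.dx)) - Φ (p - (0, G.dx))) / (2 * G.dx)))
        + ∫ p in strip T, gridFn T G (fun n j => halfSource P G (values P G n) j k) p *
            ((Φ (p - (0, G.dx)) + 2 * Φ p + Φ (p + (0, G.dx))) / 4) := by
  have hdx := h.dx_pos
  have hdt := h.dt_pos
  have hρ := hP.rhoM_pos.le
  have hLF := hP.LF_nonneg
  obtain ⟨Sb, hSb0, hSb⟩ := hP.exists_source_bound
  set r : ℕ → ℤ → ℝ := fun n j => values P G n j k with hr
  set S : ℕ → ℤ → ℝ := fun n j => G.dx * slope G (values P G n) j k with hS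
  set S' : ℕ → ℤ → ℝ := fun n j => G.dx * slope G (staggered P G (values P G n)) j k with hS'
  set F : ℕ → ℤ → ℝ := fun n j => halfFlux P G (values P G n) j k with hF
  set Q : ℕ → ℤ → ℝ := fun n j => halfSource P G (values P G n) j k with hQ
  have br : GridBdd T G r := ⟨ρM, hρ, fun n hn j => (h.inRange n hn).rho j k⟩
  have bS : GridBdd T G S := ⟨G.trunc, abs_nonneg _, fun n _ j =>
    abs_dx_mul_slope_le_trunc hdx _ j k⟩
  have bS' : GridBdd T G S' := ⟨G.trunc, abs_nonneg _, fun n _ j =>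
    abs_dx_mul_slope_le_trunc hdx _ j k⟩
  have bF : GridBdd T G F := ⟨LF * (2 * ρM), by positivity, fun n hn j =>
    hP.abs_flux_le (mem_box_iff.1 ((h.inRange n hn).halfRho j) k) ((h.inRange n hn).halfR j)⟩
  have bQ : GridBdd T G Q := ⟨Sb, hSb0, fun n hn j =>
    hSb k _ ((h.inRange n hn).halfRho j) _ ((h.inRange n hn).halfR j)⟩
  have c1 := br.stencil (1 / 4) (-1 / 2) (1 / 4)
  have c2 := bS.stencil (-1 / 16) 0 (1 / 16)
  have c3 := bS'.stencil 0 (-1 / 8) (1 / 8)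
  have c4 := bF.stencil (-(G.ratio / 2)) 0 (G.ratio / 2)
  have c5 := bQ.stencil (G.dt / 4) (G.dt / 2) (G.dt / 4)
  have c12 := c1.add c2
  have c13 := c12.add c3
  have c14 := c13.add c4
  have c15 := c14.add c5
  have hdiff : (fun n j => r (n + 1) j - r n j) = fun n j =>
      (((stencil (1 / 4) (-1 / 2) (1 / 4) r n j + stencil (-1 / 16) 0 (1 / 16) S n j)
        + stencil 0 (-1 / 8) (1 / 8) S' n j) + stencil (-(G.ratio / 2)) 0 (G.ratio / 2) F n j)
        + stencil (G.dt / 4) (G.dt / 2) (G.dt / 4) Q n j := by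
    ext n j
    simp only [hr, hS, hS', hF, hQ, stencil, values, step]
    ring
  have hi := hΦ.integrable
  have main := integral_time_difference hdt hT br (by rw [hdiff]; exact c15) hΦ hT'
  rw [hdiff, integral_gridFn_add_mul hdt c14 c5 hi, integral_gridFn_add_mul hdt c13 c4 hi,
    integral_gridFn_add_mul hdt c12 c3 hi, integral_gridFn_add_mul hdt c1 c2 hi,
    integral_gridFn_stencil_mul hdx hdt br _ _ _ hi, integral_gridFn_stencil_mul hdx hdt bS _ _ _ hi,
    integral_gridFn_stencil_mul hdx hdt bS' _ _ _ hi,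
    integral_gridFn_stencil_mul hdx hdt bF _ _ _ hi,
    integral_gridFn_stencil_mul hdx hdt bQ _ _ _ hi] at main
  simp only [integral_gridFn_mul_eq_strip] at main
  have hdiv : ∀ (a : ℕ → ℤ → ℝ) (ψ : ℝ × ℝ → ℝ), ∫ p in strip T, gridFn T G a p * (ψ p / G.dt)
      = (∫ p in strip T, gridFn T G a p * ψ p) / G.dt := fun a ψ => by
    rw [← integral_div]
    simp only [mul_div_assoc]
  -- `λ / (2 Δt) = 1 / (2 Δx)`: the flux meets the central difference quotient of `Φ`.
  have hFeq : ∀ p : ℝ × ℝ, (Φ (p + (0, G.dx)) - Φ (p - (0, G.dx))) / (2 * G.dx)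
      = (-(G.ratio / 2) * Φ (p - (0, G.dx)) + 0 * Φ p + G.ratio / 2 * Φ (p + (0, G.dx)))
        / G.dt := fun p => by
    rw [Grid.ratio]
    field_simp
    ring
  have hQeq : ∀ p : ℝ × ℝ, (Φ (p - (0, G.dx)) + 2 * Φ p + Φ (p + (0, G.dx))) / 4
      = (G.dt / 4 * Φ (p - (0, G.dx)) + G.dt / 2 * Φ p + G.dt / 4 * Φ (p + (0, G.dx)))
        / G.dt := fun p => by
    field_simp
    ring
  simp only [hFeq, hQeq, cellRho, hdiv]
  rw [main]
  simp only [add_div]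
  ring

/-! ### Difference quotients of test functions -/

/-- The indicator function of a ball that contains the supports of all shifts by at most one. -/
def ballFn (R : ℝ) (p : ℝ × ℝ) : ℝ := (Metric.closedBall (0 : ℝ × ℝ) (R + 1)).indicator (fun _ => 1) p

theorem ballFn_nonneg (R : ℝ) (p : ℝ × ℝ) : 0 ≤ ballFn R p :=
  indicator_nonneg (fun _ _ => zero_le_one) p

theorem integrable_ballFn (R : ℝ) : Integrable (ballFn R) :=
  (integrable_indicator_iff Metric.isClosed_closedBall.measurableSet).2
    (integrableOn_const measure_closedBall_lt_top.ne)

section Quotients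

variable {T T' R Lφ M : ℝ} {Φ : ℝ × ℝ → ℝ} (hΦ : TestBound T T' R Lφ M Φ)
include hΦ

theorem TestBound.bound_nonneg : 0 ≤ M := (abs_nonneg _).trans (hΦ.bound 0)

theorem TestBound.abs_shift_sub_le {v : ℝ × ℝ} (hv : ‖v‖ ≤ 1) (p : ℝ × ℝ) :
    |Φ (p + v) - Φ p| ≤ Lφ * ‖v‖ * ballFn R p := by
  by_cases hp : ‖p‖ ≤ R + 1
  · have h1 := hΦ.lip (p + v) p
    rw [add_sub_cancel_left] at h1
    simpa [ballFn, mem_closedBall_zero_iff.2 hp] using h1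
  · have h1 : R < ‖p‖ := by linarith
    have h2 : R < ‖p + v‖ := by
      have := norm_sub_norm_le p (-v)
      rw [sub_neg_eq_add, norm_neg] at this
      linarith
    rw [hΦ.zero_of_norm _ h1, hΦ.zero_of_norm _ h2]
    simp only [sub_zero, abs_zero]
    exact mul_nonneg (mul_nonneg hΦ.lip_nonneg (norm_nonneg _)) (ballFn_nonneg _ _)

theorem TestBound.abs_shift_le {v : ℝ × ℝ} (hv : ‖v‖ ≤ 1) (p : ℝ × ℝ) :
    |Φ (p + v)| ≤ M * ballFn R p := by
  by_cases hp : ‖p‖ ≤ R + 1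
  · simpa [ballFn, mem_closedBall_zero_iff.2 hp] using hΦ.bound (p + v)
  · have h2 : R < ‖p + v‖ := by
      have := norm_sub_norm_le p (-v)
      rw [sub_neg_eq_add, norm_neg] at this
      linarith
    rw [hΦ.zero_of_norm _ h2, abs_zero]
    exact mul_nonneg hΦ.bound_nonneg (ballFn_nonneg _ _)

theorem TestBound.abs_le (p : ℝ × ℝ) : |Φ p| ≤ M * ballFn R p := by
  simpa using hΦ.abs_shift_le (v := 0) (by simp) p

end Quotients

theorem IsTestFunction.tendsto_quotient_space {T : ℝ} {φ : ℝ → ℝ → ℝ} (hφ : IsTestFunction T φ)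
    {s : ℕ → ℝ} (hs : Tendsto s atTop (𝓝 0)) (hs0 : ∀ i, s i ≠ 0) (p : ℝ × ℝ) :
    Tendsto (fun i => (Function.uncurry φ (p + (0, s i)) - Function.uncurry φ p) / s i) atTop
      (𝓝 (deriv (fun x => φ p.1 x) p.2)) := by
  have hd : DifferentiableAt ℝ (fun x => φ p.1 x) p.2 :=
    (hφ.contDiff.comp (contDiff_const.prodMk contDiff_id)).differentiable one_ne_zero p.2
  have h1 := hd.hasDerivAt.tendsto_slope_zero.comp
    (tendsto_nhdsWithin_iff.2 ⟨hs, Eventually.of_forall hs0⟩)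
  refine h1.congr fun i => ?_
  simp only [Function.comp, Function.uncurry, Prod.fst_add, Prod.snd_add, add_zero, smul_eq_mul]
  ring

theorem IsTestFunction.tendsto_quotient_time {T : ℝ} {φ : ℝ → ℝ → ℝ} (hφ : IsTestFunction T φ)
    {s : ℕ → ℝ} (hs : Tendsto s atTop (𝓝 0)) (hs0 : ∀ i, s i ≠ 0) (p : ℝ × ℝ) :
    Tendsto (fun i => (Function.uncurry φ (p + (s i, 0)) - Function.uncurry φ p) / s i) atTop
      (𝓝 (deriv (fun t => φ t p.2) p.1)) := by
  have hd : DifferentiableAt ℝ (fun t => φ t p.2) p.1 :=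
    (hφ.contDiff.comp (contDiff_id.prodMk contDiff_const)).differentiable one_ne_zero p.1
  have h1 := hd.hasDerivAt.tendsto_slope_zero.comp
    (tendsto_nhdsWithin_iff.2 ⟨hs, Eventually.of_forall hs0⟩)
  refine h1.congr fun i => ?_
  simp only [Function.comp, Function.uncurry, Prod.fst_add, Prod.snd_add, add_zero, smul_eq_mul]
  ring

/-! ### The initial values -/

theorem BaseAssumption.locallyIntegrable_initial {P : BalanceSystem N m} {ρm ρM LF : ℝ}
    (hP : BaseAssumption P ρm ρM LF) (k : Fin N) : LocallyIntegrable fun x => P.initial x k :=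
  MemLp.locallyIntegrable (p := ∞) (memLp_pi_iff.1 hP.initial_mem k) (by simp)

theorem values_zero_eq_setAverage (P : BalanceSystem N m) {G : Grid} (hdx : 0 < G.dx) (j : ℤ)
    (k : Fin N) : values P G 0 j k
      = ⨍ y in Metric.closedBall ((j : ℝ) * G.dx) (G.dx / 2), P.initial y k := by
  have e1 : ((j : ℝ) - 1 / 2) * G.dx = j * G.dx - G.dx / 2 := by ring
  have e2 : ((j : ℝ) + 1 / 2) * G.dx = j * G.dx + G.dx / 2 := by ring
  rw [setAverage_eq, Real.closedBall_eq_Icc, Real.volume_real_Icc_of_le (by linarith),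
    integral_Icc_eq_integral_Ico, smul_eq_mul]
  simp only [values]
  rw [e1, e2]
  congr 1
  rw [one_div]
  congr 1
  ring

/-- Lebesgue differentiation with balls that need not be centred at `x`: the cell of `x` is a ball
of radius `Δx / 2` whose centre is within that radius of `x`. -/
theorem ae_tendsto_values_zero {P : BalanceSystem N m} {ρm ρM LF : ℝ}
    (hP : BaseAssumption P ρm ρM LF) {G : ℕ → Grid} (hdx : ∀ i, 0 < (G i).dx)
    (hdx0 : Tendsto (fun i => (G i).dx) atTop (𝓝 0)) (k : Fin N) :
    ∀ᵐ x, Tendsto (fun i => values P (G i) 0 (cellIdx (G i).dx x) k) atTop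
      (𝓝 (P.initial x k)) := by
  filter_upwards [IsUnifLocDoublingMeasure.ae_tendsto_average volume
    (hP.locallyIntegrable_initial k) 1] with x hx
  simp only [values_zero_eq_setAverage P (hdx _)]
  refine hx (fun i => (cellIdx (G i).dx x : ℝ) * (G i).dx) (fun i => (G i).dx / 2) ?_ ?_
  · refine tendsto_nhdsWithin_iff.2 ⟨?_, Eventually.of_forall fun i => half_pos (hdx i)⟩
    simpa using hdx0.div_const 2
  · refine Eventually.of_forall fun i => ?_
    rw [Metric.mem_closedBall, Real.dist_eq, one_mul]
    exact abs_sub_cellIdx_le (hdx i) x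

theorem integral_initFn_mul {G : Grid} (hdt : 0 < G.dt) {a : ℤ → ℝ} {A : ℝ} (ha : ∀ j, |a j| ≤ A)
    {Φ : ℝ × ℝ → ℝ} (hΦ : Integrable Φ) :
    (∫ p, initFn G a p * Φ p) / G.dt
      = ∫ x, a (cellIdx G.dx x) * ⨍ t in Ico (-G.dt) 0, Φ (t, x) := by
  have hA : 0 ≤ A := (abs_nonneg _).trans (ha 0)
  have hint : Integrable fun p => initFn G a p * Φ p := by
    refine hΦ.bdd_mul (c := A) (measurable_initFn _ _).aestronglyMeasurable
      (Eventually.of_forall fun p => ?_)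
    unfold initFn
    split_ifs
    · exact ha _
    · simpa using hA
  rw [Measure.volume_eq_prod] at hint ⊢
  rw [integral_prod_symm _ hint, ← integral_div]
  congr 1
  ext x
  have h1 : ∀ t, initFn G a (t, x) * Φ (t, x)
      = (Ico (-G.dt) 0).indicator (fun t => a (cellIdx G.dx x) * Φ (t, x)) t := fun t => by
    by_cases ht : t ∈ Ico (-G.dt) 0
    · rw [indicator_of_mem ht, initFn, if_pos (show -G.dt ≤ t ∧ t < 0 from ht)]
    · rw [indicator_of_notMem ht, initFn, if_neg (by simpa using ht), zero_mul]
  simp only [h1]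
  rw [integral_indicator measurableSet_Ico, integral_const_mul, setAverage_eq,
    Real.volume_real_Ico_of_le (by linarith), smul_eq_mul, zero_sub, neg_neg]
  ring

/-- The cell averages converge almost everywhere, the average of `Φ` over `[-Δt, 0)` is within `Lφ
Δt` of `Φ (0, x)`, and everything is dominated by a constant on a ball. -/
theorem tendsto_initial {P : BalanceSystem N m} {ρm ρM LF : ℝ}
    (hP : BaseAssumption P ρm ρM LF) {G : ℕ → Grid} (hdx : ∀ i, 0 < (G i).dx)
    (hdx0 : Tendsto (fun i => (G i).dx) atTop (𝓝 0)) (hdt : ∀ i, 0 < (G i).dt)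
    (hdt0 : Tendsto (fun i => (G i).dt) atTop (𝓝 0))
    {A : ℝ} {k : Fin N} (ha : ∀ i j, |values P (G i) 0 j k| ≤ A)
    {T T' R Lφ M : ℝ} {Φ : ℝ × ℝ → ℝ} (hΦ : TestBound T T' R Lφ M Φ) :
    Tendsto (fun i => (∫ p, initFn (G i) (fun j => values P (G i) 0 j k) p * Φ p) / (G i).dt) atTop
      (𝓝 (∫ x, P.initial x k * Φ (0, x))) := by
  have hA : 0 ≤ A := (abs_nonneg _).trans (ha 0 0)
  have hM := hΦ.bound_nonneg
  simp only [integral_initFn_mul (hdt _) (ha _) hΦ.integrable]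
  have hvol : ∀ i, volume (Ico (-(G i).dt) 0) ≠ ∞ := fun i => measure_Ico_lt_top.ne
  have hvol0 : ∀ i, volume (Ico (-(G i).dt) 0) ≠ 0 := fun i => by
    rw [Real.volume_Ico]
    simpa using hdt i
  have hcont : ∀ x, Continuous fun t => Φ (t, x) := fun x =>
    hΦ.continuous.comp (by fun_prop)
  have hion : ∀ i x, IntegrableOn (fun t => Φ (t, x)) (Ico (-(G i).dt) 0) := fun i x =>
    ((hcont x).integrableOn_Icc).mono_set Ico_subset_Icc_self
  have hMle : ∀ i x, |⨍ t in Ico (-(G i).dt) 0, Φ (t, x)| ≤ M := fun i x => by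
    have := setAverage_mem_Icc (hvol0 i) (hvol i) measurableSet_Ico (hion i x) (c := 0) (d := M)
      fun t _ => by simpa using hΦ.bound (t, x)
    simpa using this
  refine tendsto_integral_of_dominated_convergence
    ((Metric.closedBall (0 : ℝ) R).indicator fun _ => A * M) (fun i => ?_) ?_ (fun i => ?_) ?_
  · refine ((measurable_comp_cellIdx _ fun j => values P (G i) 0 j k).mul ?_).aestronglyMeasurable
    simp only [setAverage_eq]
    refine Measurable.const_mul (f := fun x => ∫ t in Ico (-(G i).dt) 0, Φ (t, x)) ?_ _
    exact (StronglyMeasurable.integral_prod_right (f := fun (x t : ℝ) => Φ (t, x))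
      (hΦ.continuous.comp (by fun_prop : Continuous fun q : ℝ × ℝ => (q.2, q.1))).stronglyMeasurable).measurable
  · exact (integrable_indicator_iff Metric.isClosed_closedBall.measurableSet).2
      (integrableOn_const measure_closedBall_lt_top.ne)
  · refine Eventually.of_forall fun x => ?_
    by_cases hx : |x| ≤ R
    · have hx' : x ∈ Metric.closedBall (0 : ℝ) R := by simpa using hx
      rw [indicator_of_mem hx', Real.norm_eq_abs, abs_mul]
      exact mul_le_mul (ha i _) (hMle i x) (abs_nonneg _) hA
    · have hx' : x ∉ Metric.closedBall (0 : ℝ) R := by simpa using hx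
      have hz : ∀ t, Φ (t, x) = 0 := fun t => hΦ.zero_of_norm _ (lt_of_lt_of_le (not_le.1 hx)
        (norm_snd_le (t, x)))
      simp [indicator_of_notMem hx', hz]
  · filter_upwards [ae_tendsto_values_zero hP hdx hdx0 k] with x hx
    refine hx.mul ?_
    have hd : Tendsto (fun i => Lφ * (G i).dt) atTop (𝓝 0) := by simpa using hdt0.const_mul Lφ
    rw [tendsto_iff_norm_sub_tendsto_zero]
    refine squeeze_zero (fun _ => norm_nonneg _) (fun i => ?_) hd
    refine setAverage_mem_Icc (hvol0 i) (hvol i) measurableSet_Ico (hion i x) fun t ht => ?_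
    refine (hΦ.lip _ _).trans (mul_le_mul_of_nonneg_left ?_ hΦ.lip_nonneg)
    simp only [Prod.mk_sub_mk, sub_zero, sub_self, Prod.norm_mk, norm_zero]
    rw [max_eq_left (norm_nonneg _), Real.norm_eq_abs, abs_of_neg ht.2]
    linarith [ht.1]

/-! ### The limit is a weak solution -/

theorem norm_time_shift {s : ℝ} : ‖((s, 0) : ℝ × ℝ)‖ = |s| := by simp [Prod.norm_mk]

theorem norm_space_shift {s : ℝ} : ‖((0, s) : ℝ × ℝ)‖ = |s| := by simp [Prod.norm_mk]

/-- As a pointwise limit of difference quotients along `1 / (i + 1)`, the derivative is measurable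
and inherits their bound, a multiple of the indicator of a ball. -/
theorem IsTestFunction.integrable_deriv_space {T : ℝ} {φ : ℝ → ℝ → ℝ} (hφ : IsTestFunction T φ) :
    Integrable fun p : ℝ × ℝ => deriv (fun x => φ p.1 x) p.2 := by
  obtain ⟨T', R, Lφ, M, hΦ⟩ := hφ.exists_testBound
  have hs0 : ∀ i : ℕ, (0 : ℝ) < 1 / ((i : ℝ) + 1) := fun i => by positivity
  have hlim := hφ.tendsto_quotient_space tendsto_one_div_add_atTop_nhds_zero_nat
    fun i => (hs0 i).ne'
  have hc := hΦ.continuous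
  refine Integrable.mono' ((integrable_ballFn R).const_mul Lφ)
    (aestronglyMeasurable_of_tendsto_ae atTop (fun i => ?_) (Eventually.of_forall hlim))
    (Eventually.of_forall fun p => le_of_tendsto' (hlim p).abs fun i => ?_)
  · exact Continuous.aestronglyMeasurable (by fun_prop)
  · have h1 := hΦ.abs_shift_sub_le (v := (0, 1 / ((i : ℝ) + 1))) (by
      rw [norm_space_shift, abs_of_pos (hs0 i), div_le_one (by positivity)]
      linarith [Nat.cast_nonneg (α := ℝ) i]) p
    rw [norm_space_shift, abs_of_pos (hs0 i)] at h1
    rw [abs_div, abs_of_pos (hs0 i), div_le_iff₀ (hs0 i)]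
    linarith

/-- Dominated convergence to zero on the strip. -/
theorem tendsto_integral_strip_zero {T R D : ℝ} {F : ℕ → ℝ × ℝ → ℝ} (hF : ∀ i, Measurable (F i))
    (hFD : ∀ i p, |F i p| ≤ D * ballFn R p) (hlim : ∀ p, Tendsto (fun i => F i p) atTop (𝓝 0)) :
    Tendsto (fun i => ∫ p in strip T, F i p) atTop (𝓝 0) := by
  have := (weakConv_one T).tendsto_mul (fun _ => measurable_const) (B := 1)
    (fun _ _ _ => by simp) hF ((integrable_ballFn R).const_mul D).integrableOn
    (fun i p _ => hFD i p) (Eventually.of_forall fun p _ => hlim p)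
  simpa using this

theorem IsAffineOnBox.integrableOn_mul {P : BalanceSystem N m} {ρM K : ℝ} (hρ : 0 ≤ ρM)
    (hK : ∀ l k, KernelBound (P.kernel l k) K) {f : (Fin N → ℝ) → (Fin m → ℝ) → ℝ}
    {c : Fin N → (Fin m → ℝ) → ℝ} {c₀ : (Fin m → ℝ) → ℝ} {C : ℝ} (hf : IsAffineOnBox f ρM c c₀ C)
    {u : ℝ → ℝ → Fin N → ℝ} (hu : ∀ k, Measurable fun p : ℝ × ℝ => u p.1 p.2 k)
    (huB : ∀ t x k, |u t x k| ≤ ρM) {χ : ℝ × ℝ → ℝ} {s : Set (ℝ × ℝ)} (hχ : IntegrableOn χ s) :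
    IntegrableOn (fun p => f (u p.1 p.2) (nonlocal P.kernel u p.1 p.2) * χ p) s := by
  obtain ⟨hc, hc₀, hcC, hc₀C, hrep⟩ := hf
  have hRm := measurable_nonlocal hK hu
  have hC : 0 ≤ C := (abs_nonneg _).trans (hc₀C 0)
  have heq : ∀ p : ℝ × ℝ, f (u p.1 p.2) (nonlocal P.kernel u p.1 p.2)
      = ∑ k, u p.1 p.2 k * c k (nonlocal P.kernel u p.1 p.2)
        + c₀ (nonlocal P.kernel u p.1 p.2) := fun p =>
    hrep _ _ (nonlocal_mem_box hK huB p.1 p.2)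
  simp only [heq]
  refine Integrable.bdd_mul (c := N * (ρM * C) + C) hχ (Measurable.aestronglyMeasurable ?_)
    (Eventually.of_forall fun p => ?_)
  · exact (Finset.measurable_sum _ fun k _ => (hu k).mul ((hc k).measurable.comp hRm)).add
      (hc₀.measurable.comp hRm)
  · refine (abs_add_le _ _).trans (add_le_add (abs_sum_le_mul fun k => ?_) (hc₀C _))
    rw [abs_mul]
    exact mul_le_mul (huB _ _ _) (hcC _ _) (abs_nonneg _) hρ

theorem ConvergentFamily.tendsto_integral_of_isAffineOnBox {P : BalanceSystem N m} {T ρM L K : ℝ}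
    {G : ℕ → Grid} {e : ℕ → ℝ} {u : ℝ → ℝ → Fin N → ℝ} (h : ConvergentFamily P T ρM L G e u)
    (hK : ∀ l k, KernelBound (P.kernel l k) K) {f : (Fin N → ℝ) → (Fin m → ℝ) → ℝ}
    {c : Fin N → (Fin m → ℝ) → ℝ} {c₀ : (Fin m → ℝ) → ℝ} {C : ℝ} (hf : IsAffineOnBox f ρM c c₀ C)
    {ψ : ℕ → ℝ × ℝ → ℝ} {χ Ψ : ℝ × ℝ → ℝ} (hψ : ∀ i, Measurable (ψ i))
    (hΨ : IntegrableOn Ψ (strip T)) (hψΨ : ∀ i, ∀ p ∈ strip T, |ψ i p| ≤ Ψ p)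
    (hlim : ∀ᵐ p, p ∈ strip T → Tendsto (fun i => ψ i p) atTop (𝓝 (χ p))) :
    Tendsto (fun i => ∫ p in strip T, gridFn T (G i) (fun n j =>
        f (halfRho P (G i) (values P (G i) n) j) (halfR P (G i) (values P (G i) n) j)) p * ψ i p)
      atTop (𝓝 (∫ p in strip T, f (u p.1 p.2) (nonlocal P.kernel u p.1 p.2) * χ p)) := by
  obtain ⟨hc, hc₀, hcC, hc₀C, hrep⟩ := hf
  have heq : ∀ p : ℝ × ℝ, f (u p.1 p.2) (nonlocal P.kernel u p.1 p.2)
      = ∑ k, u p.1 p.2 k * c k (nonlocal P.kernel u p.1 p.2)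
        + c₀ (nonlocal P.kernel u p.1 p.2) := fun p =>
    hrep _ _ (nonlocal_mem_box hK h.bound p.1 p.2)
  simp only [heq]
  exact h.tendsto_integral_affine hK hc hc₀ hcC hc₀C
    (fun i n hn j => hrep _ _ (((h.run i).inRange n hn).halfR j)) hψ hΨ hψΨ hlim

/-- Limit in each term of `RunBound.discrete_weak_form`: the diffusion and slope terms disappear,
flux and source converge as products of weakly and strongly convergent factors. -/
theorem ConvergentFamily.isWeakSolution {P : BalanceSystem N m} {T ρm ρM LF L : ℝ} {G : ℕ → Grid}
    {e : ℕ → ℝ} {u : ℝ → ℝ → Fin N → ℝ} (h : ConvergentFamily P T ρM L G e u)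
    (hP : LinearAssumption P ρm ρM LF) (hT : 0 < T) (hdx1 : ∀ i, (G i).dx ≤ 1)
    (hdt1 : ∀ i, (G i).dt ≤ 1) (htrunc : Tendsto (fun i => (G i).trunc) atTop (𝓝 0)) {c : ℝ}
    (hc : ∀ i, (G i).dx / (G i).dt ≤ c) : IsWeakSolution P T u := by
  obtain ⟨K, -, hK⟩ := exists_kernelBound hP.toBaseAssumption
  have hdx : ∀ i, 0 < (G i).dx := fun i => (h.run i).dx_pos
  have hdt : ∀ i, 0 < (G i).dt := fun i => (h.run i).dt_pos
  have hρ := h.rhoM_nonneg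
  refine ⟨?_, fun k φ hφ => ?_, fun k φ hφ => ?_, fun k φ hφ => ?_⟩
  · refine memLp_top_of_bound (measurable_pi_lambda _ h.measurable).aestronglyMeasurable ρM
      (Eventually.of_forall fun p => ?_)
    exact (pi_norm_le_iff_of_nonneg hρ).2 fun k => h.bound _ _ k
  · obtain ⟨cf, c₀, C, hf⟩ := hP.exists_flux_affine k
    exact hf.integrableOn_mul hρ hK h.measurable h.bound hφ.integrable_deriv_space.integrableOn
  · obtain ⟨cf, c₀, C, hf⟩ := hP.exists_source_affine k
    obtain ⟨T', R, Lφ, M, hΦ⟩ := hφ.exists_testBound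
    have := hf.integrableOn_mul hρ hK h.measurable h.bound (hΦ.integrable.integrableOn (s := strip T))
    simpa only [mul_comm, Function.uncurry] using this
  obtain ⟨T', R, Lφ, M, hΦ⟩ := hφ.exists_testBound
  set Φ := Function.uncurry φ with hΦdef
  have hΦc := hΦ.continuous
  have hLφ := hΦ.lip_nonneg
  have hM := hΦ.bound_nonneg
  have hb0 := ballFn_nonneg R
  have hcell : ∀ i p, |cellRho P (G i) T k p| ≤ ρM := fun i p => (h.run i).abs_cellRho_le hρ k p
  have hplus : ∀ i p, |Φ (p + (0, (G i).dx)) - Φ p| ≤ Lφ * (G i).dx * ballFn R p := fun i p => by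
    have := hΦ.abs_shift_sub_le (v := (0, (G i).dx)) (by
      rw [norm_space_shift, abs_of_pos (hdx i)]
      exact hdx1 i) p
    rwa [norm_space_shift, abs_of_pos (hdx i)] at this
  have hminus : ∀ i p, |Φ (p - (0, (G i).dx)) - Φ p| ≤ Lφ * (G i).dx * ballFn R p := fun i p => by
    have := hΦ.abs_shift_sub_le (v := -(0, (G i).dx)) (by
      rw [norm_neg, norm_space_shift, abs_of_pos (hdx i)]
      exact hdx1 i) p
    rwa [norm_neg, norm_space_shift, abs_of_pos (hdx i), ← sub_eq_add_neg] at this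
  have hqplus : ∀ p, Tendsto (fun i => (Φ (p + (0, (G i).dx)) - Φ p) / (G i).dx) atTop
      (𝓝 (deriv (fun x => φ p.1 x) p.2)) := fun p =>
    hφ.tendsto_quotient_space h.dx_tendsto (fun i => (hdx i).ne') p
  have hqminus : ∀ p, Tendsto (fun i => (Φ p - Φ (p - (0, (G i).dx))) / (G i).dx) atTop
      (𝓝 (deriv (fun x => φ p.1 x) p.2)) := fun p => by
    have h1 := hφ.tendsto_quotient_space (s := fun i => -(G i).dx) (by simpa using h.dx_tendsto.neg)
      (fun i => (neg_lt_zero.2 (hdx i)).ne) p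
    refine h1.congr fun i => ?_
    have e1 : p + ((0 : ℝ), -(G i).dx) = p - (0, (G i).dx) := by
      ext <;> simp [sub_eq_add_neg]
    rw [e1, div_neg, ← neg_div, neg_sub]
  have hcdt : ∀ i, (G i).dx ≤ c * (G i).dt := fun i => (div_le_iff₀ (hdt i)).1 (hc i)
  have hc0 : 0 ≤ c := (div_pos (hdx 0) (hdt 0)).le.trans (hc 0)
  -- a combination of differences of `Φ`, divided by `Δt`, is bounded
  have hdiffbound : ∀ (α β : ℝ) i p,
      |(α * (Φ (p - (0, (G i).dx)) - Φ p) + β * (Φ (p + (0, (G i).dx)) - Φ p)) / (G i).dt|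
        ≤ (|α| + |β|) * (Lφ * c) * ballFn R p := by
    intro α β i p
    rw [abs_div, abs_of_pos (hdt i), div_le_iff₀ (hdt i)]
    refine (abs_add_le _ _).trans ?_
    rw [abs_mul, abs_mul]
    calc _ ≤ |α| * (Lφ * (G i).dx * ballFn R p) + |β| * (Lφ * (G i).dx * ballFn R p) :=
          add_le_add (mul_le_mul_of_nonneg_left (hminus i p) (abs_nonneg _))
            (mul_le_mul_of_nonneg_left (hplus i p) (abs_nonneg _))
      _ = (|α| + |β|) * Lφ * ballFn R p * (G i).dx := by ring
      _ ≤ (|α| + |β|) * Lφ * ballFn R p * (c * (G i).dt) :=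
          mul_le_mul_of_nonneg_left (hcdt i) (mul_nonneg (by positivity) (hb0 p))
      _ = _ := by ring
  -- the time derivative
  have t1 : Tendsto (fun i => ∫ p in strip T, cellRho P (G i) T k p *
      ((Φ (p - ((G i).dt, 0)) - Φ p) / (G i).dt)) atTop
      (𝓝 (∫ p in strip T, u p.1 p.2 k * (-deriv (fun t => φ t p.2) p.1))) := by
    refine (h.weak k).tendsto_mul (fun i => measurable_gridFn _ _ _) (fun i p _ => hcell i p)
      (Ψ := fun p => Lφ * ballFn R p) (fun i => ?_)
      ((integrable_ballFn R).const_mul _).integrableOn (fun i p _ => ?_)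
      (Eventually.of_forall fun p _ => ?_)
    · exact Continuous.measurable (by fun_prop)
    · have h1 := hΦ.abs_shift_sub_le (v := -((G i).dt, 0)) (by
        rw [norm_neg, norm_time_shift, abs_of_pos (hdt i)]
        exact hdt1 i) p
      rw [norm_neg, norm_time_shift, abs_of_pos (hdt i), ← sub_eq_add_neg] at h1
      rw [abs_div, abs_of_pos (hdt i), div_le_iff₀ (hdt i)]
      linarith
    · have h1 := (hφ.tendsto_quotient_time (s := fun i => -(G i).dt)
        (by simpa using h.dt_tendsto.neg) (fun i => (neg_lt_zero.2 (hdt i)).ne) p).neg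
      refine h1.congr fun i => ?_
      have e1 : p + (-(G i).dt, (0 : ℝ)) = p - ((G i).dt, 0) := by
        ext <;> simp [sub_eq_add_neg]
      rw [e1, div_neg, neg_neg]
  have t2 := tendsto_initial hP.toBaseAssumption hdx h.dx_tendsto hdt h.dt_tendsto (k := k)
    (A := ρM) (fun i j => ((h.run i).inRange 0 (by simpa using hT)).rho j k) hΦ
  -- the numerical diffusion
  have t3 : Tendsto (fun i => ∫ p in strip T, cellRho P (G i) T k p * ((1 / 4 *
      Φ (p - (0, (G i).dx)) + -1 / 2 * Φ p + 1 / 4 * Φ (p + (0, (G i).dx))) / (G i).dt)) atTop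
      (𝓝 0) := by
    have e1 : ∀ i p, (1 / 4 * Φ (p - (0, (G i).dx)) + -1 / 2 * Φ p
        + 1 / 4 * Φ (p + (0, (G i).dx))) / (G i).dt = (1 / 4 * (Φ (p - (0, (G i).dx)) - Φ p)
        + 1 / 4 * (Φ (p + (0, (G i).dx)) - Φ p)) / (G i).dt := fun i p => by ring
    simp only [e1]
    refine tendsto_integral_strip_zero (R := R) (D := ρM * ((|1 / 4| + |1 / 4|) * (Lφ * c)))
      (fun i => (measurable_gridFn _ _ _).mul (Continuous.measurable (by fun_prop)))
      (fun i p => ?_) fun p => ?_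
    · rw [abs_mul, mul_assoc]
      exact mul_le_mul (hcell i p) (hdiffbound _ _ i p) (abs_nonneg _) hρ
    · have h1 : Tendsto (fun i => ρM * (c * (1 / 4 * |(Φ (p + (0, (G i).dx)) - Φ p) / (G i).dx
          - (Φ p - Φ (p - (0, (G i).dx))) / (G i).dx|))) atTop (𝓝 0) := by
        have := ((((hqplus p).sub (hqminus p)).abs.const_mul (1 / 4)).const_mul c).const_mul ρM
        simpa using this
      refine squeeze_zero_norm (fun i => ?_) h1
      rw [norm_mul, Real.norm_eq_abs, Real.norm_eq_abs]
      refine mul_le_mul (hcell i p) ?_ (abs_nonneg _) hρ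
      -- The second difference over `Δt` is `Δx / Δt`, which is bounded, times the difference of the
      -- forward and backward quotients, which share the limit `∂ₓφ`. No second derivative of `φ` is
      -- needed.
      have e2 : (1 / 4 * (Φ (p - (0, (G i).dx)) - Φ p)
          + 1 / 4 * (Φ (p + (0, (G i).dx)) - Φ p)) / (G i).dt
          = ((G i).dx / (G i).dt) * (1 / 4 * ((Φ (p + (0, (G i).dx)) - Φ p) / (G i).dx
            - (Φ p - Φ (p - (0, (G i).dx))) / (G i).dx)) := by
        have := (hdx i).ne'
        field_simp
        ring
      rw [e2, abs_mul, abs_mul, abs_of_pos (div_pos (hdx i) (hdt i)),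
        abs_of_pos (by norm_num : (0 : ℝ) < 1 / 4)]
      exact mul_le_mul_of_nonneg_right (hc i) (by positivity)
  -- the slopes
  obtain ⟨τ, hτ⟩ := htrunc.bddAbove_range
  have hτ : ∀ i, (G i).trunc ≤ τ := fun i => hτ ⟨i, rfl⟩
  -- Differences of `Φ` over `Δt` are bounded because `Δx / Δt ≤ c`; the smallness comes only from
  -- the truncation, in place of any estimate of the variation.
  have hslope : ∀ (α β : ℝ) (a : ℕ → ℕ → ℤ → ℝ), (∀ i n j, |a i n j| ≤ (G i).trunc) →
      Tendsto (fun i => ∫ p in strip T, gridFn T (G i) (a i) p *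
        ((α * (Φ (p - (0, (G i).dx)) - Φ p) + β * (Φ (p + (0, (G i).dx)) - Φ p)) / (G i).dt))
        atTop (𝓝 0) := by
    intro α β a ha
    have htr0 : ∀ i, 0 ≤ (G i).trunc := fun i => abs_nonneg _
    have hgb : ∀ i p, |gridFn T (G i) (a i) p| ≤ (G i).trunc := fun i p =>
      abs_gridFn_le (hdt i) (htr0 i) (fun n _ j => ha i n j) p
    have hpt : ∀ i p, |gridFn T (G i) (a i) p * ((α * (Φ (p - (0, (G i).dx)) - Φ p)
        + β * (Φ (p + (0, (G i).dx)) - Φ p)) / (G i).dt)|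
        ≤ (G i).trunc * ((|α| + |β|) * (Lφ * c) * ballFn R p) := fun i p => by
      rw [abs_mul]
      exact mul_le_mul (hgb i p) (hdiffbound α β i p) (abs_nonneg _) (htr0 i)
    refine tendsto_integral_strip_zero (R := R) (D := τ * ((|α| + |β|) * (Lφ * c)))
      (fun i => (measurable_gridFn _ _ _).mul (Continuous.measurable (by fun_prop)))
      (fun i p => (hpt i p).trans ?_) fun p => ?_
    · rw [mul_assoc τ]
      exact mul_le_mul_of_nonneg_right (hτ i) (mul_nonneg (by positivity) (hb0 p))
    · exact squeeze_zero_norm (fun i => hpt i p) (by simpa using htrunc.mul_const _)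
  have t4 : Tendsto (fun i => ∫ p in strip T,
      gridFn T (G i) (fun n j => (G i).dx * slope (G i) (values P (G i) n) j k) p *
      ((-1 / 16 * Φ (p - (0, (G i).dx)) + 0 * Φ p + 1 / 16 * Φ (p + (0, (G i).dx))) / (G i).dt))
      atTop (𝓝 0) := by
    refine (hslope (-1 / 16) (1 / 16) (fun i n j => (G i).dx * slope (G i) (values P (G i) n) j k)
      fun i n j => abs_dx_mul_slope_le_trunc (hdx i) _ j k).congr fun i => ?_
    congr 1
    ext p
    ring
  have t5 : Tendsto (fun i => ∫ p in strip T, gridFn T (G i) (fun n j =>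
      (G i).dx * slope (G i) (staggered P (G i) (values P (G i) n)) j k) p *
      ((0 * Φ (p - (0, (G i).dx)) + -1 / 8 * Φ p + 1 / 8 * Φ (p + (0, (G i).dx))) / (G i).dt))
      atTop (𝓝 0) := by
    refine (hslope 0 (1 / 8) (fun i n j => (G i).dx * slope (G i) (staggered P (G i)
      (values P (G i) n)) j k) fun i n j => abs_dx_mul_slope_le_trunc (hdx i) _ j k).congr
      fun i => ?_
    congr 1
    ext p
    ring
  -- the flux
  have t6 : Tendsto (fun i => ∫ p in strip T,
      gridFn T (G i) (fun n j => halfFlux P (G i) (values P (G i) n) j k) p *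
      ((Φ (p + (0, (G i).dx)) - Φ (p - (0, (G i).dx))) / (2 * (G i).dx))) atTop
      (𝓝 (∫ p in strip T, P.flux k (u p.1 p.2 k) (nonlocal P.kernel u p.1 p.2)
        * deriv (fun x => φ p.1 x) p.2)) := by
    obtain ⟨cf, c₀, C, hf⟩ := hP.exists_flux_affine k
    refine h.tendsto_integral_of_isAffineOnBox hK hf (Ψ := fun p => Lφ * ballFn R p)
      (ψ := fun i p => (Φ (p + (0, (G i).dx)) - Φ (p - (0, (G i).dx))) / (2 * (G i).dx))
      (fun i => Continuous.measurable (by fun_prop))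
      ((integrable_ballFn R).const_mul _).integrableOn (fun i p _ => ?_)
      (Eventually.of_forall fun p _ => ?_)
    · have h2 : 0 < 2 * (G i).dx := by linarith [hdx i]
      rw [abs_div, abs_of_pos h2, div_le_iff₀ h2]
      have h3 := abs_sub_le (Φ (p + (0, (G i).dx))) (Φ p) (Φ (p - (0, (G i).dx)))
      rw [abs_sub_comm (Φ p)] at h3
      linarith [hplus i p, hminus i p]
    · have h1 := ((hqplus p).add (hqminus p)).div_const 2
      rw [add_self_div_two] at h1
      refine h1.congr fun i => ?_
      have := (hdx i).ne'
      field_simp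
      ring
  -- the source
  have t7 : Tendsto (fun i => ∫ p in strip T,
      gridFn T (G i) (fun n j => halfSource P (G i) (values P (G i) n) j k) p *
      ((Φ (p - (0, (G i).dx)) + 2 * Φ p + Φ (p + (0, (G i).dx))) / 4)) atTop
      (𝓝 (∫ p in strip T, P.source k (u p.1 p.2) (nonlocal P.kernel u p.1 p.2) * Φ p)) := by
    obtain ⟨cf, c₀, C, hf⟩ := hP.exists_source_affine k
    refine h.tendsto_integral_of_isAffineOnBox hK hf (Ψ := fun p => M * ballFn R p)
      (ψ := fun i p => (Φ (p - (0, (G i).dx)) + 2 * Φ p + Φ (p + (0, (G i).dx))) / 4)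
      (fun i => Continuous.measurable (by fun_prop))
      ((integrable_ballFn R).const_mul _).integrableOn (fun i p _ => ?_)
      (Eventually.of_forall fun p _ => ?_)
    · have h1 := abs_le.1 (hΦ.abs_shift_le (v := (0, (G i).dx)) (by
        rw [norm_space_shift, abs_of_pos (hdx i)]
        exact hdx1 i) p)
      have h2 := hΦ.abs_shift_le (v := -(0, (G i).dx)) (by
        rw [norm_neg, norm_space_shift, abs_of_pos (hdx i)]
        exact hdx1 i) p
      rw [← sub_eq_add_neg] at h2
      have h2 := abs_le.1 h2
      have h3 := abs_le.1 (hΦ.abs_le p)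
      rw [abs_le]
      constructor <;> linarith [h1.1, h1.2, h2.1, h2.2, h3.1, h3.2]
    · have h0 : Tendsto (fun i => ((0 : ℝ), (G i).dx)) atTop (𝓝 (0, 0)) :=
        tendsto_const_nhds.prodMk_nhds h.dx_tendsto
      have h1 : Tendsto (fun i => Φ (p - (0, (G i).dx))) atTop (𝓝 (Φ p)) := by
        have := (hΦc.tendsto (p - (0, 0))).comp (h0.const_sub p)
        simpa only [Prod.mk_zero_zero, sub_zero, Function.comp_def] using this
      have h2 : Tendsto (fun i => Φ (p + (0, (G i).dx))) atTop (𝓝 (Φ p)) := by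
        have := (hΦc.tendsto (p + (0, 0))).comp (h0.const_add p)
        simpa only [Prod.mk_zero_zero, add_zero, Function.comp_def] using this
      have h3 := ((h1.add (tendsto_const_nhds (x := 2 * Φ p))).add h2).div_const 4
      have e1 : (Φ p + 2 * Φ p + Φ p) / 4 = Φ p := by ring
      rwa [e1] at h3
  have hlt : 0 < T - T' := sub_pos.2 hΦ.time_lt
  have hfinal := tendsto_nhds_unique t1
    -- The discrete identity requires `T' + Δt ≤ T` and therefore holds only for small time steps.
    ((((((t2.add t3).add t4).add t5).add t6).add t7).congr' (by
      filter_upwards [h.dt_tendsto.eventually (gt_mem_nhds hlt)] with i hi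
      exact ((h.run i).discrete_weak_form hP.toBaseAssumption hT hΦ (by linarith) k).symm))
  simp only [mul_neg, integral_neg] at hfinal
  have e1 : ∫ p in strip T, φ p.1 p.2 * P.source k (u p.1 p.2) (nonlocal P.kernel u p.1 p.2)
      = ∫ p in strip T, P.source k (u p.1 p.2) (nonlocal P.kernel u p.1 p.2) * Φ p := by
    simp only [hΦdef, Function.uncurry, mul_comm]
  have e2 : ∫ x, P.initial x k * φ 0 x = ∫ x, P.initial x k * Φ (0, x) := rfl
  rw [e1, e2]
  linarith

/-! ### Existence of weak solutions -/

section Bounds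

variable {P : BalanceSystem N m} {ρm ρM LF : ℝ}

theorem BaseAssumption.exists_abs_values_zero_le (hP : BaseAssumption P ρm ρM LF) :
    ∃ b, 0 ≤ b ∧ b < ρM ∧ ∀ G : Grid, 0 < G.dx → ∀ j k, |values P G 0 j k| ≤ b := by
  obtain ⟨b, hb, hi⟩ := hP.initial_range
  refine ⟨max b 0, le_max_right _ _, max_lt hb hP.rhoM_pos, fun G hdx j k => ?_⟩
  have h1 : ∀ᵐ x, ‖P.initial x k‖ ≤ max b 0 := by
    filter_upwards [hi] with x hx
    rw [Real.norm_eq_abs, abs_of_nonneg (hP.rhom_nonneg.trans (hx k).1)]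
    exact (hx k).2.trans (le_max_left _ _)
  have h2 : ‖∫ x in Ico (((j : ℝ) - 1 / 2) * G.dx) (((j : ℝ) + 1 / 2) * G.dx), P.initial x k‖
      ≤ max b 0 * volume.real (Ico (((j : ℝ) - 1 / 2) * G.dx) (((j : ℝ) + 1 / 2) * G.dx)) :=
    norm_setIntegral_le_of_norm_le_const_ae measure_Ico_lt_top
      (ae_restrict_of_ae h1)
  rw [Real.volume_real_Ico_of_le (by nlinarith), Real.norm_eq_abs] at h2
  simp only [values]
  rw [abs_mul, abs_of_pos (one_div_pos.2 hdx), one_div, inv_mul_le_iff₀ hdx]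
  linarith

variable {K Sb : ℝ} {G : Grid} {b β : ℝ}

/-- The smallness condition on the step sizes under which the scheme stays in `[-ρM, ρM]`
as long as its values are bounded by `β`. -/
structure Grid.IsSmall (G : Grid) (N m : ℕ) (ρM LF K Sb β : ℝ) : Prop where
  dx_pos : 0 < G.dx
  dt_pos : 0 < G.dt
  dx_le : G.dx ≤ 1
  dt_le : G.dt ≤ 1
  cfl : G.ratio * LF ≤ (√2 - 1) / 2
  small : β + K * G.dx * (3 * ρM) + (1 + K * G.dx) * rateBound N m ρM LF K Sb G ≤ ρM
  trunc_le : β + G.trunc ≤ ρM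

/-- Induction on the time step: the bound for `n` is at most `β`, which puts all arguments of flux
and source in range, and this is what the one-step growth estimate needs. -/
theorem abs_values_le (hP : BaseAssumption P ρm ρM LF) (hK0 : 0 ≤ K)
    (hK : ∀ l k, KernelBound (P.kernel l k) K) (hSb0 : 0 ≤ Sb)
    (hSb : ∀ k, ∀ r ∈ box ρM, ∀ R ∈ box (N * ρM), |P.source k r R| ≤ Sb)
    (hG : G.IsSmall N m ρM LF K Sb β) (hb : ∀ j k, |values P G 0 j k| ≤ b) (n : ℕ)
    (hn : b + growthRate N m ρM LF K Sb * (n * G.dt) ≤ β) (j : ℤ) (k : Fin N) :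
    |values P G n j k| ≤ b + growthRate N m ρM LF K Sb * (n * G.dt) := by
  have hA : 0 ≤ growthRate N m ρM LF K Sb :=
    growthRate_nonneg hK0 hSb0 hP.LF_nonneg hP.rhoM_pos.le
  induction n generalizing j k with
  | zero => simpa using hb j k
  | succ n ih =>
    have h0 := mul_nonneg hA hG.dt_pos.le
    push_cast at hn ⊢
    have hn' : b + growthRate N m ρM LF K Sb * (n * G.dt) ≤ β := by nlinarith
    have h1 := abs_step_le hP hK hSb hG.dx_pos hG.dt_pos
      (inRange_of_abs_le hP hK hSb0 hSb hG.dx_pos hG.dt_pos hK0 hG.small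
        fun j k => (ih hn' j k).trans hn')
      hK0 hSb0 hG.dx_le hG.dt_le hG.cfl (ih hn') j k
    exact h1.trans_eq (by ring)

theorem RunBound.of_isSmall (hP : BaseAssumption P ρm ρM LF) (hK0 : 0 ≤ K)
    (hK : ∀ l k, KernelBound (P.kernel l k) K) (hSb0 : 0 ≤ Sb)
    (hSb : ∀ k, ∀ r ∈ box ρM, ∀ R ∈ box (N * ρM), |P.source k r R| ≤ Sb)
    (hG : G.IsSmall N m ρM LF K Sb β) {T c : ℝ} (hc : G.dx ≤ c * G.dt)
    (hv : ∀ n : ℕ, n * G.dt < T → ∀ j k, |values P G n j k| ≤ β) :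
    RunBound P G T ρM (K * (5 * ρM + growthRate N m ρM LF K Sb) * c + Sb)
      (rateBound N m ρM LF K Sb G) := by
  have hA : 0 ≤ growthRate N m ρM LF K Sb :=
    growthRate_nonneg hK0 hSb0 hP.LF_nonneg hP.rhoM_pos.le
  have hr : ∀ n : ℕ, n * G.dt < T → InRange P G ρM (values P G n) := fun n hn =>
    inRange_of_abs_le hP hK hSb0 hSb hG.dx_pos hG.dt_pos hK0 hG.small (hv n hn)
  refine ⟨hG.dx_pos, hG.dt_pos, hr, fun n hn l k x => ?_, fun n hn j k => ?_⟩
  · refine (abs_integral_step_sub_le hP hK hSb hG.dx_pos hG.dt_pos (hr n hn) hK0 hSb0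
      hG.dx_le hG.dt_le hG.cfl (hK l k) k x).trans ?_
    -- Since `Δx ≤ c Δt`, a change of order `Δx` per step is still a Lipschitz bound in time.
    have h1 := mul_le_mul_of_nonneg_left hc
      (mul_nonneg hK0 (by linarith [hP.rhoM_pos] : 0 ≤ 5 * ρM + growthRate N m ρM LF K Sb))
    linarith
  · exact abs_dt_mul_discRate_le hP hK hSb hG.dx_pos hG.dt_pos (hr n hn).rho (hr n hn).discR j k

end Bounds

theorem tendsto_rateBound (N m : ℕ) {ρM LF K Sb : ℝ} (hρ : 0 ≤ ρM) (hK : 0 ≤ K)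
    (hLF : 0 ≤ LF) {G : ℕ → Grid} (hdx : ∀ i, 0 < (G i).dx) (hdt : ∀ i, 0 < (G i).dt)
    (hcfl : ∀ i, (G i).ratio * LF ≤ (√2 - 1) / 2)
    (hdt0 : Tendsto (fun i => (G i).dt) atTop (𝓝 0))
    (htrunc : Tendsto (fun i => (G i).trunc) atTop (𝓝 0)) :
    Tendsto (fun i => rateBound N m ρM LF K Sb (G i)) atTop (𝓝 0) := by
  have hratio : ∀ i, 0 ≤ (G i).ratio := fun i => div_nonneg (hdt i).le (hdx i).le
  have htr : ∀ i, 0 ≤ (G i).trunc := fun i => abs_nonneg _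
  have hdx' : ∀ i, 0 ≤ 2 * ρM + m * (N * (3 * K * (G i).dx * (3 * ρM))) := fun i => by
    have := (hdx i).le
    positivity
  have h1 : Tendsto (fun i => min ((G i).ratio * (G i).trunc)
      ((G i).ratio * LF * (2 * ρM + m * (N * (3 * K * (G i).dx * (3 * ρM)))))) atTop (𝓝 0) := by
    -- For `LF = 0` the CFL condition gives no bound on the ratio, but the second argument of the
    -- minimum vanishes. For `LF > 0` the ratio is bounded and the truncation tends to zero.
    rcases hLF.eq_or_lt with rfl | hLF
    · refine tendsto_const_nhds.congr fun i => ?_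
      rw [mul_zero, zero_mul, min_eq_right (mul_nonneg (hratio i) (htr i))]
    · refine squeeze_zero (g := fun i => (√2 - 1) / 2 / LF * (G i).trunc)
        (fun i => le_min (mul_nonneg (hratio i) (htr i))
          (mul_nonneg (mul_nonneg (hratio i) hLF.le) (hdx' i)))
        (fun i => (min_le_left _ _).trans (mul_le_mul_of_nonneg_right ?_ (htr i)))
        (by simpa using htrunc.const_mul ((√2 - 1) / 2 / LF))
      rw [le_div_iff₀ hLF]
      exact hcfl i
  simpa [rateBound] using (hdt0.mul_const Sb).add h1

/-! ### Piecewise linear against piecewise constant approximations -/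

section Approx

variable {P : BalanceSystem N m} {G : Grid} {T : ℝ} {k : Fin N}

theorem measurable_approx (P : BalanceSystem N m) (G : Grid) (k : Fin N) :
    Measurable fun p : ℝ × ℝ => approx P G p.1 p.2 k := by
  have h1 : Measurable fun p : ℝ × ℝ => (⌊p.1 / G.dt⌋₊, ⌊p.2 / G.dx + 1 / 2⌋) :=
    (Nat.measurable_floor.comp (measurable_fst.div_const _)).prodMk
      (Int.measurable_floor.comp ((measurable_snd.div_const _).add_const _))
  have h2 : ∀ a : ℕ × ℤ → ℝ, Measurable fun p : ℝ × ℝ =>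
      a (⌊p.1 / G.dt⌋₊, ⌊p.2 / G.dx + 1 / 2⌋) := fun a => (measurable_of_countable a).comp h1
  exact (h2 fun q => values P G q.1 q.2 k).add ((h2 fun q => slope G (values P G q.1) q.2 k).mul
    (measurable_snd.sub ((h2 fun q => q.2).mul_const _)))

theorem abs_approx_sub_cellRho_le (hdx : 0 < G.dx) {p : ℝ × ℝ} (hp : p ∈ strip T) :
    |approx P G p.1 p.2 k - cellRho P G T k p| ≤ G.trunc := by
  rw [cellRho, gridFn_of_mem hp]
  simp only [approx, cellIdx, add_sub_cancel_left]
  have h1 := abs_dx_mul_slope_le_trunc hdx (values P G ⌊p.1 / G.dt⌋₊) (cellIdx G.dx p.2) k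
  have h2 := abs_sub_cellIdx_le hdx p.2
  simp only [cellIdx] at h1 h2
  refine le_trans ?_ h1
  rw [abs_mul, abs_mul, mul_comm, abs_of_pos hdx]
  exact mul_le_mul_of_nonneg_right (by linarith) (abs_nonneg _)

theorem abs_cellRho_le {β : ℝ} (hβ : 0 ≤ β) (hdt : 0 < G.dt)
    (hv : ∀ n : ℕ, n * G.dt < T → ∀ j k, |values P G n j k| ≤ β) (p : ℝ × ℝ) :
    |cellRho P G T k p| ≤ β :=
  abs_gridFn_le hdt hβ (fun n hn j => hv n hn j k) p

end Approx

/-- Bounded functions with measurable components belong to `L^∞`. -/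
theorem memLinf_of_abs_le {T M : ℝ} (hM : 0 ≤ M) {u : ℝ → ℝ → Fin N → ℝ}
    (hu : ∀ k, Measurable fun p : ℝ × ℝ => u p.1 p.2 k)
    (hb : ∀ p ∈ strip T, ∀ k, |u p.1 p.2 k| ≤ M) : MemLinf T u := by
  refine memLp_top_of_bound (measurable_pi_iff.2 hu).aestronglyMeasurable M ?_
  filter_upwards [ae_restrict_mem (measurableSet_strip T)] with p hp
  exact (pi_norm_le_iff_of_nonneg hM).2 fun k => hb p hp k

/-- Approximate solutions that obey uniform bounds converge to a weak solution along a
subsequence. -/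
theorem exists_weakStar_isWeakSolution {P : BalanceSystem N m} {ρm ρM LF : ℝ}
    (hP : LinearAssumption P ρm ρM LF) {T L β c : ℝ} (hT : 0 < T) (hL : 0 ≤ L) (hβ : 0 ≤ β)
    {G : ℕ → Grid} {e : ℕ → ℝ} (hrun : ∀ i, RunBound P (G i) T ρM L (e i))
    (hdx1 : ∀ i, (G i).dx ≤ 1) (hdt1 : ∀ i, (G i).dt ≤ 1)
    (hdx0 : Tendsto (fun i => (G i).dx) atTop (𝓝 0))
    (hdt0 : Tendsto (fun i => (G i).dt) atTop (𝓝 0)) (he0 : Tendsto e atTop (𝓝 0))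
    (htr0 : Tendsto (fun i => (G i).trunc) atTop (𝓝 0))
    (hv : ∀ i, ∀ n : ℕ, n * (G i).dt < T → ∀ j k, |values P (G i) n j k| ≤ β)
    (htr : ∀ i, β + (G i).trunc ≤ ρM) (hc : ∀ i, (G i).dx / (G i).dt ≤ c) :
    ∃ (θ : ℕ → ℕ) (u : ℝ → ℝ → Fin N → ℝ), StrictMono θ ∧
      WeakStarTendsto T (fun i => approx P (G (θ i))) u ∧ IsWeakSolution P T u := by
  have hρ := hP.rhoM_pos.le
  have hab : ∀ i, ∀ p ∈ strip T, ∀ k, |approx P (G i) p.1 p.2 k| ≤ ρM := fun i p hp k => by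
    have h1 := abs_approx_sub_cellRho_le (P := P) (k := k) (hrun i).dx_pos hp
    have h2 := abs_cellRho_le (k := k) hβ (hrun i).dt_pos (hv i) p
    have h3 := abs_sub_abs_le_abs_sub (approx P (G i) p.1 p.2 k) (cellRho P (G i) T k p)
    linarith [htr i]
  obtain ⟨θ, hθ, g, hgm, hgb, hg⟩ := exists_weakStar_subseq_family
    (μ := volume.restrict (strip T)) hρ (f := fun i p k => approx P (G i) p.1 p.2 k)
    (fun i k => (measurable_approx P (G i) k).aestronglyMeasurable) fun i k => by
      filter_upwards [ae_restrict_mem (measurableSet_strip T)] with p hp using hab i p hp k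
  refine ⟨θ, fun t x k => g (t, x) k, hθ, ⟨fun i => ?_, ?_, hg⟩, ?_⟩
  · exact memLinf_of_abs_le hρ (measurable_approx P _) (hab (θ i))
  · exact memLinf_of_abs_le hρ hgm fun p _ k => hgb p k
  · have hθ' := hθ.tendsto_atTop
    have hfam : ConvergentFamily P T ρM L (fun i => G (θ i)) (fun i => e (θ i))
        (fun t x k => g (t, x) k) :=
      { run := fun i => hrun (θ i)
        rhoM_nonneg := hρ
        L_nonneg := hL
        dx_tendsto := hdx0.comp hθ'
        dt_tendsto := hdt0.comp hθ'
        e_tendsto := he0.comp hθ'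
        measurable := hgm
        bound := fun t x k => hgb (t, x) k
        weak := fun k => WeakConv.congr_of_tendsto_zero
          (f := fun i p => approx P (G (θ i)) p.1 p.2 k) (fun h hh => hg k h hh)
          (fun i => measurable_approx P _ k) (fun i => measurable_gridFn _ _ _)
          (fun i p hp => hab (θ i) p hp k) (htr0.comp hθ') fun i p hp => by
            rw [abs_sub_comm]
            exact abs_approx_sub_cellRho_le (hrun (θ i)).dx_pos hp }
    exact hfam.isWeakSolution hP hT (fun i => hdx1 _) (fun i => hdt1 _) (htr0.comp hθ')
      fun i => hc (θ i)

end NonlocalNT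

end

/-! ### The main theorem: choice of the time -/

theorem mainTheorem2 {N m : ℕ} (P : NonlocalNT.BalanceSystem N m) (ρm ρM LF : ℝ)
    (hP : NonlocalNT.LinearAssumption P ρm ρM LF) (T : ℝ) (hT : 0 < T) :
    ∃ Tstar : ℝ, 0 < Tstar ∧ Tstar ≤ T ∧
      ∀ (C δ : ℝ), 0 < C → 0 < δ → δ < 1 →
      ∀ (dx dt : ℕ → ℝ), (∀ i, 0 < dx i) → (∀ i, 0 < dt i) →
        Tendsto dx atTop (𝓝 0) → Tendsto dt atTop (𝓝 0) →
        (∀ i, dt i / dx i * LF ≤ (Real.sqrt 2 - 1) / 2) →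
        (∃ c : ℝ, 0 < c ∧ ∀ i, c ≤ dt i / dx i) →
      ∃ (θ : ℕ → ℕ) (ρ : ℝ → ℝ → Fin N → ℝ), StrictMono θ ∧
        NonlocalNT.WeakStarTendsto Tstar
          (fun i => NonlocalNT.approx P ⟨dx (θ i), dt (θ i), C, δ⟩) ρ ∧
        NonlocalNT.IsWeakSolution P Tstar ρ := by
  open NonlocalNT in
  have hB := hP.toBaseAssumption
  obtain ⟨K, hK0, hK⟩ := exists_kernelBound hB
  obtain ⟨Sb, hSb0, hSb⟩ := hB.exists_source_bound
  obtain ⟨b, hb0, hb, hinit⟩ := hB.exists_abs_values_zero_le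
  set A := growthRate N m ρM LF K Sb
  have hA : 0 ≤ A := growthRate_nonneg hK0 hSb0 hB.LF_nonneg hB.rhoM_pos.le
  -- The gap `β - b` is spent on growth in time; the gap `ρM - β` absorbs the slopes, the predictor
  -- step and the quadrature error once the grid is fine.
  obtain ⟨β, hbβ, hβ⟩ := exists_between hb
  -- `A` may vanish, hence `A + 1`. The time depends only on the system and its constants, as it
  -- must be chosen before `C`, `δ` and the step sizes.
  have hTs : 0 < (β - b) / (A + 1) := div_pos (sub_pos.2 hbβ) (by linarith)
  refine ⟨min T ((β - b) / (A + 1)), lt_min hT hTs, min_le_left _ _, ?_⟩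
  intro C δ hC hδ _ dx dt hdx hdt hdx0 hdt0 hcfl ⟨c, hc, hcr⟩
  set G : ℕ → Grid := fun i => ⟨dx i, dt i, C, δ⟩ with hGdef
  have htr0 : Tendsto (fun i => (G i).trunc) atTop (𝓝 0) := by
    have h1 := ((hdx0.rpow_const (Or.inr hδ.le)).const_mul C).abs
    rwa [Real.zero_rpow hδ.ne', mul_zero, abs_zero] at h1
  have hrate := tendsto_rateBound N m (Sb := Sb) hB.rhoM_pos.le hK0 hB.LF_nonneg (G := G) hdx hdt hcfl
    hdt0 htr0
  have hsmall : Tendsto (fun i => β + K * (G i).dx * (3 * ρM)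
      + (1 + K * (G i).dx) * rateBound N m ρM LF K Sb (G i)) atTop (𝓝 β) := by
    have h1 := (((hdx0.const_mul K).mul_const (3 * ρM)).const_add β).add
      (((hdx0.const_mul K).const_add 1).mul hrate)
    simpa using h1
  have hev : ∀ᶠ i in atTop, (G i).IsSmall N m ρM LF K Sb β := by
    filter_upwards [hdx0.eventually_le_const one_pos, hdt0.eventually_le_const one_pos,
      hsmall.eventually_le_const hβ, htr0.eventually_le_const (sub_pos.2 hβ)] with i h1 h2 h3 h4
    exact ⟨hdx i, hdt i, h1, h2, hcfl i, h3, by linarith⟩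
  -- The step sizes are small only eventually; the first `i₀` grids are dropped and the index shift
  -- is built into the final subsequence.
  obtain ⟨i₀, hi₀⟩ := eventually_atTop.1 hev
  have hG : ∀ i, (G (i + i₀)).IsSmall N m ρM LF K Sb β := fun i => hi₀ _ (Nat.le_add_left _ _)
  have hshift := tendsto_add_atTop_nat i₀
  have hc' : ∀ i, dx i ≤ c⁻¹ * dt i := fun i => by
    have := (le_div_iff₀ (hdx i)).1 (hcr i)
    rwa [inv_mul_eq_div, le_div_iff₀ hc, mul_comm]
  have hv : ∀ i, ∀ n : ℕ, n * (G (i + i₀)).dt < min T ((β - b) / (A + 1)) → ∀ j k,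
      |values P (G (i + i₀)) n j k| ≤ β := fun i n hn j k => by
    have h1 := (lt_div_iff₀ (by linarith : 0 < A + 1)).1 (hn.trans_le (min_le_right _ _))
    have h2 : 0 ≤ n * (G (i + i₀)).dt := mul_nonneg n.cast_nonneg (hG i).dt_pos.le
    have h3 : b + A * (n * (G (i + i₀)).dt) ≤ β := by nlinarith
    exact (abs_values_le hB hK0 hK hSb0 hSb (hG i) (hinit _ (hG i).dx_pos) n h3 j k).trans h3
  obtain ⟨θ, u, hθ, hu, hw⟩ := exists_weakStar_isWeakSolution hP (lt_min hT hTs)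
    (L := K * (5 * ρM + A) * c⁻¹ + Sb)
    (by have := hB.rhoM_pos.le; have := inv_nonneg.2 hc.le; positivity) (hb0.trans hbβ.le)
    (G := fun i => G (i + i₀))
    (fun i => RunBound.of_isSmall hB hK0 hK hSb0 hSb (hG i) (hc' (i + i₀)) (hv i))
    (fun i => (hG i).dx_le) (fun i => (hG i).dt_le) (hdx0.comp hshift) (hdt0.comp hshift)
    (hrate.comp hshift) (htr0.comp hshift) hv (fun i => (hG i).trunc_le) (c := c⁻¹)
    fun i => (div_le_iff₀ (hdt _)).2 (hc' _)
  exact ⟨fun i => θ i + i₀, u, hθ.add_const i₀, hu, hw⟩
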